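/- **Setting.** Let $A$ be a finite totally ordered alphabet with an involution $\iota:A\to A$ (formal inversion), extended to strings by $(x_1\cdots x_n)^{-1}=\iota(x_n)\cdots\iota(x_1)$. Let $R$ be a finite set of equalities between strings over $A$ containing $x\,\iota(x)=\epsilon$ and $\iota(x)\,x=\epsilon$ for each $x\in A$, and let $G$ be the group presented by $\langle A\mid R\rangle$. Write $\bar u\in G$ for the element represented by $u\in A^*$, and $<$ for the shortlex order on $A^*$: $u<v$ if $|u|<|v|$, or $|u|=|v|$ and $u$ is lexicographically smaller. With a padding symbol $\$$ ($\bar{\$}=1$), a pair $(u,v)$ of strings is read as the padded string $(u,v)^+$ over $(A\cup\{\$\})^2$, the shorter string being padded on the right. Assume that $G$ is *shortlex-automatic*: the language $L$ of shortlex-least representatives of elements of $G$ is regular, and so is the set of padded pairs $(u,v)$, $u,v\in L$, with $\overline{ux}=\bar v$ for some $x\in A\cup\{\epsilon\}$. **Automata.** A *rule* is a pair $(\lambda,\rho)$ of strings. All two-variable automata $M$ below are finite and have one initial state, which is also the only final state; their states are labelled by distinct strings, the initial state by $\epsilon$. They are recorded as their sets of labelled states and arrows. Let $\mathrm{SL2}$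 be the automaton accepting those $(u,v)$ with $u>v$, $|u|\le|v|+2$ and no common first letter, and let $\mathrm{Set}(M)=L(M)\cap L(\mathrm{SL2})$. A string is *$M$-reducible* if it has a substring that is the left-hand side of a rule of $\mathrm{Set}(M)$. *Welding* means: identify targets (sources) of equally labelled arrows with the same source (target), and the ends of every $(x,x)$-arrow starting or ending at the initial state, as long as possible; give an amalgamated state the least of the labels; then omit the $(x,x)$-arrows at the initial state. For a rule $r=(\lambda,\rho)$ with $r^+=(u_1,v_1)\cdots(u_n,v_n)$, $M(r)$ is the path with states $s_0,\dots,s_n$ and arrows $(s_{i-1},(u_i,v_i),s_i)$. **The procedure.** It keeps a finite set $S=\mathit{Considered}\sqcup\mathit{This}\sqcup\mathit{New}\sqcup\mathit{Delete}$ of rules, the automaton $\mathrm{Rules}[n]$ of the current pass $n$, and an automaton $\mathrm{WDiff}$, some of whose states and arrows are marked *needed*. *Reduction.* To reduce $w$ during pass $n$: while $w$ is $\mathrm{Rules}[n]$-reducible, take its shortest reducible prefix, then the shortest suffix $\lambda$ of this prefix that is a left-hand side in $\mathrm{Set}(\mathrm{Rules}[n])$; let $\rho$ be least with $(\lambda,\rho)\in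 S$ or, if there is no such rule in $S$, least with $(\lambda,\rho)\in\mathrm{Set}(\mathrm{Rules}[n])$; insert $(\lambda,\rho)$ into $\mathit{New}$ unless it is in $S$; replace this occurrence of $\lambda$ by $\rho$. (Reductions of labels use the same steps but insert no rules.) *Start.* For each equality $a=b$ in $R$ whose relator $ab^{-1}$ has a nonempty cyclic reduction $c$, choose rules (at least one) $(l,r)$ accepted by $\mathrm{SL2}$ such that $lr^{-1}$ is $c$ up to cyclic permutation and inversion. These and the rules $(x\iota(x),\epsilon)$, $(\iota(x)x,\epsilon)$, $x\in A$, are put into $\mathit{This}$; the other three sets are empty. In the automata $M(r)$ of these rules, identify all initial and final states (label $\epsilon$), give the other states $s_i$ pairwise distinct nonempty labels representing $\overline{u_1\cdots u_i}^{\,-1}\,\overline{v_1\cdots v_i}$, and weld. The result is $\mathrm{WDiff}=\mathrm{Rules}[1]$, all of it needed. Start with $n=1$. *Pass $n$.* 1. Minimize each rule of $\mathit{Considered}$, then rules of $\mathit{New}$ until $\mathit{New}$ is empty. 2. While $\mathit{This}$ is nonempty, move a rule $(\lambda,\rho)$ from $\mathit{This}$ to $\mathit{Considered}$. For each rule in $\mathit{Considered}$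 (including this one) and each overlap, in either order, of a nonempty suffix of one left-hand side with a prefix of the other, say $\lambda_1=s_1z$, $\lambda_2=zs_2$, reduce $\rho_1s_2$ and $s_1\rho_2$; if the results differ, insert them, greater one first, as a rule into $\mathit{New}$, unless it is in $S$. 3. Delete from $\mathrm{WDiff}$ all that is not needed. While some label is $\mathrm{WDiff}$-reducible, replace all labels by their reductions (with $\mathrm{Rules}[n]$ replaced by $\mathrm{WDiff}$), identify states with equal labels, and weld. The result is $\mathrm{Rules}[n+1]$ and the new $\mathrm{WDiff}$, with nothing marked needed. Empty $\mathit{Delete}$ and go to pass $n+1$. *Minimizing $(\lambda,\rho)$.* Put $(u,v)=(\lambda,\rho)$, $u=u_1\cdots u_p$, $v=v_1\cdots v_q$ (with current values throughout). (i) Reduce $u_1\cdots u_{p-1}$ inside $u$; if $u$ is unchanged, reduce $u_2\cdots u_p$ inside $u$; if $u$ has now changed, reduce $u$. (ii) While $p>q+2$, or $p=q+2$, $q>0$ and $u_1>v_1$, replace $(u,v)$ by $(u_1\cdots u_{p-1},v\,\iota(u_p))$. (iii) If $p=q+2$ and $u_2>\iota(u_1)$, replace $(u,v)$ by $(u_2\cdots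 u_p,\iota(u_1)v)$. (iv) Cancel common first letters, then common last letters. (v) Reduce $v$. (vi) If $v>u$, interchange them. (vii) If (ii)–(vi) changed $(u,v)$, repeat them; otherwise output $(u,v)$. If the output is not $(\epsilon,\epsilon)$, sew it into $\mathrm{WDiff}$. If the output is $(\lambda,\rho)$, move it to $\mathit{This}$ in case it was in $\mathit{New}$. Otherwise insert the output into $\mathit{This}$, unless it is $(\epsilon,\epsilon)$ or in $S$; remove $(\lambda,\rho)$ from $\mathit{Considered}$ or $\mathit{New}$, and put it into $\mathit{Delete}$ if (i) did not change $u$. *Sewing $r$.* Read $r^+$ into $\mathrm{WDiff}$ from the initial state forwards as far as possible, then the remaining letters from the final state backwards as far as possible. For the letters $(x,y)$ still remaining, successively adjoin an arrow from the current state, with label $w$, to the state labelled by the reduction of $\iota(x)\,w\,y$ (omitting $y$ if $y=\$$), creating this state if necessary. Mark all states and arrows met as needed, identify the two states finally reached, and weld. (A state or arrow resulting from identifications is needed if one of those identified was.) Loops over sets may run in any order, and the procedure is never stopped. Let $S_t$ be the set $S$ after $t$ steps (a step being the minimization of one rule, the treatment of one overlap, the move of one rule to $\mathit{Considered}$, or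 a change of stage or pass), and let $P=\bigcap_t\bigcup_{s\ge t}S_s$. **Theorem.** For all choices of the initial rules and labels and all orders of processing, every pass ends, and there is $n_0$ such that $\mathrm{Rules}[n+1]=\mathrm{Rules}[n]$ for all $n\ge n_0$. Moreover, $P$ is the language of a two-variable finite state automaton explicitly constructed from $M=\mathrm{Rules}[n_0]$: the deterministic automaton $D(M)$ that combines the subset automaton of $M$, the automaton $\mathrm{SL2}$, and copies of the subset automaton of the evident nondeterministic automaton accepting the $M$-reducible strings (which guesses the beginning of a left-hand side and the second components of letters on an accepted path of $M\times\mathrm{SL2}$), and that accepts exactly those padded $(u,v)^+$ with $(u,v)\in\mathrm{Set}(M)$ for which $v$, $u$ without its last letter, and $u$ without its first letter are not $M$-reducible. Thus $L(D(M))=\{(\lambda,\rho)^+ : (\lambda,\rho)\in P\}$. -/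

import Mathlib

namespace KnuthBendix

noncomputable section

open scoped Classical

universe u v

/-! ### Strings, rules, rewriting, the shortlex order -/

/-- A rule is a pair `(left-hand side, right-hand side)` of strings over `A`. -/
abbrev Rule (A : Type u) := List A × List A

/-- The elementary reduction `u → v` of the rewrite system `R`. -/
def Rewrites {A : Type u} (R : Set (Rule A)) (u v : List A) : Prop :=
  ∃ x y : List A, ∃ r ∈ R, u = x ++ r.1 ++ y ∧ v = x ++ r.2 ++ y

/-- The Thue congruence generated by `R`. -/
def Thue {A : Type u} (R : Set (Rule A)) : List A → List A → Prop :=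
  Relation.EqvGen (Rewrites R)

/-- The strict shortlex order on strings induced by the order of the alphabet. -/
def SLt {A : Type u} [LinearOrder A] (u v : List A) : Prop :=
  List.Shortlex (· < ·) u v

theorem sLt_wf {A : Type u} [LinearOrder A] [Fintype A] :
    WellFounded (SLt (A := A)) :=
  List.Shortlex.wf wellFounded_lt

/-- The shortlex-least element of a nonempty set of strings (`[]` for the empty set). -/
def slMin {A : Type u} [LinearOrder A] [Fintype A] (T : Set (List A)) : List A :=
  if h : T.Nonempty then sLt_wf.min T h else []

/-- `u` contains the left-hand side of a rule of `T`. -/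
def Reducible {A : Type u} (T : Set (Rule A)) (u : List A) : Prop :=
  ∃ r ∈ T, r.1 <:+: u

/-- Apply `f` repeatedly until `done` holds (all the loops below do halt). -/
def iterUntil {α : Type u} (done : α → Prop) (f : α → α) (a : α) : α :=
  f^[sInf {k : ℕ | done (f^[k] a)}] a

/-- The formal inverse of a string, `ι` being the formal inverse of letters. -/
def inv {A : Type u} (ι : A → A) (u : List A) : List A := (u.map ι).reverse

/-! ### Padded pairs, shortlex-automatic groups -/

/-- Letters of two-variable automata; `none` is the padding symbol. -/
abbrev Letter (A : Type u) := Option A × Option A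

/-- The padded string of a pair of strings: the shorter one is padded at its right end. -/
def pad {A : Type u} (u v : List A) : List (Letter A) := List.zipWithAll Prod.mk u v

/-- The group element represented by a string. -/
def val {A : Type u} {G : Type v} [Group G] (γ : A → G) (u : List A) : G := (u.map γ).prod

/-- `γ : A → G` exhibits `G` as the group presented by the alphabet `A` and the
equalities `R`. -/
def IsPresentation {A : Type u} {G : Type v} [Group G] (γ : A → G) (R : Set (Rule A)) : Prop :=
  (∀ g : G, ∃ u : List A, val γ u = g) ∧ ∀ u v : List A, val γ u = val γ v ↔ Thue R u v

/-- `G` is automatic with respect to the monoid generators `γ : A → G`,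
with word acceptor accepting `L`. -/
def IsAutomatic {A : Type u} {G : Type v} [Group G] (γ : A → G) (L : Language A) : Prop :=
  (∀ x : A, ∃ y : A, γ y = (γ x)⁻¹) ∧ L.IsRegular ∧ (∀ g : G, ∃ w ∈ L, val γ w = g) ∧
    Language.IsRegular ({z | ∃ u ∈ L, ∃ v ∈ L,
      (val γ u = val γ v ∨ ∃ x : A, val γ (u ++ [x]) = val γ v) ∧ z = pad u v} :
        Language (Letter A))

/-- `G` is shortlex-automatic with respect to the ordered generators `γ : A → G`. -/
def IsShortlexAutomatic {A : Type u} [LinearOrder A] {G : Type v} [Group G] (γ : A → G) :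
    Prop :=
  ∃ L : Language A, IsAutomatic γ L ∧
    ∀ w : List A, w ∈ L ↔ ∀ w' : List A, val γ w' = val γ w → ¬ SLt w' w

/-! ### Two-variable automata whose states are labelled by strings -/

/-- An arrow `(source, letter, target)`; states are identified with their labels, which are
pairwise distinct strings. -/
abbrev Arrow (A : Type u) := List A × Letter A × List A

/-- A rule automaton. Its unique initial state, which is also its unique final state, is the
state labelled `[]`. The automata that occur are trim, so that every other state is an end of an
arrow, and the automaton is recorded by its arrows. -/
abbrev RuleAut (A : Type u) := Finset (Arrow A)

/-- The states of a rule automaton. -/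
def states {A : Type u} (M : RuleAut A) : Finset (List A) :=
  {[]} ∪ M.image (fun a => a.1) ∪ M.image (fun a => a.2.2)

/-- A rule automaton as an acceptor. -/
def toNFA {A : Type u} (M : RuleAut A) : NFA (Letter A) (List A) where
  step s a := {t | (s, a, t) ∈ M}
  start := {[]}
  accept := {[]}

/-- The arrows of the five-state automaton `SL2` (states `1, …, 5` are written `0, …, 4`). -/
def sl2Step {A : Type u} [LinearOrder A] : Fin 5 → Letter A → Option (Fin 5)
  | 0, (some x, some y) => if y < x then some 1 else if x < y then some 2 else none
  | 0, (some _, none) => some 3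
  | 1, (some _, some _) => some 1
  | 1, (some _, none) => some 3
  | 2, (some _, some _) => some 2
  | 2, (some _, none) => some 3
  | 3, (some _, none) => some 4
  | _, _ => none

/-- The final states of `SL2`. -/
def sl2Final : Set (Fin 5) := {1, 3, 4}

/-- `SL2` accepts the pairs `(u, v)` without common first letter, with `u` shortlex-greater than
`v` and `|v| ≤ |u| ≤ |v| + 2`. -/
def SL2 (A : Type u) [LinearOrder A] : NFA (Letter A) (Fin 5) where
  step q a := {q' | sl2Step q a = some q'}
  start := {0}
  accept := sl2Final

/-- `Set(M) = L(M) ∩ L(SL2)`, the rules implicitly stored in `M`. -/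
def ruleSet {A : Type u} [LinearOrder A] (M : RuleAut A) : Set (Rule A) :=
  {r | pad r.1 r.2 ∈ (toNFA M).accepts ∧ pad r.1 r.2 ∈ (SL2 A).accepts}

/-! ### Welding -/

/-- The identifications of states made when `E` is welded, after an additional identification of
the two states in `j`: targets (sources) of equally labelled arrows with identified sources
(targets) are identified, and so are the ends of each `(x, x)`-arrow that starts or ends at the
initial state. -/
inductive WeldRel {A : Type u} (E : RuleAut A) (j : List A × List A) : List A → List A → Prop
  | refl (s : List A) : WeldRel E j s s
  | symm {s t : List A} : WeldRel E j s t → WeldRel E j t s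
  | trans {s t w : List A} : WeldRel E j s t → WeldRel E j t w → WeldRel E j s w
  | join : WeldRel E j j.1 j.2
  | forward {s s' t t' : List A} {a : Letter A} :
      (s, a, t) ∈ E → (s', a, t') ∈ E → WeldRel E j s s' → WeldRel E j t t'
  | backward {s s' t t' : List A} {a : Letter A} :
      (s, a, t) ∈ E → (s', a, t') ∈ E → WeldRel E j t t' → WeldRel E j s s'
  | diagSource {s t : List A} {x : A} :
      (s, (some x, some x), t) ∈ E → WeldRel E j s [] → WeldRel E j t []
  | diagTarget {s t : List A} {x : A} :
      (s, (some x, some x), t) ∈ E → WeldRel E j t [] → WeldRel E j s []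

/-- The label of an amalgamated state: the shortlex-least of the labels. -/
def weldLabel {A : Type u} [LinearOrder A] [Fintype A] (E : RuleAut A) (j : List A × List A)
    (s : List A) : List A :=
  slMin {t | WeldRel E j s t}

/-- The image of a set `F` of arrows of `E` under welding; `(x, x)`-arrows at the initial state
are omitted. -/
def weldImage {A : Type u} [LinearOrder A] [Fintype A] (E : RuleAut A) (j : List A × List A)
    (F : Finset (Arrow A)) : Finset (Arrow A) :=
  (F.image fun a => (weldLabel E j a.1, a.2.1, weldLabel E j a.2.2)).filter
    fun a => ¬ (a.1 = [] ∧ ∃ x : A, a.2.1 = (some x, some x))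

/-! ### The finite set `S` of explicit rules, and R-reduction -/

/-- The explicit rules, `S`, as a union of four sets. -/
structure Store (A : Type u) where
  considered : Finset (Rule A)
  this : Finset (Rule A)
  new : Finset (Rule A)
  delete : Finset (Rule A)

/-- The set `S` itself. -/
def Store.all {A : Type u} (S : Store A) : Finset (Rule A) :=
  S.considered ∪ S.this ∪ S.new ∪ S.delete

/-- Insert a rule in `New` unless it is already in `S`. -/
def Store.addNew {A : Type u} (S : Store A) (r : Rule A) : Store A :=
  if r ∈ S.all then S else { S with new := insert r S.new }

/-- One step of R-reduction of a reducible string: take the shortest reducible prefix, then its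
shortest suffix `lhs` that is the left-hand side of a rule of `Set(M)`, and replace it by the
least `rhs` such that `(lhs, rhs)` is in `S` or, if there is none, in `Set(M)`. The rule used is
inserted in `New` unless it is already in `S`. -/
def rStep {A : Type u} [LinearOrder A] [Fintype A] (M : RuleAut A) (c : Store A × List A) :
    Store A × List A :=
  let pre := c.2.take (sInf {m : ℕ | Reducible (ruleSet M) (c.2.take m)})
  let k := sInf {k : ℕ | ∃ r ∈ ruleSet M, r.1 <:+ pre ∧ r.1.length = k}
  let lhs := pre.drop (pre.length - k)
  let rhs :=
    if ∃ ρ : List A, (lhs, ρ) ∈ c.1.all then slMin {ρ | (lhs, ρ) ∈ c.1.all}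
    else slMin {ρ | (lhs, ρ) ∈ ruleSet M}
  (c.1.addNew (lhs, rhs), pre.take (pre.length - k) ++ rhs ++ c.2.drop pre.length)

/-- R-reduction with respect to `M` of the string `c.2`, with current store `c.1`. -/
def rReduce {A : Type u} [LinearOrder A] [Fintype A] (M : RuleAut A) (c : Store A × List A) :
    Store A × List A :=
  iterUntil (fun c => ¬ Reducible (ruleSet M) c.2) (rStep M) c

/-! ### The minimization routine -/

/-- Reduce the maximal proper prefix of `u`; if this changes nothing, reduce the maximal proper
suffix; if `u` has changed, reduce `u`. -/
def minimizeLeft {A : Type u} [LinearOrder A] [Fintype A] (M : RuleAut A) (S : Store A)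
    (u : List A) : Store A × List A :=
  let c := rReduce M (S, u.dropLast)
  let u₁ := c.2 ++ u.getLast?.toList
  let d := rReduce M (c.1, u.tail)
  let e := if u₁ = u then (d.1, u.head?.toList ++ d.2) else (c.1, u₁)
  if e.2 = u then e else rReduce M e

/-- `u = u'x` is more than two letters longer than `v`, or two letters longer with a greater
first letter. -/
def TooLong {A : Type u} [LinearOrder A] (p : Rule A) : Prop :=
  p.2.length + 2 < p.1.length ∨
    (p.1.length = p.2.length + 2 ∧ ∃ x y : A, p.1.head? = some x ∧ p.2.head? = some y ∧ y < x)

/-- Move last letters of `u` to the right-hand side, as long as the pair is `TooLong`. -/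
def balanceRight {A : Type u} [LinearOrder A] (ι : A → A) (p : Rule A) : Rule A :=
  iterUntil (fun p => ¬ TooLong p)
    (fun p => (p.1.dropLast, p.2 ++ (p.1.getLast?.map ι).toList)) p

/-- Move the first letter `u₁` of `u` to the right-hand side if `|u| = |v| + 2` and
`u₂ > ι(u₁)`. -/
def balanceLeft {A : Type u} [LinearOrder A] (ι : A → A) (p : Rule A) : Rule A :=
  if p.1.length = p.2.length + 2 ∧ ∃ x y : A, p.1[0]? = some x ∧ p.1[1]? = some y ∧ ι x < y then
    (p.1.tail, (p.1.head?.map ι).toList ++ p.2)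
  else p

/-- Cancel equal first letters as long as possible. -/
def cancelLeft {A : Type u} (p : Rule A) : Rule A :=
  iterUntil (fun p => ¬ (p.2 ≠ [] ∧ p.1.head? = p.2.head?)) (fun p => (p.1.tail, p.2.tail)) p

/-- Cancel equal last letters as long as possible. -/
def cancelRight {A : Type u} (p : Rule A) : Rule A :=
  iterUntil (fun p => ¬ (p.2 ≠ [] ∧ p.1.getLast? = p.2.getLast?))
    (fun p => (p.1.dropLast, p.2.dropLast)) p

/-- One round of the loop of the minimization routine: balance, cancel, reduce the right-hand
side, and interchange the sides if the right-hand side is the greater one. -/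
def minimizeRound {A : Type u} [LinearOrder A] [Fintype A] (ι : A → A) (M : RuleAut A)
    (c : Store A × Rule A) : Store A × Rule A :=
  let p := cancelRight (cancelLeft (balanceLeft ι (balanceRight ι c.2)))
  let d := rReduce M (c.1, p.2)
  (d.1, if SLt p.1 d.2 then (d.2, p.1) else (p.1, d.2))

/-- The loop, applied to the pair that is current after `minimizeLeft`: rounds are repeated until
one of them does not change the pair. -/
def minimizeLoop {A : Type u} [LinearOrder A] [Fintype A] (ι : A → A) (M : RuleAut A)
    (c : Store A × Rule A) : Store A × Rule A :=
  iterUntil (fun c => (minimizeRound ι M c).2 = c.2) (minimizeRound ι M) c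

/-! ### Sewing a rule into `WDiff` -/

/-- Read letters forwards from a state as far as possible: the arrows used, the state reached,
and the letters that remain. -/
def readForward {A : Type u} (E : RuleAut A) :
    List A → List (Letter A) → List (Arrow A) × List A × List (Letter A)
  | s, [] => ([], s, [])
  | s, a :: l =>
    if h : ∃ t, (s, a, t) ∈ E then
      let c := readForward E h.choose l
      ((s, a, h.choose) :: c.1, c.2)
    else ([], s, a :: l)

/-- Read letters backwards, against the arrows, as far as possible. -/
def readBackward {A : Type u} (E : RuleAut A) :
    List A → List (Letter A) → List (Arrow A) × List A × List (Letter A)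
  | t, [] => ([], t, [])
  | t, a :: l =>
    if h : ∃ s, (s, a, t) ∈ E then
      let c := readBackward E h.choose l
      ((h.choose, a, t) :: c.1, c.2)
    else ([], t, a :: l)

/-- The new arrows for the letters that remain, and the last state. The target of an arrow
labelled `(x, y)` with source `w` is the state labelled by the reduction of `x⁻¹ w y` (a new state,
if there is none with this label). -/
def newArrows {A : Type u} (ι : A → A) (red : List A → List A) :
    List A → List (Letter A) → List (Arrow A) × List A
  | s, [] => ([], s)
  | s, a :: l =>
    let t := red ((a.1.map ι).toList ++ s ++ a.2.toList)
    let c := newArrows ι red t l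
    ((s, a, t) :: c.1, c.2)

/-- `WDiff` as a rule automaton, with the set of those arrows that are marked as needed (the
needed states are the ends of the needed arrows, and the initial state). -/
structure WDiff (A : Type u) where
  arrows : RuleAut A
  needed : Finset (Arrow A)

/-- Weld, after identifying the two states in `j`. -/
def WDiff.weld {A : Type u} [LinearOrder A] [Fintype A] (W : WDiff A) (j : List A × List A) :
    WDiff A :=
  ⟨weldImage W.arrows j W.arrows, weldImage W.arrows j W.needed⟩

/-- Adjoin a rule to the language accepted by `WDiff`. -/
def sew {A : Type u} [LinearOrder A] [Fintype A] (ι : A → A) (red : List A → List A)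
    (W : WDiff A) (r : Rule A) : WDiff A :=
  let f := readForward W.arrows [] (pad r.1 r.2)
  let b := readBackward W.arrows [] f.2.2.reverse
  let m := newArrows ι red f.2.1 b.2.2.reverse
  WDiff.weld
    ⟨W.arrows ∪ m.1.toFinset, W.needed ∪ f.1.toFinset ∪ b.1.toFinset ∪ m.1.toFinset⟩
    (m.2, b.2.1)

/-- Replace all labels of `E` by their R-reductions with respect to `Set(E)`, identify states with
the same label, and weld. -/
def relabel {A : Type u} [LinearOrder A] [Fintype A] (S : Store A) (E : RuleAut A) : RuleAut A :=
  let red := fun w : List A => (rReduce E (S, w)).2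
  let F := E.image fun a => (red a.1, a.2.1, red a.2.2)
  weldImage F ([], []) F

/-- Repeat this until all labels are irreducible with respect to the rules of the automaton. -/
def normalize {A : Type u} [LinearOrder A] [Fintype A] (S : Store A) (E : RuleAut A) :
    RuleAut A :=
  iterUntil (fun E => ∀ s ∈ states E, ¬ Reducible (ruleSet E) s) (relabel S) E

/-! ### The main loop -/

/-- A configuration of the procedure. `todo` holds the rules of `Considered` that still have to be
minimized in the current pass. `comparing` tells whether the pass has reached the stage where
rules of `This` are compared for overlaps with those of `Considered`, and `pairs` holds the
critical pairs that have been found and not yet been resolved. -/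
structure Config (A : Type u) where
  pass : ℕ
  rules : RuleAut A
  wdiff : WDiff A
  store : Store A
  todo : Finset (Rule A)
  comparing : Bool
  pairs : Finset (List A × List A)

/-- Minimize the rule `r` of `Considered` or `New`, and handle the output. -/
def minimizeRule {A : Type u} [LinearOrder A] [Fintype A] (ι : A → A) (c : Config A)
    (r : Rule A) : Config A :=
  let l := minimizeLeft c.rules c.store r.1
  let o := minimizeLoop ι c.rules (l.1, (l.2, r.2))
  let S := o.1
  let out := o.2
  let W :=
    if out = ([], []) then c.wdiff
    else sew ι (fun w => (rReduce c.rules (S, w)).2) c.wdiff out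
  let S' : Store A :=
    if out = r then
      if r ∈ S.new then { S with new := S.new.erase r, this := insert r S.this } else S
    else
      { considered := S.considered.erase r
        new := S.new.erase r
        this := if out = ([], []) ∨ out ∈ S.all then S.this else insert out S.this
        delete := if l.2 = r.1 then insert r S.delete else S.delete }
  { c with wdiff := W, store := S', todo := c.todo.erase r }

/-- The pairs obtained from the overlaps of a suffix of the left-hand side of `r` with a prefix of
the left-hand side of `r'`, by applying either rule. -/
def overlaps {A : Type u} (r r' : Rule A) : Finset (List A × List A) :=
  ((Finset.Icc 1 (min r.1.length r'.1.length)).filter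
      fun k => r.1.drop (r.1.length - k) = r'.1.take k).image
    fun k => (r.2 ++ r'.1.drop k, r.1.take (r.1.length - k) ++ r'.2)

/-- R-reduce both strings; if the results differ, they form a rule, which is inserted in `New`
unless it is already in `S`. -/
def resolve {A : Type u} [LinearOrder A] [Fintype A] (M : RuleAut A) (S : Store A)
    (p : List A × List A) : Store A :=
  let c := rReduce M (S, p.1)
  let d := rReduce M (c.1, p.2)
  if c.2 = d.2 then d.1
  else if SLt d.2 c.2 then d.1.addNew (c.2, d.2)
  else d.1.addNew (d.2, c.2)

/-- Move `r` from `This` to `Considered` and compare it for overlaps with all rules there. -/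
def compare {A : Type u} (c : Config A) (r : Rule A) : Config A :=
  let C := insert r c.store.considered
  { c with
    store := { c.store with this := c.store.this.erase r, considered := C }
    pairs := C.biUnion fun r' => overlaps r r' ∪ overlaps r' r }

/-- End the current pass and begin the next one: what is not needed is removed from `WDiff`, the
labels are normalized, the result becomes the next automaton `Rules`, and the rules in `Delete` are
deleted. -/
def nextPass {A : Type u} [LinearOrder A] [Fintype A] (c : Config A) : Config A :=
  let M := normalize c.store c.wdiff.needed
  { pass := c.pass + 1
    rules := M
    wdiff := ⟨M, ∅⟩
    store := { c.store with delete := ∅ }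
    todo := c.store.considered
    comparing := false
    pairs := ∅ }

/-- One step of the procedure. Where a loop runs through a set, `pick` tells which element is
processed next. -/
def step {A : Type u} [LinearOrder A] [Fintype A] (ι : A → A)
    (pick : Finset (List A × List A) → List A × List A) (c : Config A) : Config A :=
  if c.comparing = false then
    if c.todo.Nonempty then minimizeRule ι c (pick c.todo)
    else if c.store.new.Nonempty then minimizeRule ι c (pick c.store.new)
    else { c with comparing := true }
  else
    if c.pairs.Nonempty then
      { c with
        store := resolve c.rules c.store (pick c.pairs)
        pairs := c.pairs.erase (pick c.pairs) }
    else if c.store.this.Nonempty then compare c (pick c.store.this)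
    else nextPass c

/-! ### Initial arrangements -/

/-- One step of cyclic reduction of a string. -/
def CyclicStep {A : Type u} (ι : A → A) (w w' : List A) : Prop :=
  (∃ (p q : List A) (x : A), w = p ++ [x, ι x] ++ q ∧ w' = p ++ q) ∨
    ∃ (m : List A) (x : A), w = [x] ++ m ++ [ι x] ∧ w' = m

/-- `c` is the result of cyclic reduction of `w`. -/
def IsCyclicReduction {A : Type u} (ι : A → A) (w c : List A) : Prop :=
  Relation.ReflTransGen (CyclicStep ι) w c ∧ ∀ c', ¬ CyclicStep ι c c'

/-- The rule `(l, r)` is accepted by `SL2`, and `l r⁻¹` is the relator `c`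
up to cyclic permutation and inversion. -/
def RuleOfRelator {A : Type u} [LinearOrder A] (ι : A → A) (c : List A) (r : Rule A) : Prop :=
  pad r.1 r.2 ∈ (SL2 A).accepts ∧ (r.1 ++ inv ι r.2 ~r c ∨ r.1 ++ inv ι r.2 ~r inv ι c)

/-- `I` is a set of initial rules obtained from the equalities `R`: it consists of the special
rules `(x ι(x), ε)`, `(ι(x) x, ε)`, and of rules `(l, r)` written for the nonempty cyclic
reductions of the relators of `R`. (The relators of the special rules reduce to `ε`.) -/
def IsInitialRules {A : Type u} [LinearOrder A] (ι : A → A) (R I : Finset (Rule A)) : Prop :=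
  (∀ x : A, ([x, ι x], []) ∈ I ∧ ([ι x, x], []) ∈ I) ∧
  (∀ e ∈ R, ∀ c : List A, IsCyclicReduction ι (e.1 ++ inv ι e.2) c → c ≠ [] →
    ∃ r ∈ I, RuleOfRelator ι c r) ∧
  ∀ r ∈ I, (∃ x : A, r = ([x, ι x], []) ∨ r = ([ι x, x], [])) ∨
    ∃ e ∈ R, ∃ c : List A, IsCyclicReduction ι (e.1 ++ inv ι e.2) c ∧ c ≠ [] ∧
      RuleOfRelator ι c r

/-- Labels for the automata `M(r)` of the initial rules, the `i`-th state of `M(r)` being labelled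
`ℓ r i`: the first and the last states have the label `[]`, all others have pairwise distinct
nonempty labels, and each label represents the group element associated to its state. -/
def IsInitialLabelling {A : Type u} {G : Type v} [Group G] (γ : A → G) (I : Finset (Rule A))
    (ℓ : Rule A → ℕ → List A) : Prop :=
  (∀ r ∈ I, ℓ r 0 = [] ∧ ℓ r (pad r.1 r.2).length = []) ∧
  (∀ r ∈ I, ∀ i, 0 < i → i < (pad r.1 r.2).length → ℓ r i ≠ [] ∧
    val γ (ℓ r i) = (val γ (r.1.take i))⁻¹ * val γ (r.2.take i) ∧
    ∀ r' ∈ I, ∀ i', 0 < i' → i' < (pad r'.1 r'.2).length → ℓ r i = ℓ r' i' → r = r' ∧ i = i')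

/-- The union of the labelled automata `M(r)`, `r ∈ I`. -/
def initialUnion {A : Type u} (I : Finset (Rule A)) (ℓ : Rule A → ℕ → List A) : RuleAut A :=
  I.biUnion fun r =>
    ((pad r.1 r.2).zipIdx.map fun a => (ℓ r a.2, a.1, ℓ r (a.2 + 1))).toFinset

/-- The configuration at the beginning of the first pass. -/
def initialConfig {A : Type u} [LinearOrder A] [Fintype A] (I : Finset (Rule A))
    (ℓ : Rule A → ℕ → List A) : Config A :=
  let U := initialUnion I ℓ
  let M := weldImage U ([], []) U
  { pass := 1
    rules := M
    wdiff := ⟨M, M⟩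
    store := ⟨∅, I, ∅, ∅⟩
    todo := ∅
    comparing := false
    pairs := ∅ }

/-- The configuration at time `t`. -/
def run {A : Type u} [LinearOrder A] [Fintype A] (ι : A → A) (I : Finset (Rule A))
    (ℓ : Rule A → ℕ → List A)
    (pick : ℕ → Finset (List A × List A) → List A × List A) : ℕ → Config A
  | 0 => initialConfig I ℓ
  | t + 1 => step ι (pick t) (run ι I ℓ pick t)

/-- The limiting rule set `P = ⋂ₜ ⋃_{s ≥ t} Sₛ` of a sequence of configurations. -/
def limitRules {A : Type u} (σ : ℕ → Config A) : Set (Rule A) :=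
  {r | ∀ t, ∃ s, t ≤ s ∧ r ∈ (σ s).store.all}

/-! ### The automaton constructed from the limiting automaton `Rules` -/

/-- A nondeterministic automaton accepting the `Set(M)`-reducible strings. It loops at its start
until it guesses the beginning of a left-hand side, then it follows an accepted path of the product
of `M` and `SL2`, guessing the second components of the letters; `none` is its absorbing
final state. -/
def redNFA {A : Type u} [LinearOrder A] (M : RuleAut A) :
    NFA A (Option ({s : List A // s ∈ states M} × Fin 5)) where
  step p x :=
    match p with
    | none => {none}
    | some (s, q) =>
      {p' | (s.1 = [] ∧ q = 0 ∧ p' = some (s, q)) ∨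
        ∃ (y : Option A) (s' : {s : List A // s ∈ states M}) (q' : Fin 5),
          (s.1, (some x, y), s'.1) ∈ M ∧ sl2Step q (some x, y) = some q' ∧
            (p' = some (s', q') ∨ (s'.1 = [] ∧ q' ∈ sl2Final ∧ p' = none))}
  start := {p | ∃ s : {s : List A // s ∈ states M}, s.1 = [] ∧ p = some (s, 0)}
  accept := {none}

/-- The deterministic automaton accepting the `Set(M)`-reducible strings, by the subset
construction. -/
abbrev redDFA {A : Type u} [LinearOrder A] (M : RuleAut A) :
    DFA A (Set (Option ({s : List A // s ∈ states M} × Fin 5))) :=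
  (redNFA M).toDFA

/-- States of `redDFA M`. -/
abbrev RedState {A : Type u} (M : RuleAut A) :=
  Set (Option ({s : List A // s ∈ states M} × Fin 5))

/-- A state of `permanentDFA M` after a padded pair `(u, v)` has been read. The components are the
set of states of `M` reached; the state of `SL2` reached (`none` if it has failed); and the states
of `redDFA M` after reading `v`, after `u`, after `u` without its last letter, and after `u` without
its first letter (`none` at the beginning). -/
abbrev PermState {A : Type u} (M : RuleAut A) :=
  Set {s : List A // s ∈ states M} × Option (Fin 5) ×
    RedState M × RedState M × RedState M × Option (RedState M)

/-- The deterministic two-variable automaton accepting those `(u, v)` in `Set(M)` for which `v`,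
`u` without its last letter, and `u` without its first letter are `Set(M)`-irreducible. -/
def permanentDFA {A : Type u} [LinearOrder A] (M : RuleAut A) : DFA (Letter A) (PermState M) where
  step p a :=
    match p, a with
    | (s, q, dv, du, _, ds), (some x, y) =>
      ({t | ∃ s' ∈ s, (s'.1, (some x, y), t.1) ∈ M},
        q.bind fun q' => sl2Step q' (some x, y),
        (match y with | none => dv | some y' => (redDFA M).step dv y'),
        (redDFA M).step du x,
        du,
        some (match ds with | none => (redDFA M).start | some d => (redDFA M).step d x))
    | (_, _, dv, du, dp, ds), (none, _) => (∅, none, dv, du, dp, ds)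
  start := ({s | s.1 = []}, some 0, (redDFA M).start, (redDFA M).start, (redDFA M).start, none)
  accept := {p | (∃ s ∈ p.1, s.1 = []) ∧ (∃ q ∈ sl2Final, p.2.1 = some q) ∧
    p.2.2.1 ∉ (redDFA M).accept ∧ p.2.2.2.2.1 ∉ (redDFA M).accept ∧
    ∃ d ∉ (redDFA M).accept, p.2.2.2.2.2 = some d}

end

end KnuthBendix

/-!
Call a string least if it is the shortlex-least representative of its group element, and call a
rule `(λ, ρ)` minimal (`IsMinimal`) if `λ` is not least but its proper substrings are, `ρ` is least,
and both sides represent the same element. The theorem holds because in the long run the procedure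
keeps exactly the minimal rules, and the automaton `Rules` consists exactly of the paths of
the minimal rules, with their states labelled by least strings.

*Permanent rules.* A rule is permanent if it belongs to `S` from some time on. Whenever a rule is
replaced by the minimization routine, it remains derivable, without leaving the strings
up to its left-hand side in the shortlex order, from rules that precede it in a well-founded order
(`Minimizes.derivable`, `Steps.inv`). Therefore all rules of `S` derive from permanent ones
(`IsRun.supersedes_permanent`), and the permanent rules present the group. The minimization of
a permanent rule returns the rule itself, since otherwise the rule would be deleted at the end of
the pass. Hence its right-hand side and the proper substrings of its left-hand side are irreducible
in all late passes; and as the rule is sewn into `WDiff`, its left-hand side is reducible in all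
late passes. In particular no permanent left-hand side properly contains another one; and the
critical pairs of permanent rules are connected below their overlaps, because these overlaps have
been treated. By the critical pair theorem (`HasConnectedOverlaps.join`) the permanent rules are
confluent. So every string that is not least is reducible by a permanent rule, and is reducible in
all late passes, whence the permanent rules are the minimal ones (`IsRun.mem_permanent_iff`).

*Stabilization.* The labels along the path of a minimal rule do not increase from one pass to the
next one, by `sew_spec` and `normalize_spec`: all the operations on automata are foldings which do
not increase labels. These labels are bounded, and they are irreducible with respect to the current
automaton. As every string that is not least becomes reducible, they become least
(`IsRun.eventually_walk_leastRep`). The group is shortlex-automatic, so minimal rules have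
finitely many word differences, and there are finitely many arrows on paths of minimal rules
with least labels (`finite_limitArrows`). Once `Rules` contains all these arrows, reducible means
not least. From then on minimization returns minimal rules only, sewing them in has no effect other
than marking the arrows of their paths, and the marked arrows at the end of a pass are exactly
those of the paths of minimal rules (`IsRun.eventually_rules_eq`). Also, no rule that is not minimal
is inserted any more, so the limit `P` of the sets `S` is the set of minimal rules
(`IsRun.limitRules_eq`).

*Termination of a pass.* The rules inserted while a rule of `New` is minimized have smaller
left-hand sides, so the Dershowitz–Manna order on multisets shows that `New` becomes empty.
-/

namespace KnuthBendix

set_option linter.unusedSectionVars false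

noncomputable section

open scoped Classical
open Filter

universe u v

variable {A : Type u} [LinearOrder A] [Fintype A]

/-! ### The rank of a string in the shortlex order -/

theorem sLt_trans {u v w : List A} (h₁ : SLt u v) (h₂ : SLt v w) : SLt u w := by
  unfold SLt at *
  rw [List.shortlex_def] at *
  rcases h₁ with h₁ | ⟨h₁, h₁'⟩ <;> rcases h₂ with h₂ | ⟨h₂, h₂'⟩
  · left; omega
  · left; omega
  · left; omega
  · exact Or.inr ⟨h₁.trans h₂, lt_trans (α := List A) h₁' h₂'⟩

theorem sLt_irrefl (u : List A) : ¬ SLt u u := by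
  unfold SLt
  intro h
  exact asymm h h

theorem sLt_trichotomy (u v : List A) : SLt u v ∨ u = v ∨ SLt v u :=
  trichotomous_of (List.Shortlex (· < ·)) u v

theorem finite_sLt (w : List A) : {u | SLt u w}.Finite := by
  refine (List.finite_length_le A w.length).subset fun u hu => ?_
  rcases List.shortlex_def.1 hu with h | h
  · exact h.le
  · exact h.1.le

/-- The position of a string in the shortlex order, which has order type `ω` or is finite. -/
def rank (w : List A) : ℕ := {u | SLt u w}.ncard

theorem rank_lt_of_sLt {u v : List A} (h : SLt u v) : rank u < rank v :=
  Set.ncard_lt_ncard ⟨fun _ hw => sLt_trans hw h, fun hs => sLt_irrefl u (hs h)⟩ (finite_sLt v)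

theorem rank_lt_iff {u v : List A} : rank u < rank v ↔ SLt u v := by
  refine ⟨fun h => ?_, rank_lt_of_sLt⟩
  rcases sLt_trichotomy u v with h' | rfl | h'
  · exact h'
  · omega
  · have := rank_lt_of_sLt h'
    omega

theorem rank_injective : Function.Injective (rank (A := A)) := by
  intro u v h
  rcases sLt_trichotomy u v with h' | h' | h'
  · have := rank_lt_of_sLt h'
    omega
  · exact h'
  · have := rank_lt_of_sLt h'
    omega

theorem rank_nil : rank ([] : List A) = 0 := by
  simp [rank, SLt]

theorem eq_nil_of_rank_le {u : List A} (h : rank u ≤ rank ([] : List A)) : u = [] :=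
  rank_injective (by rw [rank_nil] at *; omega)

theorem rank_lt_of_length_lt {u v : List A} (h : u.length < v.length) : rank u < rank v :=
  rank_lt_of_sLt (List.Shortlex.of_length_lt h)

theorem length_le_of_rank_le {u v : List A} (h : rank u ≤ rank v) : u.length ≤ v.length := by
  by_contra h'
  have := rank_lt_of_length_lt (not_le.1 h')
  omega

theorem rank_lt_cons_cons {x y : A} {u v : List A} (hl : u.length = v.length) :
    rank (x :: u) < rank (y :: v) ↔ x < y ∨ x = y ∧ rank u < rank v := by
  rw [rank_lt_iff, rank_lt_iff]
  unfold SLt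
  rw [List.shortlex_iff_lex (by simpa using hl), List.shortlex_iff_lex hl]
  constructor
  · intro h
    cases h with
    | cons h => exact Or.inr ⟨rfl, h⟩
    | rel h => exact Or.inl h
  · rintro (h | ⟨rfl, h⟩)
    · exact List.Lex.rel h
    · exact List.Lex.cons h

theorem lex_append_right_of_length_eq {u v : List A} (hl : u.length = v.length)
    (h : List.Lex (· < ·) u v) (y : List A) : List.Lex (· < ·) (u ++ y) (v ++ y) := by
  induction h with
  | nil => simp at hl
  | cons _ ih => exact List.Lex.cons (ih (by simpa using hl))
  | rel h => exact List.Lex.rel h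

theorem rank_append_lt {u v : List A} (h : rank u < rank v) (x y : List A) :
    rank (x ++ u ++ y) < rank (x ++ v ++ y) := by
  rw [rank_lt_iff] at *
  have h' : SLt (u ++ y) (v ++ y) := by
    rcases List.shortlex_def.1 h with h | ⟨h, h'⟩
    · exact List.Shortlex.of_length_lt (by simpa using h)
    · exact List.Shortlex.of_lex (by simpa using h) (lex_append_right_of_length_eq h h' y)
  simpa using! List.Shortlex.append_left h' x

theorem rank_append_le {u v : List A} (h : rank u ≤ rank v) (x y : List A) :
    rank (x ++ u ++ y) ≤ rank (x ++ v ++ y) := by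
  rcases h.lt_or_eq with h | h
  · exact (rank_append_lt h x y).le
  · rw [rank_injective h]

theorem rank_le_of_infix {u v : List A} (h : u <:+: v) : rank u ≤ rank v := by
  rcases h.length_le.lt_or_eq with h' | h'
  · exact (rank_lt_of_length_lt h').le
  · rw [h.eq_of_length h']

theorem rank_lt_of_infix {u v : List A} (h : u <:+: v) (h' : u ≠ v) : rank u < rank v :=
  lt_of_le_of_ne (rank_le_of_infix h) fun e => h' (rank_injective e)

theorem slMin_mem {T : Set (List A)} (h : T.Nonempty) : slMin T ∈ T := by
  rw [slMin, dif_pos h]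
  exact WellFounded.min_mem _ _ h

theorem rank_slMin_le {T : Set (List A)} {w : List A} (h : w ∈ T) : rank (slMin T) ≤ rank w := by
  rw [slMin, dif_pos ⟨w, h⟩]
  by_contra h'
  exact WellFounded.not_lt_min sLt_wf _ h (rank_lt_iff.1 (not_le.1 h'))

/-! ### Rewriting paths with bounded nodes -/

/-- Every rule of `T` has a shortlex-smaller right-hand side. -/
def Decreasing (T : Set (Rule A)) : Prop := ∀ r ∈ T, rank r.2 < rank r.1

/-- `a` and `b` are joined by a path of elementary reductions of `T`, in either direction, all of
whose nodes have rank less than `n`. (The trivial path is allowed for all `a`.) -/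
def Conn (T : Set (Rule A)) (n : ℕ) : List A → List A → Prop :=
  Relation.ReflTransGen fun a b =>
    rank a < n ∧ rank b < n ∧ (Rewrites T a b ∨ Rewrites T b a)

theorem Conn.refl {T : Set (Rule A)} {n : ℕ} (a : List A) : Conn T n a a :=
  Relation.ReflTransGen.refl

theorem Conn.trans {T : Set (Rule A)} {n : ℕ} {a b c : List A} (h₁ : Conn T n a b)
    (h₂ : Conn T n b c) : Conn T n a c :=
  Relation.ReflTransGen.trans h₁ h₂

theorem Conn.symm {T : Set (Rule A)} {n : ℕ} {a b : List A} (h : Conn T n a b) :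
    Conn T n b a := by
  induction h with
  | refl => exact Conn.refl _
  | tail _ h₂ ih => exact Relation.ReflTransGen.head ⟨h₂.2.1, h₂.1, h₂.2.2.symm⟩ ih

theorem Rewrites.append {T : Set (Rule A)} {a b : List A} (h : Rewrites T a b) (x y : List A) :
    Rewrites T (x ++ a ++ y) (x ++ b ++ y) := by
  obtain ⟨p, q, r, hr, rfl, rfl⟩ := h
  exact ⟨x ++ p, q ++ y, r, hr, by simp, by simp⟩

theorem Rewrites.rank_lt {T : Set (Rule A)} (hT : Decreasing T) {a b : List A}
    (h : Rewrites T a b) : rank b < rank a := by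
  obtain ⟨p, q, r, hr, rfl, rfl⟩ := h
  exact rank_append_lt (hT r hr) p q

theorem Conn.of_rule {T : Set (Rule A)} {n : ℕ} {r : Rule A} (hr : r ∈ T)
    (h₁ : rank r.1 < n) (h₂ : rank r.2 < n) : Conn T n r.1 r.2 :=
  Relation.ReflTransGen.single ⟨h₁, h₂, Or.inl ⟨[], [], r, hr, by simp, by simp⟩⟩

theorem Conn.append_bound {T : Set (Rule A)} {n m : ℕ} {a b : List A} (h : Conn T n a b)
    (x y : List A) (hm : ∀ w, rank w < n → rank (x ++ w ++ y) < m) :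
    Conn T m (x ++ a ++ y) (x ++ b ++ y) := by
  refine Relation.ReflTransGen.lift (fun w => x ++ w ++ y) ?_ _ _ h
  rintro a b ⟨h₁, h₂, h₃⟩
  exact ⟨hm a h₁, hm b h₂, h₃.imp (fun h => h.append x y) fun h => h.append x y⟩

theorem Conn.append {T : Set (Rule A)} {o a b : List A} (h : Conn T (rank o) a b)
    (x y : List A) : Conn T (rank (x ++ o ++ y)) (x ++ a ++ y) (x ++ b ++ y) :=
  h.append_bound x y fun _ hw => rank_append_lt hw x y

theorem Conn.append_succ {T : Set (Rule A)} {o a b : List A} (h : Conn T (rank o + 1) a b)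
    (x y : List A) : Conn T (rank (x ++ o ++ y) + 1) (x ++ a ++ y) (x ++ b ++ y) :=
  h.append_bound x y fun _ hw => Nat.lt_succ_of_le (rank_append_le (Nat.le_of_lt_succ hw) x y)

/-- The rules of a path may be replaced by paths that do not exceed their left-hand sides. -/
theorem Conn.bind {T T' : Set (Rule A)} {n : ℕ} {a b : List A} (h : Conn T n a b)
    (hT : ∀ r ∈ T, rank r.1 < n → Conn T' (rank r.1 + 1) r.1 r.2) : Conn T' n a b := by
  have key : ∀ a b, rank a < n → Rewrites T a b → Conn T' n a b := by
    rintro _ _ ha ⟨x, y, r, hr, rfl, rfl⟩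
    have h₁ : rank r.1 ≤ rank (x ++ r.1 ++ y) := rank_le_of_infix ⟨x, y, rfl⟩
    refine (hT r hr (by omega)).append_bound x y fun w hw => ?_
    have := rank_append_le (Nat.le_of_lt_succ hw) x y
    omega
  induction h with
  | refl => exact Conn.refl _
  | tail _ h₂ ih =>
    obtain ⟨h₃, h₄, h₅ | h₅⟩ := h₂
    · exact ih.trans (key _ _ h₃ h₅)
    · exact ih.trans (key _ _ h₄ h₅).symm

theorem Conn.mono {T T' : Set (Rule A)} {n n' : ℕ} {a b : List A} (h : Conn T n a b)
    (hT : T ⊆ T') (hn : n ≤ n') : Conn T' n' a b := by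
  refine Relation.ReflTransGen.mono ?_ _ _ h
  rintro a b ⟨h₁, h₂, h₃⟩
  refine ⟨by omega, by omega, ?_⟩
  rcases h₃ with ⟨x, y, r, hr, h⟩ | ⟨x, y, r, hr, h⟩
  · exact Or.inl ⟨x, y, r, hT hr, h⟩
  · exact Or.inr ⟨x, y, r, hT hr, h⟩

/-- Only rules whose left-hand side is within the bound occur on a path. -/
theorem Conn.of_bounded {T T' : Set (Rule A)} (hd : Decreasing T) {n : ℕ} {a b : List A}
    (h : Conn T n a b) (hT : ∀ r ∈ T, rank r.1 < n → r ∈ T') : Conn T' n a b :=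
  h.bind fun r hr hn => Conn.of_rule (hT r hr hn) (by omega) (by have := hd r hr; omega)

/-- A number that is monotone for the lexicographic order on decreasing rules. -/
def weight (r : Rule A) : ℕ := rank r.1 ^ 2 + rank r.2

theorem weight_lt_of_fst_lt {r r' : Rule A} (hr' : rank r'.2 < rank r'.1)
    (h : rank r'.1 < rank r.1) : weight r' < weight r := by
  unfold weight
  nlinarith

theorem weight_lt_of_snd_lt {r r' : Rule A} (h₁ : r'.1 = r.1)
    (h₂ : rank r'.2 < rank r.2) : weight r' < weight r := by
  unfold weight
  rw [h₁]
  omega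

/-- The two sides of `r` are joined by a path that does not exceed the left-hand side and uses
only rules of `T` that precede `r`. -/
def Derivable (T : Set (Rule A)) (r : Rule A) : Prop :=
  Conn {r' ∈ T | weight r' < weight r} (rank r.1 + 1) r.1 r.2

theorem Derivable.conn {T : Set (Rule A)} {r : Rule A} (h : Derivable T r) :
    Conn T (rank r.1 + 1) r.1 r.2 :=
  h.mono (fun _ h => h.1) le_rfl

/-- `T'` contains or derives all rules of `T`. -/
def Supersedes (T' T : Set (Rule A)) : Prop := ∀ r ∈ T, r ∈ T' ∨ Derivable T' r

theorem Derivable.supersedes {T T' : Set (Rule A)} (hd : Decreasing T) (hs : Supersedes T' T)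
    {r : Rule A} (h : Derivable T r) : Derivable T' r := by
  refine Conn.bind h ?_
  rintro r' ⟨hr', hw⟩ -
  rcases hs r' hr' with h' | h'
  · exact Conn.of_rule ⟨h', hw⟩ (by omega) (by have := hd r' hr'; omega)
  · exact Conn.mono h' (fun r'' h'' => ⟨h''.1, by have := h''.2; omega⟩) le_rfl

theorem Supersedes.refl (T : Set (Rule A)) : Supersedes T T := fun _ h => Or.inl h

theorem Supersedes.of_subset {T T' : Set (Rule A)} (h : T ⊆ T') : Supersedes T' T :=
  fun _ hr => Or.inl (h hr)

theorem Supersedes.trans {T T' T'' : Set (Rule A)} (hd : Decreasing T')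
    (h₁ : Supersedes T' T) (h₂ : Supersedes T'' T') : Supersedes T'' T := by
  intro r hr
  rcases h₁ r hr with h | h
  · exact h₂ r h
  · exact Or.inr (h.supersedes hd h₂)

theorem Conn.supersedes {T T' : Set (Rule A)} (hd : Decreasing T) (hs : Supersedes T' T)
    {n : ℕ} {a b : List A} (h : Conn T n a b) : Conn T' n a b := by
  refine h.bind fun r hr hn => ?_
  rcases hs r hr with h' | h'
  · exact Conn.of_rule h' (by omega) (by have := hd r hr; omega)
  · exact h'.conn

/-! ### Loops -/

/-- A loop halts if a measure decreases along it, and it preserves invariants. -/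
theorem iterUntil_spec {α : Type*} {done : α → Prop} {f : α → α} {P : α → Prop} (m : α → ℕ)
    (hf : ∀ a, P a → ¬ done a → P (f a) ∧ m (f a) < m a) {a : α} (ha : P a) :
    P (iterUntil done f a) ∧ done (iterUntil done f a) := by
  have hex : ∀ n a, P a → m a = n → ∃ k, done (f^[k] a) := by
    intro n
    induction n using Nat.strong_induction_on with
    | _ n ih =>
      intro a ha hn
      by_cases hd : done a
      · exact ⟨0, hd⟩
      · obtain ⟨h₁, h₂⟩ := hf a ha hd
        obtain ⟨k, hk⟩ := ih (m (f a)) (hn ▸ h₂) (f a) h₁ rfl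
        exact ⟨k + 1, hk⟩
  have hne : {k : ℕ | done (f^[k] a)}.Nonempty := hex _ a ha rfl
  refine ⟨?_, Nat.sInf_mem hne⟩
  have : ∀ k ≤ sInf {k : ℕ | done (f^[k] a)}, P (f^[k] a) := by
    intro k
    induction k with
    | zero => exact fun _ => ha
    | succ k ih =>
      intro hk
      rw [Function.iterate_succ_apply']
      exact (hf _ (ih (by omega)) (Nat.notMem_of_lt_sInf (Nat.lt_of_succ_le hk))).1
  exact this _ le_rfl

theorem iterUntil_of_done {α : Type*} {done : α → Prop} {f : α → α} {a : α} (h : done a) :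
    iterUntil done f a = a := by
  have : sInf {k : ℕ | done (f^[k] a)} = 0 := Nat.sInf_eq_zero.2 (Or.inl h)
  simp [iterUntil, this]

/-! ### Padded pairs -/

theorem getElem?_pad (u v : List A) (i : ℕ) (a : Letter A) :
    (pad u v)[i]? = some a ↔ (i < u.length ∨ i < v.length) ∧ a = (u[i]?, v[i]?) := by
  unfold pad
  rw [List.getElem?_zipWithAll]
  have hu : i < u.length ↔ u[i]?.isSome := by simp
  have hv : i < v.length ↔ v[i]?.isSome := by simp
  rw [hu, hv]
  rcases u[i]? with _ | x <;> rcases v[i]? with _ | y <;> simp [eq_comm]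

theorem length_pad (u v : List A) : (pad u v).length = max u.length v.length := by
  induction u generalizing v with
  | nil => simp [pad]
  | cons x u ih =>
    rcases v with _ | ⟨y, v⟩
    · simp [pad]
    · have := ih v
      simp only [pad, List.zipWithAll_cons_cons, List.length_cons] at *
      omega

theorem pad_cons_cons (x y : A) (u v : List A) :
    pad (x :: u) (y :: v) = (some x, some y) :: pad u v := rfl

theorem pad_cons_nil (x : A) (u : List A) :
    pad (x :: u) [] = (some x, none) :: pad u [] := by
  simp [pad]

theorem take_pad (u v : List A) (i : ℕ) : (pad u v).take i = pad (u.take i) (v.take i) := by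
  refine List.ext_getElem? fun j => ?_
  unfold pad
  simp only [List.getElem?_take, List.getElem?_zipWithAll]
  split <;> simp

theorem filterMap_fst_pad (u v : List A) : (pad u v).filterMap Prod.fst = u := by
  induction u generalizing v with
  | nil => simp [pad, List.filterMap_map]
  | cons x u ih =>
    rcases v with _ | ⟨y, v⟩
    · simp [pad_cons_nil, ih]
    · simp [pad_cons_cons, ih]

theorem filterMap_snd_pad (u v : List A) : (pad u v).filterMap Prod.snd = v := by
  induction u generalizing v with
  | nil => simp [pad, List.filterMap_map]
  | cons x u ih =>
    rcases v with _ | ⟨y, v⟩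
    · simpa [pad_cons_nil] using ih []
    · simp [pad_cons_cons, ih]

theorem pad_injective {u v u' v' : List A} (h : pad u v = pad u' v') : u = u' ∧ v = v' := by
  have h₁ := congrArg (List.filterMap Prod.fst) h
  have h₂ := congrArg (List.filterMap Prod.snd) h
  rw [filterMap_fst_pad, filterMap_fst_pad] at h₁
  rw [filterMap_snd_pad, filterMap_snd_pad] at h₂
  exact ⟨h₁, h₂⟩

/-! ### The automaton `SL2` -/

/-- The state of `SL2` reached from `q` (`none` if it has failed). -/
def sl2From (q : Option (Fin 5)) (z : List (Letter A)) : Option (Fin 5) :=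
  z.foldl (fun o a => o.bind fun q => sl2Step q a) q

/-- `SL2` accepts `z` from the state `q`. -/
def Sl2Accepts (q : Fin 5) (z : List (Letter A)) : Prop :=
  ∃ f ∈ sl2Final, sl2From (some q) z = some f

theorem sl2From_none (z : List (Letter A)) : sl2From none z = none := by
  induction z with
  | nil => rfl
  | cons a z ih => simpa [sl2From] using ih

theorem sl2Accepts_nil (q : Fin 5) : Sl2Accepts q ([] : List (Letter A)) ↔ q ∈ sl2Final := by
  simp [Sl2Accepts, sl2From]

theorem sl2Accepts_cons (q : Fin 5) (a : Letter A) (z : List (Letter A)) :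
    Sl2Accepts q (a :: z) ↔ ∃ q', sl2Step q a = some q' ∧ Sl2Accepts q' z := by
  have h : sl2From (some q) (a :: z) = sl2From (sl2Step q a) z := rfl
  unfold Sl2Accepts
  rw [h]
  rcases sl2Step q a with _ | q'
  · simp [sl2From_none]
  · simp

theorem mem_eval_SL2 (z : List (Letter A)) (q : Fin 5) :
    q ∈ (SL2 A).eval z ↔ sl2From (some 0) z = some q := by
  induction z using List.reverseRecOn generalizing q with
  | nil => simp [SL2, sl2From, eq_comm]
  | append_singleton z a ih =>
    rw [NFA.eval_append_singleton, NFA.mem_stepSet]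
    simp only [ih, sl2From, List.foldl_append, List.foldl_cons, List.foldl_nil]
    simp [SL2, Option.bind_eq_some_iff]

theorem mem_accepts_SL2 (z : List (Letter A)) : z ∈ (SL2 A).accepts ↔ Sl2Accepts 0 z := by
  rw [NFA.mem_accepts]
  exact exists_congr fun q => and_congr_right fun _ => mem_eval_SL2 z q

theorem sl2Accepts_four (z : List (Letter A)) : Sl2Accepts 4 z ↔ z = [] := by
  rcases z with _ | ⟨a, z⟩
  · simp [sl2Accepts_nil, sl2Final]
  · simp [sl2Accepts_cons, sl2Step]

theorem sl2Accepts_three (z : List (Letter A)) :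
    Sl2Accepts 3 z ↔ ∃ u, z = pad u [] ∧ u.length ≤ 1 := by
  rcases z with _ | ⟨⟨_ | x, _ | y⟩, z⟩
  · simp only [sl2Accepts_nil, sl2Final]
    exact ⟨fun _ => ⟨[], by simp [pad]⟩, fun _ => by simp⟩
  · simp only [sl2Accepts_cons, sl2Step, reduceCtorEq, false_and, exists_false, false_iff]
    rintro ⟨_ | ⟨x', u⟩, h, h'⟩ <;> simp [pad] at h
  · simp only [sl2Accepts_cons, sl2Step, reduceCtorEq, false_and, exists_false, false_iff]
    rintro ⟨_ | ⟨x', u⟩, h, h'⟩ <;> simp [pad] at h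
  · simp only [sl2Accepts_cons, sl2Step, Option.some.injEq, exists_eq_left', sl2Accepts_four]
    constructor
    · rintro rfl
      exact ⟨[x], by simp [pad]⟩
    · rintro ⟨_ | ⟨x', _ | ⟨y, u⟩⟩, h, h'⟩
      · simp [pad] at h
      · simp [pad] at h
        exact h.2
      · simp at h'
  · simp only [sl2Accepts_cons, sl2Step, reduceCtorEq, false_and, exists_false, false_iff]
    rintro ⟨_ | ⟨x', u⟩, h, h'⟩ <;> simp [pad] at h

theorem sl2Accepts_one (z : List (Letter A)) :
    Sl2Accepts 1 z ↔ ∃ u v, z = pad u v ∧ v.length ≤ u.length ∧ u.length ≤ v.length + 2 := by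
  induction z with
  | nil =>
    simp only [sl2Accepts_nil, sl2Final]
    exact ⟨fun _ => ⟨[], [], by simp [pad]⟩, fun _ => by simp⟩
  | cons a z ih =>
    rw [sl2Accepts_cons]
    constructor
    · rintro ⟨q, hq, h⟩
      rcases a with ⟨_ | x, _ | y⟩ <;> simp only [sl2Step, reduceCtorEq, Option.some.injEq] at hq
      · subst hq
        obtain ⟨u, rfl, hu⟩ := (sl2Accepts_three z).1 h
        exact ⟨x :: u, [], (pad_cons_nil x u).symm, by simp, by simpa using hu⟩
      · subst hq
        obtain ⟨u, v, rfl, h₁, h₂⟩ := ih.1 h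
        exact ⟨x :: u, y :: v, rfl, by simpa using h₁, by simp; omega⟩
    · rintro ⟨_ | ⟨x, u⟩, _ | ⟨y, v⟩, h, h₁, h₂⟩
      · simp [pad] at h
      · simp at h₁
      · rw [pad_cons_nil] at h
        obtain ⟨rfl, rfl⟩ := List.cons.inj h
        exact ⟨3, rfl, (sl2Accepts_three _).2 ⟨u, rfl, by simpa using h₂⟩⟩
      · rw [pad_cons_cons] at h
        obtain ⟨rfl, rfl⟩ := List.cons.inj h
        exact ⟨1, rfl, ih.2 ⟨u, v, rfl, by simpa using h₁, by simp at h₂; omega⟩⟩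

theorem sl2Accepts_two (z : List (Letter A)) :
    Sl2Accepts 2 z ↔ ∃ u v, z = pad u v ∧ v.length < u.length ∧ u.length ≤ v.length + 2 := by
  induction z with
  | nil =>
    simp only [sl2Accepts_nil, sl2Final]
    constructor
    · simp
    · rintro ⟨_ | ⟨x, u⟩, _ | ⟨y, v⟩, h, h₁, h₂⟩ <;> simp [pad] at h h₁
  | cons a z ih =>
    rw [sl2Accepts_cons]
    constructor
    · rintro ⟨q, hq, h⟩
      rcases a with ⟨_ | x, _ | y⟩ <;> simp only [sl2Step, reduceCtorEq, Option.some.injEq] at hq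
      · subst hq
        obtain ⟨u, rfl, hu⟩ := (sl2Accepts_three z).1 h
        exact ⟨x :: u, [], (pad_cons_nil x u).symm, by simp, by simpa using hu⟩
      · subst hq
        obtain ⟨u, v, rfl, h₁, h₂⟩ := ih.1 h
        exact ⟨x :: u, y :: v, rfl, by simpa using h₁, by simp; omega⟩
    · rintro ⟨_ | ⟨x, u⟩, _ | ⟨y, v⟩, h, h₁, h₂⟩
      · simp [pad] at h
      · simp at h₁
      · rw [pad_cons_nil] at h
        obtain ⟨rfl, rfl⟩ := List.cons.inj h
        exact ⟨3, rfl, (sl2Accepts_three _).2 ⟨u, rfl, by simpa using h₂⟩⟩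
      · rw [pad_cons_cons] at h
        obtain ⟨rfl, rfl⟩ := List.cons.inj h
        exact ⟨2, rfl, ih.2 ⟨u, v, rfl, by simpa using h₁, by simp at h₂; omega⟩⟩

/-- The pairs accepted by `SL2`. -/
def Balanced (u v : List A) : Prop :=
  rank v < rank u ∧ u.length ≤ v.length + 2 ∧ ¬ (v ≠ [] ∧ u.head? = v.head?)

theorem rank_lt_cons_cons_of_ne {x y : A} (hxy : x ≠ y) (u v : List A) :
    rank (x :: u) < rank (y :: v) ↔
      u.length < v.length ∨ u.length = v.length ∧ x < y := by
  rcases lt_trichotomy u.length v.length with h | h | h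
  · have : rank (x :: u) < rank (y :: v) := rank_lt_of_length_lt (by simpa using h)
    tauto
  · rw [rank_lt_cons_cons h]
    simp [hxy, h]
  · have : rank (y :: v) < rank (x :: u) := rank_lt_of_length_lt (by simpa using h)
    constructor
    · omega
    · omega

theorem sl2Accepts_zero (z : List (Letter A)) :
    Sl2Accepts 0 z ↔ ∃ u v, z = pad u v ∧ Balanced u v := by
  rcases z with _ | ⟨a, z⟩
  · simp only [sl2Accepts_nil, sl2Final]
    constructor
    · simp
    · rintro ⟨_ | ⟨x, u⟩, _ | ⟨y, v⟩, h, h₁, h₂⟩ <;> simp [pad] at h h₁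
  rw [sl2Accepts_cons]
  constructor
  · rintro ⟨q, hq, h⟩
    rcases a with ⟨_ | x, _ | y⟩ <;> simp only [sl2Step, reduceCtorEq, Option.some.injEq] at hq
    · subst hq
      obtain ⟨u, rfl, hu⟩ := (sl2Accepts_three z).1 h
      exact ⟨x :: u, [], (pad_cons_nil x u).symm, rank_lt_of_length_lt (by simp),
        by simpa using hu, by simp⟩
    · split_ifs at hq with h₁ h₂
      · cases hq
        obtain ⟨u, v, rfl, h₃, h₄⟩ := (sl2Accepts_one z).1 h
        refine ⟨x :: u, y :: v, rfl, ?_, by simp; omega, ?_⟩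
        · rw [rank_lt_cons_cons_of_ne h₁.ne]
          rcases h₃.lt_or_eq with h₃ | h₃
          · exact Or.inl h₃
          · exact Or.inr ⟨h₃, h₁⟩
        · simpa using h₁.ne'
      · cases hq
        obtain ⟨u, v, rfl, h₃, h₄⟩ := (sl2Accepts_two z).1 h
        exact ⟨x :: u, y :: v, rfl, rank_lt_of_length_lt (by simpa using h₃), by simp; omega,
          by simpa using h₂.ne⟩
  · rintro ⟨_ | ⟨x, u⟩, _ | ⟨y, v⟩, h, h₁, h₂, h₃⟩
    · simp [pad] at h
    · have := length_le_of_rank_le h₁.le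
      simp at this
    · rw [pad_cons_nil] at h
      obtain ⟨rfl, rfl⟩ := List.cons.inj h
      exact ⟨3, rfl, (sl2Accepts_three _).2 ⟨u, rfl, by simpa using h₂⟩⟩
    · rw [pad_cons_cons] at h
      obtain ⟨rfl, rfl⟩ := List.cons.inj h
      have hne : x ≠ y := by simpa using h₃
      simp only [List.length_cons] at h₂
      have h₄ := (rank_lt_cons_cons_of_ne hne.symm v u).1 h₁
      rcases lt_or_gt_of_ne hne with h' | h'
      · refine ⟨2, by simp [sl2Step, h', h'.not_gt], (sl2Accepts_two _).2 ⟨u, v, rfl, ?_, by omega⟩⟩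
        rcases h₄ with h₄ | h₄
        · exact h₄
        · exact absurd h₄.2 h'.not_gt
      · refine ⟨1, by simp [sl2Step, h'], (sl2Accepts_one _).2 ⟨u, v, rfl, ?_, by omega⟩⟩
        omega

theorem pad_mem_SL2_iff (u v : List A) : pad u v ∈ (SL2 A).accepts ↔ Balanced u v := by
  rw [mem_accepts_SL2, sl2Accepts_zero]
  constructor
  · rintro ⟨u', v', h, h'⟩
    obtain ⟨rfl, rfl⟩ := pad_injective h
    exact h'
  · exact fun h => ⟨u, v, rfl, h⟩

/-! ### Walks in rule automata -/

/-- `σ 0, σ 1, …` are the states of a path of `E` that reads `z`. -/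
def Walk (E : RuleAut A) (z : List (Letter A)) (σ : ℕ → List A) : Prop :=
  ∀ i a, z[i]? = some a → (σ i, a, σ (i + 1)) ∈ E

/-- The letters `(x, x)`. -/
def IsDiag (a : Letter A) : Prop := ∃ x : A, a = (some x, some x)

/-- `σ 0, σ 1, …` are the states of a path that reads `z` in the automaton `E` with additional
`(x, x)`-loops at the initial state. -/
def LoopWalk (E : RuleAut A) (z : List (Letter A)) (σ : ℕ → List A) : Prop :=
  ∀ i a, z[i]? = some a →
    (σ i, a, σ (i + 1)) ∈ E ∨ σ i = [] ∧ σ (i + 1) = [] ∧ IsDiag a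

theorem Walk.loopWalk {E : RuleAut A} {z : List (Letter A)} {σ : ℕ → List A} (h : Walk E z σ) :
    LoopWalk E z σ :=
  fun i a ha => Or.inl (h i a ha)

theorem mem_eval_toNFA (E : RuleAut A) (z : List (Letter A)) (t : List A) :
    t ∈ (toNFA E).eval z ↔ ∃ σ, σ 0 = [] ∧ Walk E z σ ∧ σ z.length = t := by
  induction z using List.reverseRecOn generalizing t with
  | nil =>
    simp only [NFA.eval_nil, List.length_nil]
    constructor
    · intro h
      exact ⟨fun _ => [], rfl, by simp [Walk], (Set.mem_singleton_iff.1 h).symm⟩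
    · rintro ⟨σ, h, -, rfl⟩
      exact h
  | append_singleton z a ih =>
    rw [NFA.eval_append_singleton, NFA.mem_stepSet]
    simp only [ih]
    constructor
    · rintro ⟨s, ⟨σ, h₀, hw, rfl⟩, hs⟩
      refine ⟨fun i => if i ≤ z.length then σ i else t, by simpa using h₀, ?_, by simp⟩
      intro i b hb
      rcases lt_trichotomy i z.length with h | h | h
      · rw [List.getElem?_append_left h] at hb
        simpa [h.le, Nat.succ_le_of_lt h] using hw i b hb
      · subst h
        simp only [List.getElem?_concat_length, Option.some.injEq] at hb
        subst hb
        simpa using! hs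
      · simp [List.getElem?_eq_none (show (z ++ [a]).length ≤ i by simpa using h)] at hb
    · rintro ⟨σ, h₀, hw, rfl⟩
      refine ⟨σ z.length, ⟨σ, h₀, fun i b hb => hw i b ?_, rfl⟩, ?_⟩
      · rw [List.getElem?_append_left (List.getElem?_eq_some_iff.1 hb).1, hb]
      · have := hw z.length a (by simp)
        simpa using! this

theorem mem_accepts_toNFA (E : RuleAut A) (z : List (Letter A)) :
    z ∈ (toNFA E).accepts ↔ ∃ σ, σ 0 = [] ∧ Walk E z σ ∧ σ z.length = [] := by
  rw [NFA.mem_accepts, ← mem_eval_toNFA]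
  exact ⟨fun ⟨s, hs, h⟩ => (show s = [] from hs) ▸ h, fun h => ⟨[], rfl, h⟩⟩

theorem mem_ruleSet {E : RuleAut A} {r : Rule A} :
    r ∈ ruleSet E ↔ Balanced r.1 r.2 ∧
      ∃ σ, σ 0 = [] ∧ Walk E (pad r.1 r.2) σ ∧ σ (pad r.1 r.2).length = [] := by
  rw [ruleSet, Set.mem_ofPred_eq, mem_accepts_toNFA, pad_mem_SL2_iff, and_comm]

theorem decreasing_ruleSet (E : RuleAut A) : Decreasing (ruleSet E) :=
  fun _ hr => (mem_ruleSet.1 hr).1.1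

/-- `E` has no `(x, x)`-arrow that starts at the initial state. -/
def NoInitialDiag (E : RuleAut A) : Prop := ∀ a ∈ E, ¬ (a.1 = [] ∧ IsDiag a.2.1)

/-- The `(x, x)`-loops at the initial state are irrelevant for reducibility: if the loops help to
read a balanced pair, some segment of the path between two visits of the initial state reads a rule
of `Set(E)` (the last segment if the left-hand side is the longer one, otherwise the first). -/
theorem LoopWalk.reducible {E : RuleAut A} (hE : NoInitialDiag E) {u v : List A}
    (hb : Balanced u v) {σ : ℕ → List A} (hw : LoopWalk E (pad u v) σ) (h₀ : σ 0 = [])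
    (h₁ : σ (pad u v).length = []) : Reducible (ruleSet E) u := by
  obtain ⟨hb₁, hb₂, hb₃⟩ := hb
  have hlen : v.length ≤ u.length := length_le_of_rank_le hb₁.le
  rw [length_pad, max_eq_left hlen] at h₁
  have hu : 0 < u.length := by
    rcases u with _ | ⟨x, u⟩
    · rw [rank_nil] at hb₁
      omega
    · simp
  have hstep : ∀ i < u.length, (σ i, (u[i]?, v[i]?), σ (i + 1)) ∈ E ∨
      σ i = [] ∧ σ (i + 1) = [] ∧ IsDiag (u[i]?, v[i]?) := fun i hi =>
    hw i _ ((getElem?_pad u v i _).2 ⟨Or.inl hi, rfl⟩)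
  rcases hlen.lt_or_eq with hlt | heq
  · set i := Nat.findGreatest (fun i => σ i = []) (u.length - 1) with hi
    have hi₁ : i ≤ u.length - 1 := Nat.findGreatest_le _
    have hi₂ : σ i = [] := Nat.findGreatest_spec (P := fun i => σ i = []) (Nat.zero_le _) h₀
    have hi₃ : ∀ j, i < j → j < u.length → σ j ≠ [] := fun j hj hj' =>
      Nat.findGreatest_is_greatest hj (by omega)
    have hmem : ∀ j, i ≤ j → j < u.length → (σ j, (u[j]?, v[j]?), σ (j + 1)) ∈ E := by
      intro j hj hj'
      rcases hstep j hj' with h | ⟨h, h', y, hy⟩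
      · exact h
      · rcases hj.lt_or_eq with hj | rfl
        · exact absurd h (hi₃ j hj hj')
        · have hy' := (Prod.ext_iff.1 hy).2
          simp only [List.getElem?_eq_some_iff] at hy'
          exact absurd h' (hi₃ _ (by omega) (by have := hy'.1; omega))
    refine ⟨(u.drop i, v.drop i), mem_ruleSet.2 ⟨⟨?_, ?_, ?_⟩, fun j => σ (i + j), hi₂, ?_, ?_⟩,
      (List.drop_suffix i u).isInfix⟩
    · exact rank_lt_of_length_lt (by simp; omega)
    · simp
      omega
    · rintro ⟨h, h'⟩
      have hv : i < v.length := by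
        by_contra h''
        exact h (List.drop_eq_nil_of_le (by omega))
      simp only [List.head?_drop] at h'
      refine hE _ (hmem i le_rfl (by omega)) ⟨hi₂, v[i], ?_⟩
      rw [h', List.getElem?_eq_getElem hv]
    · intro j a ha
      rw [getElem?_pad] at ha
      simp only [List.length_drop, List.getElem?_drop] at ha
      rw [ha.2]
      exact hmem (i + j) (by omega) (by omega)
    · simp only [length_pad, List.length_drop]
      rw [max_eq_left (by omega), Nat.add_sub_cancel' (by omega)]
      exact h₁
  · have hex : ∃ i, 0 < i ∧ σ i = [] := ⟨u.length, hu, h₁⟩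
    set i := Nat.find hex with hi
    have hi₁ : i ≤ u.length := Nat.find_le ⟨hu, h₁⟩
    obtain ⟨hi₀, hi₂⟩ : 0 < i ∧ σ i = [] := Nat.find_spec hex
    have hi₃ : ∀ j, 0 < j → j < i → σ j ≠ [] := fun j hj hj' h => Nat.find_min hex hj' ⟨hj, h⟩
    rcases u with _ | ⟨x, u⟩
    · simp at hu
    rcases v with _ | ⟨y, v⟩
    · simp at heq
    have hxy : x ≠ y := by simpa using hb₃
    have hlt : y < x := by
      have := (rank_lt_cons_cons_of_ne hxy.symm v u).1 hb₁
      simp only [List.length_cons] at heq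
      rcases this with h | h
      · omega
      · exact h.2
    have hmem : ∀ j, j < i → (σ j, ((x :: u)[j]?, (y :: v)[j]?), σ (j + 1)) ∈ E := by
      intro j hj
      rcases hstep j (by omega) with h | ⟨h, h', w, hw⟩
      · exact h
      · rcases Nat.eq_zero_or_pos j with rfl | hj'
        · simp only [List.length_cons, Nat.zero_lt_succ, List.getElem?_eq_getElem,
            List.getElem_cons_zero, Prod.mk.injEq, Option.some.injEq] at hw
          exact absurd (hw.1.trans hw.2.symm) hxy
        · exact absurd h (hi₃ j hj' hj)
    obtain ⟨k, hk⟩ : ∃ k, i = k + 1 := ⟨i - 1, by omega⟩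
    refine ⟨((x :: u).take i, (y :: v).take i), mem_ruleSet.2 ⟨⟨?_, ?_, ?_⟩, σ, h₀, ?_, ?_⟩,
      (List.take_prefix i _).isInfix⟩
    · rw [hk]
      simp only [List.take_succ_cons]
      rw [rank_lt_cons_cons_of_ne hxy.symm]
      simp only [List.length_cons] at heq
      exact Or.inr ⟨by simp only [List.length_take]; omega, hlt⟩
    · simp only [List.length_take]
      omega
    · rw [hk]
      simpa using hxy
    · intro j a ha
      rw [getElem?_pad] at ha
      have hj : j < i := by
        have := ha.1
        simp only [List.length_take] at this
        omega
      rw [ha.2, List.getElem?_take_of_lt hj, List.getElem?_take_of_lt hj]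
      exact hmem j hj
    · simp only [length_pad, List.length_take]
      rw [← heq, max_self, min_eq_left (by omega)]
      exact hi₂

/-! ### Values in the group -/

variable {G : Type v} [Group G] {γ : A → G}

theorem val_nil : val γ [] = 1 := rfl

theorem val_append (u v : List A) : val γ (u ++ v) = val γ u * val γ v := by
  simp [val]

theorem val_cons (x : A) (u : List A) : val γ (x :: u) = γ x * val γ u := by
  simp [val]

theorem val_take_succ (u : List A) (i : ℕ) :
    val γ (u.take (i + 1)) = val γ (u.take i) * val γ u[i]?.toList := by
  rw [List.take_add_one, val_append]

/-- The states of `E` are labelled consistently: an arrow with label `(x, y)` leads from `g` to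
`x⁻¹ g y`. -/
def GroupLabelled (γ : A → G) (E : RuleAut A) : Prop :=
  ∀ a ∈ E, val γ a.2.2 = (val γ a.2.1.1.toList)⁻¹ * val γ a.1 * val γ a.2.1.2.toList

theorem LoopWalk.val_eq {E : RuleAut A} (hE : GroupLabelled γ E) {u v : List A}
    {σ : ℕ → List A} (hw : LoopWalk E (pad u v) σ) (h₀ : σ 0 = []) {i : ℕ}
    (hi : i ≤ (pad u v).length) :
    val γ (σ i) = (val γ (u.take i))⁻¹ * val γ (v.take i) := by
  induction i with
  | zero => simp [h₀, val_nil]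
  | succ i ih =>
    rw [val_take_succ, val_take_succ]
    have hi' : i < u.length ∨ i < v.length := by
      rw [length_pad] at hi
      omega
    rcases hw i _ ((getElem?_pad u v i _).2 ⟨hi', rfl⟩) with h | ⟨h, h', x, hx⟩
    · have := hE _ h
      simp only at this
      rw [this, ih (by omega)]
      group
    · have h'' := ih (by omega)
      rw [h, val_nil] at h''
      have h₁ : u[i]? = some x := (Prod.ext_iff.1 hx).1
      have h₂ : v[i]? = some x := (Prod.ext_iff.1 hx).2
      have h₃ := inv_mul_eq_one.1 h''.symm
      rw [h', h₁, h₂, h₃, inv_mul_cancel, val_nil]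

theorem GroupLabelled.val_eq_of_mem_ruleSet {E : RuleAut A} (hE : GroupLabelled γ E) {r : Rule A}
    (hr : r ∈ ruleSet E) : val γ r.1 = val γ r.2 := by
  obtain ⟨hb, σ, h₀, hw, h₁⟩ := mem_ruleSet.1 hr
  have h := hw.loopWalk.val_eq hE h₀ le_rfl
  rw [h₁, val_nil, List.take_of_length_le (by simp [length_pad]),
    List.take_of_length_le (by simp [length_pad])] at h
  rw [← mul_one (val γ r.1), h]
  group

/-- A rule that holds in the group and whose right-hand side is shortlex-smaller. -/
def Sound (γ : A → G) (r : Rule A) : Prop := val γ r.1 = val γ r.2 ∧ rank r.2 < rank r.1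

theorem GroupLabelled.sound {E : RuleAut A} (hE : GroupLabelled γ E) {r : Rule A}
    (hr : r ∈ ruleSet E) : Sound γ r :=
  ⟨hE.val_eq_of_mem_ruleSet hr, decreasing_ruleSet E r hr⟩

/-! ### R-reduction -/

theorem Reducible.mono {T : Set (Rule A)} {u v : List A} (h : Reducible T u) (huv : u <:+: v) :
    Reducible T v := by
  obtain ⟨r, hr, h⟩ := h
  exact ⟨r, hr, h.trans huv⟩

theorem tail_infix (u : List A) : u.tail <:+: u := (List.tail_suffix u).isInfix

theorem dropLast_infix (u : List A) : u.dropLast <:+: u := (List.dropLast_prefix u).isInfix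

/-- The rules of `Set(M)` that reduction may insert: no proper substring of the left-hand side is
reducible, and the right-hand side is the least one. -/
structure IsInsertable (M : RuleAut A) (r : Rule A) : Prop where
  mem : r ∈ ruleSet M
  dropLast : ¬ Reducible (ruleSet M) r.1.dropLast
  tail : ¬ Reducible (ruleSet M) r.1.tail
  least : ∀ ρ, (r.1, ρ) ∈ ruleSet M → rank r.2 ≤ rank ρ

/-- `S'` arises from `S` by the insertion in `New` of rules used in reductions, with left-hand sides
of rank less than `b`. -/
structure Extends (M : RuleAut A) (b : ℕ) (S S' : Store A) : Prop where
  considered : S'.considered = S.considered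
  this : S'.this = S.this
  delete : S'.delete = S.delete
  new_subset : S.new ⊆ S'.new
  new_mem : ∀ r ∈ S'.new, r ∈ S.new ∨ r ∉ S.all ∧ IsInsertable M r ∧ rank r.1 < b

theorem Store.mem_all {S : Store A} {r : Rule A} :
    r ∈ S.all ↔ r ∈ S.considered ∨ r ∈ S.this ∨ r ∈ S.new ∨ r ∈ S.delete := by
  simp [Store.all]

theorem Store.addNew_of_mem {S : Store A} {r : Rule A} (h : r ∈ S.all) : S.addNew r = S :=
  if_pos h

theorem Store.addNew_considered (S : Store A) (r : Rule A) :
    (S.addNew r).considered = S.considered := by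
  unfold Store.addNew
  split_ifs <;> rfl

theorem Store.addNew_this (S : Store A) (r : Rule A) : (S.addNew r).this = S.this := by
  unfold Store.addNew
  split_ifs <;> rfl

theorem Store.addNew_delete (S : Store A) (r : Rule A) : (S.addNew r).delete = S.delete := by
  unfold Store.addNew
  split_ifs <;> rfl

theorem Store.mem_addNew_new {S : Store A} {r r' : Rule A} :
    r' ∈ (S.addNew r).new ↔ r' ∈ S.new ∨ r' = r ∧ r ∉ S.all := by
  unfold Store.addNew
  split_ifs with h
  · simp [h]
  · simp [h, or_comm]

theorem Store.mem_addNew_all {S : Store A} {r r' : Rule A} :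
    r' ∈ (S.addNew r).all ↔ r' ∈ S.all ∨ r' = r := by
  unfold Store.addNew
  split_ifs with h
  · constructor
    · exact Or.inl
    · rintro (h' | rfl)
      · exact h'
      · exact h
  · simp only [Store.mem_all, Finset.mem_insert]
    tauto

theorem Extends.refl (M : RuleAut A) (b : ℕ) (S : Store A) : Extends M b S S :=
  ⟨rfl, rfl, rfl, subset_rfl, fun _ h => Or.inl h⟩

theorem Extends.mono {M : RuleAut A} {b b' : ℕ} {S S' : Store A} (h : Extends M b S S')
    (hb : b ≤ b') : Extends M b' S S' :=
  ⟨h.considered, h.this, h.delete, h.new_subset, fun r hr =>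
    (h.new_mem r hr).imp_right fun h => ⟨h.1, h.2.1, h.2.2.trans_le hb⟩⟩

theorem Extends.all_subset {M : RuleAut A} {b : ℕ} {S S' : Store A} (h : Extends M b S S') :
    S.all ⊆ S'.all := by
  intro r hr
  rw [Store.mem_all] at *
  rw [h.considered, h.this, h.delete]
  have := @h.new_subset r
  tauto

theorem Extends.mem_all {M : RuleAut A} {b : ℕ} {S S' : Store A} (h : Extends M b S S')
    {r : Rule A} (hr : r ∈ S'.all) : r ∈ S.all ∨ r ∉ S.all ∧ IsInsertable M r ∧ rank r.1 < b := by
  rw [Store.mem_all, h.considered, h.this, h.delete] at hr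
  rcases hr with hr | hr | hr | hr
  · exact Or.inl (Store.mem_all.2 (Or.inl hr))
  · exact Or.inl (Store.mem_all.2 (Or.inr (Or.inl hr)))
  · exact (h.new_mem r hr).imp_left fun hr => Store.mem_all.2 (Or.inr (Or.inr (Or.inl hr)))
  · exact Or.inl (Store.mem_all.2 (Or.inr (Or.inr (Or.inr hr))))

theorem Extends.trans {M : RuleAut A} {b : ℕ} {S S' S'' : Store A} (h₁ : Extends M b S S')
    (h₂ : Extends M b S' S'') : Extends M b S S'' := by
  refine ⟨h₂.considered.trans h₁.considered, h₂.this.trans h₁.this, h₂.delete.trans h₁.delete,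
    h₁.new_subset.trans h₂.new_subset, fun r hr => ?_⟩
  rcases h₂.new_mem r hr with h | h
  · exact h₁.new_mem r h
  · exact Or.inr ⟨fun h' => h.1 (h₁.all_subset h'), h.2⟩

theorem Extends.sound {M : RuleAut A} {b : ℕ} {S S' : Store A} (h : Extends M b S S')
    (hM : GroupLabelled γ M) (hS : ∀ r ∈ S.all, Sound γ r) : ∀ r ∈ S'.all, Sound γ r := by
  intro r hr
  rcases h.mem_all hr with h | h
  · exact hS r h
  · exact hM.sound h.2.1.mem

/-- A prefix of minimal length among the reducible ones ends with every left-hand side that it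
contains. -/
theorem rStep_spec {M : RuleAut A} {S : Store A} {w : List A} (hw : Reducible (ruleSet M) w) :
    ∃ x y : List A, ∃ r : Rule A, w = x ++ r.1 ++ y ∧ (rStep M (S, w)).2 = x ++ r.2 ++ y ∧
      (r ∈ S.all ∨ r ∈ ruleSet M) ∧ r ∈ (rStep M (S, w)).1.all ∧
      Extends M (rank r.1 + 1) S (rStep M (S, w)).1 := by
  set m := sInf {m : ℕ | Reducible (ruleSet M) (w.take m)} with hm
  have hm₁ : Reducible (ruleSet M) (w.take m) :=
    Nat.sInf_mem (s := {m : ℕ | Reducible (ruleSet M) (w.take m)}) ⟨w.length, by simpa using hw⟩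
  have hm₂ : ∀ k < m, ¬ Reducible (ruleSet M) (w.take k) := fun k hk => Nat.notMem_of_lt_sInf hk
  set pre := w.take m with hpre
  have hlen : pre.length ≤ m := by simp [hpre]
  have hshort : ∀ k < pre.length, ¬ Reducible (ruleSet M) (pre.take k) := by
    intro k hk
    rw [hpre, List.take_take, min_eq_left (by omega)]
    exact hm₂ k (by omega)
  have hend : ∀ a b : List A, ∀ r ∈ ruleSet M, pre = a ++ r.1 ++ b → b = [] := by
    intro a b r hr h
    by_contra hb
    refine hshort (a ++ r.1).length ?_ ⟨r, hr, ?_⟩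
    · rw [h, List.length_append (as := a ++ r.1)]
      have := List.length_pos_iff.2 hb
      omega
    · rw [h, List.take_left]
      exact (List.suffix_append a r.1).isInfix
  set k := sInf {k : ℕ | ∃ r ∈ ruleSet M, r.1 <:+ pre ∧ r.1.length = k} with hk
  obtain ⟨r₀, hr₀, hsuf, hr₀k⟩ : ∃ r ∈ ruleSet M, r.1 <:+ pre ∧ r.1.length = k := by
    refine Nat.sInf_mem (s := {k : ℕ | ∃ r ∈ ruleSet M, r.1 <:+ pre ∧ r.1.length = k}) ?_
    obtain ⟨r, hr, a, b, h⟩ := hm₁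
    have := hend a b r hr h.symm
    subst this
    exact ⟨_, r, hr, ⟨a, by simpa using h⟩, rfl⟩
  have hkmin : ∀ r ∈ ruleSet M, r.1 <:+ pre → k ≤ r.1.length := fun r hr h =>
    Nat.sInf_le ⟨r, hr, h, rfl⟩
  set lhs := pre.drop (pre.length - k) with hlhs
  have hlhs' : r₀.1 = lhs := by
    rw [hlhs, ← hr₀k]
    exact List.suffix_iff_eq_drop.1 hsuf
  set rhs := if ∃ ρ : List A, (lhs, ρ) ∈ S.all then slMin {ρ | (lhs, ρ) ∈ S.all}
    else slMin {ρ | (lhs, ρ) ∈ ruleSet M} with hrhs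
  have hstep : rStep M (S, w) =
      (S.addNew (lhs, rhs), pre.take (pre.length - k) ++ rhs ++ w.drop pre.length) := rfl
  have hne : {ρ | (lhs, ρ) ∈ ruleSet M}.Nonempty := ⟨r₀.2, by rw [← hlhs']; exact hr₀⟩
  have hdecomp : pre.take (pre.length - k) ++ lhs = pre := List.take_append_drop _ _
  rw [hstep]
  refine ⟨pre.take (pre.length - k), w.drop pre.length, (lhs, rhs), ?_, rfl, ?_⟩
  · rw [hdecomp]
    have : pre = w.take pre.length := by simp [hpre]
    conv_lhs => rw [← List.take_append_drop pre.length w, ← this]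
  by_cases hex : ∃ ρ : List A, (lhs, ρ) ∈ S.all
  · rw [if_pos hex] at hrhs
    have hmem : (lhs, rhs) ∈ S.all := by
      rw [hrhs]
      exact slMin_mem (T := {ρ | (lhs, ρ) ∈ S.all}) hex
    rw [Store.addNew_of_mem hmem]
    exact ⟨Or.inl hmem, hmem, Extends.refl _ _ _⟩
  · rw [if_neg hex] at hrhs
    have hmem : (lhs, rhs) ∈ ruleSet M := by
      rw [hrhs]
      exact slMin_mem (T := {ρ | (lhs, ρ) ∈ ruleSet M}) hne
    have hnot : (lhs, rhs) ∉ S.all := fun h => hex ⟨_, h⟩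
    have hpos : 0 < lhs.length := by
      rw [← hlhs']
      have := decreasing_ruleSet M r₀ hr₀
      by_contra h
      rw [List.eq_nil_of_length_eq_zero (by omega : r₀.1.length = 0), rank_nil] at this
      omega
    refine ⟨Or.inr hmem, Store.mem_addNew_all.2 (Or.inr rfl), Store.addNew_considered _ _,
      Store.addNew_this _ _, Store.addNew_delete _ _,
      fun r hr => Store.mem_addNew_new.2 (Or.inl hr), ?_⟩
    intro r hr
    rcases Store.mem_addNew_new.1 hr with hr | ⟨rfl, -⟩
    · exact Or.inl hr
    · refine Or.inr ⟨hnot, ⟨hmem, ?_, ?_, ?_⟩, by simp⟩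
      · intro h
        refine hshort (pre.length - 1) ?_ (h.mono ?_)
        · rw [← hdecomp, List.length_append]
          omega
        · rw [← List.dropLast_eq_take]
          conv_rhs => rw [← hdecomp]
          rw [List.dropLast_append_of_ne_nil (List.ne_nil_of_length_pos hpos)]
          exact (List.suffix_append _ _).isInfix
      · rintro ⟨r', hr', a, b, h⟩
        obtain ⟨x, l, hxl⟩ := List.exists_cons_of_length_pos hpos
        simp only [hxl, List.tail_cons] at h
        have hp : pre = (pre.take (pre.length - k) ++ [x] ++ a) ++ r'.1 ++ b := by
          conv_lhs => rw [← hdecomp, hxl, ← h]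
          simp
        have hb := hend _ b r' hr' hp
        subst hb
        have h₁ := hkmin r' hr' ⟨_, by rw [List.append_nil] at hp; exact hp.symm⟩
        have h₂ : lhs.length = k := by rw [← hlhs', hr₀k]
        have h₃ := congrArg List.length h
        rw [hxl] at h₂
        simp at h₂ h₃
        omega
      · intro ρ hρ
        simp only [hrhs]
        exact rank_slMin_le (T := {ρ | (lhs, ρ) ∈ ruleSet M}) hρ

/-- The string `w` has been reduced, completely or in part, to `w'`. -/
structure Reduces (γ : A → G) (M : RuleAut A) (S : Store A) (w : List A) (S' : Store A)
    (w' : List A) : Prop where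
  ext : Extends M (rank w + 1) S S'
  rank_le : rank w' ≤ rank w
  conn : Conn (S'.all : Set (Rule A)) (rank w + 1) w w'
  val_eq : val γ w' = val γ w

theorem rReduce_spec {M : RuleAut A} (hM : GroupLabelled γ M) {S : Store A}
    (hS : ∀ r ∈ S.all, Sound γ r) (w : List A) :
    Reduces γ M S w (rReduce M (S, w)).1 (rReduce M (S, w)).2 ∧
      ¬ Reducible (ruleSet M) (rReduce M (S, w)).2 := by
  refine iterUntil_spec (P := fun c : Store A × List A => Reduces γ M S w c.1 c.2)
    (fun c => rank c.2) ?_ ⟨Extends.refl _ _ _, le_rfl, Conn.refl _, rfl⟩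
  rintro ⟨S₁, w₁⟩ hc hred
  simp only [not_not] at hred
  obtain ⟨x, y, r, hxy, h₂, hr, hmem, hext⟩ := rStep_spec (S := S₁) hred
  simp only at hc
  have hsound : Sound γ r := by
    rcases hr with hr | hr
    · exact hc.ext.sound hM hS r hr
    · exact hM.sound hr
  have hlt : rank (x ++ r.2 ++ y) < rank w₁ := by
    rw [hxy]
    exact rank_append_lt hsound.2 x y
  have hle := hc.rank_le
  have hr₁ : rank r.1 ≤ rank w₁ := by
    rw [hxy]
    exact rank_le_of_infix ⟨x, y, rfl⟩
  rw [h₂]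
  refine ⟨⟨hc.ext.trans (hext.mono (by omega)), by omega, ?_, ?_⟩, hlt⟩
  · refine (hc.conn.mono (fun _ h => hext.all_subset h) le_rfl).tail
      ⟨by omega, by omega, Or.inl ⟨x, y, r, hmem, hxy, rfl⟩⟩
  · rw [← hc.val_eq, hxy]
    simp only [val_append, hsound.1]

theorem Reduces.rank_lt {M : RuleAut A} {S S' : Store A} {w w' : List A}
    (h : Reduces γ M S w S' w') (hw : Reducible (ruleSet M) w)
    (hw' : ¬ Reducible (ruleSet M) w') : rank w' < rank w :=
  lt_of_le_of_ne h.rank_le fun e => hw' (rank_injective e ▸ hw)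

theorem Reduces.conn_of_mem {M : RuleAut A} (hM : GroupLabelled γ M) {S S' : Store A}
    (hS : ∀ r ∈ S.all, Sound γ r) {w w' : List A} (h : Reduces γ M S w S' w') {T : Set (Rule A)}
    {b : ℕ} (hT : ∀ r ∈ S'.all, rank r.1 < b → r ∈ T) (hb : rank w < b) :
    Conn T (rank w + 1) w w' :=
  h.conn.of_bounded (fun r hr => (h.ext.sound hM hS r hr).2) fun r hr hn => hT r hr (by omega)

/-! ### The minimization of the left-hand side -/

theorem dropLast_append_getLast?_toList (u : List A) : u.dropLast ++ u.getLast?.toList = u := by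
  rcases List.eq_nil_or_concat u with rfl | ⟨u, x, rfl⟩ <;> simp

theorem head?_toList_append_tail (u : List A) : u.head?.toList ++ u.tail = u := by
  cases u <;> simp

theorem rank_dropLast_lt {u : List A} (hu : u ≠ []) : rank u.dropLast < rank u :=
  rank_lt_of_length_lt (by
    have := List.length_pos_iff.2 hu
    rw [List.length_dropLast]
    omega)

theorem rank_tail_lt {u : List A} (hu : u ≠ []) : rank u.tail < rank u :=
  rank_lt_of_length_lt (by
    have := List.length_pos_iff.2 hu
    rw [List.length_tail]
    omega)

theorem minimizeLeft_spec {M : RuleAut A} (hM : GroupLabelled γ M) {S : Store A}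
    (hS : ∀ r ∈ S.all, Sound γ r) {w : List A} (hw : w ≠ []) :
    Extends M (rank w) S (minimizeLeft M S w).1 ∧
      val γ (minimizeLeft M S w).2 = val γ w ∧
      (∀ T : Set (Rule A), (∀ r ∈ (minimizeLeft M S w).1.all, rank r.1 < rank w → r ∈ T) →
        Conn T (rank w + 1) w (minimizeLeft M S w).2) ∧
      ((minimizeLeft M S w).2 = w ∧ ¬ Reducible (ruleSet M) w.dropLast ∧
          ¬ Reducible (ruleSet M) w.tail ∨
        rank (minimizeLeft M S w).2 < rank w ∧
          ¬ Reducible (ruleSet M) (minimizeLeft M S w).2) := by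
  have hc := rReduce_spec hM hS w.dropLast
  set c := rReduce M (S, w.dropLast) with hc'
  have hw₁ := rank_dropLast_lt hw
  have hw₂ := rank_tail_lt hw
  have hcS := hc.1.ext.sound hM hS
  have hd := rReduce_spec hM hcS w.tail
  set d := rReduce M (c.1, w.tail) with hd'
  set e := if c.2 ++ w.getLast?.toList = w then (d.1, w.head?.toList ++ d.2)
    else (c.1, c.2 ++ w.getLast?.toList) with he'
  have hdef : minimizeLeft M S w = if e.2 = w then e else rReduce M e := rfl
  -- The state of affairs before the final reduction of the whole string.
  have he : Extends M (rank w) S e.1 ∧ val γ e.2 = val γ w ∧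
      (∀ T : Set (Rule A), (∀ r ∈ e.1.all, rank r.1 < rank w → r ∈ T) →
        Conn T (rank w + 1) w e.2) ∧
      (e.2 = w ∧ ¬ Reducible (ruleSet M) w.dropLast ∧ ¬ Reducible (ruleSet M) w.tail ∨
        rank e.2 < rank w) := by
    by_cases h : c.2 ++ w.getLast?.toList = w
    · rw [if_pos h] at he'
      have hc₂ : c.2 = w.dropLast := by
        conv_rhs at h => rw [← dropLast_append_getLast?_toList w]
        exact List.append_cancel_right h
      rw [he']
      have h₁ : rank (w.head?.toList ++ d.2 ++ []) ≤ rank (w.head?.toList ++ w.tail ++ []) :=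
        rank_append_le hd.1.rank_le _ _
      simp only [List.append_nil, head?_toList_append_tail] at h₁
      refine ⟨(hc.1.ext.mono (by omega)).trans (hd.1.ext.mono (by omega)), ?_, ?_, ?_⟩
      · simp only [val_append, hd.1.val_eq]
        rw [← val_append, head?_toList_append_tail]
      · intro T hT
        have := (hd.1.conn_of_mem hM hcS hT hw₂).append_succ w.head?.toList []
        simpa only [List.append_nil, head?_toList_append_tail] using this
      · rcases h₁.lt_or_eq with h₁ | h₁
        · exact Or.inr h₁
        · have h₂ := rank_injective h₁
          have hd₂ : d.2 = w.tail := by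
            conv_rhs at h₂ => rw [← head?_toList_append_tail w]
            exact List.append_cancel_left h₂
          exact Or.inl ⟨h₂, hc₂ ▸ hc.2, hd₂ ▸ hd.2⟩
    · rw [if_neg h] at he'
      rw [he']
      have h₁ : rank ([] ++ c.2 ++ w.getLast?.toList) ≤
          rank ([] ++ w.dropLast ++ w.getLast?.toList) := rank_append_le hc.1.rank_le _ _
      simp only [List.nil_append, dropLast_append_getLast?_toList] at h₁
      refine ⟨hc.1.ext.mono (by omega), ?_, ?_, ?_⟩
      · simp only [val_append, hc.1.val_eq]
        rw [← val_append, dropLast_append_getLast?_toList]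
      · intro T hT
        have := (hc.1.conn_of_mem hM hS hT hw₁).append_succ [] w.getLast?.toList
        simpa only [List.nil_append, dropLast_append_getLast?_toList] using this
      · exact Or.inr (lt_of_le_of_ne h₁ fun e => h (rank_injective e))
  rw [hdef]
  obtain ⟨he₁, he₂, he₃, he₄⟩ := he
  by_cases h : e.2 = w
  · rw [if_pos h]
    refine ⟨he₁, he₂, he₃, Or.inl ?_⟩
    rcases he₄ with he₄ | he₄
    · exact he₄
    · rw [h] at he₄
      omega
  · rw [if_neg h]
    have hlt : rank e.2 < rank w := by
      rcases he₄ with he₄ | he₄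
      · exact absurd he₄.1 h
      · exact he₄
    have heS := he₁.sound hM hS
    obtain ⟨hf, hf'⟩ := rReduce_spec hM heS e.2
    change Reduces γ M e.1 e.2 (rReduce M e).1 (rReduce M e).2 at hf
    refine ⟨he₁.trans (hf.ext.mono (by omega)), hf.val_eq.trans he₂, ?_, Or.inr ⟨?_, hf'⟩⟩
    · intro T hT
      refine (he₃ T fun r hr => hT r (hf.ext.all_subset hr)).trans ?_
      exact (hf.conn_of_mem hM heS hT hlt).mono subset_rfl (by omega)
    · have := hf.rank_le
      omega

/-! ### The stages of a round of minimization -/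

/-- The rank of the greater one of two strings. -/
def maxRank (p : Rule A) : ℕ := max (rank p.1) (rank p.2)

/-- The two strings are joined by a path that does not exceed the greater one. -/
def Tight (T : Set (Rule A)) (p : Rule A) : Prop := Conn T (maxRank p + 1) p.1 p.2

/-- Tight paths from `x ι(x)` to the empty string, as far as `x ι(x)` is below the bound. -/
def InverseConn (ι : A → A) (T : Set (Rule A)) (b : ℕ) : Prop :=
  ∀ x, rank [x, ι x] < b → Conn T (rank [x, ι x] + 1) [x, ι x] []

theorem InverseConn.mono {ι : A → A} {T : Set (Rule A)} {b b' : ℕ} (h : InverseConn ι T b')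
    (hb : b ≤ b') : InverseConn ι T b :=
  fun x hx => h x (hx.trans_le hb)

/-- What balancing and cancelling do to a pair. -/
structure Stage (γ : A → G) (ι : A → A) (p p' : Rule A) : Prop where
  isInfix : p'.1 <:+: p.1
  eq_or_lt : p' = p ∨ maxRank p' < maxRank p
  val_eq : val γ p.1 = val γ p.2 → val γ p'.1 = val γ p'.2
  tight : ∀ T : Set (Rule A), InverseConn ι T (maxRank p) → Tight T p' → Tight T p

theorem Stage.refl (γ : A → G) (ι : A → A) (p : Rule A) : Stage γ ι p p :=
  ⟨List.infix_rfl, Or.inl rfl, id, fun _ _ => id⟩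

theorem Stage.maxRank_le {ι : A → A} {p p' : Rule A} (h : Stage γ ι p p') :
    maxRank p' ≤ maxRank p := by
  rcases h.eq_or_lt with rfl | h
  · exact le_rfl
  · exact h.le

theorem Stage.trans {ι : A → A} {p p' p'' : Rule A} (h₁ : Stage γ ι p p')
    (h₂ : Stage γ ι p' p'') : Stage γ ι p p'' := by
  refine ⟨h₂.isInfix.trans h₁.isInfix, ?_, fun h => h₂.val_eq (h₁.val_eq h), fun T hT h =>
    h₁.tight T hT (h₂.tight T (hT.mono h₁.maxRank_le) h)⟩
  have := h₂.maxRank_le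
  rcases h₁.eq_or_lt with rfl | h
  · exact h₂.eq_or_lt
  · exact Or.inr (by omega)

variable {ι : A → A}

/-- Moving the last letter `x` of `u x` to the right-hand side: a tight path from `u` to `v ι(x)`
gives a tight path from `u x` through `v ι(x) x` to `v`. -/
theorem stage_balanceRight (hι : Function.Involutive ι) (hγ : ∀ x, γ (ι x) = (γ x)⁻¹)
    {p : Rule A} (hp : TooLong p) :
    Stage γ ι p (p.1.dropLast, p.2 ++ (p.1.getLast?.map ι).toList) ∧
      maxRank (p.1.dropLast, p.2 ++ (p.1.getLast?.map ι).toList) < maxRank p := by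
  obtain ⟨u, v⟩ := p
  rcases List.eq_nil_or_concat u with rfl | ⟨u, x, rfl⟩
  · simp [TooLong] at hp
  simp only [List.concat_eq_append] at hp ⊢
  simp only [TooLong, List.length_append, List.length_singleton] at hp
  simp only [List.dropLast_concat, List.getLast?_append, List.getLast?_singleton, Option.map_some,
    Option.some_or, Option.toList_some]
  have h₁ : rank u < rank (u ++ [x]) := rank_lt_of_length_lt (by simp)
  have h₂ : rank (v ++ [ι x]) < rank (u ++ [x]) := by
    refine rank_lt_of_length_lt ?_
    simp only [List.length_append, List.length_singleton]
    omega
  have h₃ : rank v < rank (u ++ [x]) := by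
    refine rank_lt_of_length_lt ?_
    simp only [List.length_append, List.length_singleton]
    omega
  have h₄ : rank (v ++ [ι x, x]) < rank (u ++ [x]) := by
    rcases hp with hp | ⟨hp, a, b, ha, hb, hab⟩
    · exact rank_lt_of_length_lt (by simp; omega)
    · rcases v with _ | ⟨b', v⟩
      · simp at hb
      rcases u with _ | ⟨a', u⟩
      · simp at hp
      simp only [List.cons_append, List.head?_cons, Option.some.injEq] at ha hb
      subst ha hb
      rw [List.cons_append, List.cons_append, rank_lt_cons_cons (by simp at hp; simp; omega)]
      exact Or.inl hab
  have hmax : maxRank (u, v ++ [ι x]) < maxRank (u ++ [x], v) := by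
    simp only [maxRank]
    omega
  refine ⟨⟨(List.prefix_append u [x]).isInfix, Or.inr hmax, ?_, ?_⟩, hmax⟩
  · simp only [val_append]
    intro h
    rw [← h]
    simp [val, hγ]
  · intro T hT h
    unfold Tight at *
    have h₅ : Conn T (maxRank (u ++ [x], v) + 1) (u ++ [x]) (v ++ [ι x, x]) := by
      have := h.append_bound (m := maxRank (u ++ [x], v) + 1) [] [x] ?_
      · simpa using this
      · intro w hw
        simp only [maxRank] at hw ⊢
        have h₆ : rank w ≤ rank u ∨ rank w ≤ rank (v ++ [ι x]) := by omega
        rcases h₆ with h₆ | h₆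
        · have := rank_append_le h₆ [] [x]
          simp only [List.nil_append] at *
          omega
        · have := rank_append_le h₆ [] [x]
          simp only [List.nil_append, List.append_assoc, List.singleton_append] at *
          omega
    have h₆ : rank [ι x, x] ≤ rank (v ++ [ι x, x]) :=
      rank_le_of_infix (List.suffix_append _ _).isInfix
    have h₇ : Conn T (maxRank (u ++ [x], v) + 1) (v ++ [ι x, x]) v := by
      have := hT (ι x) (by rw [hι x]; simp only [maxRank]; omega)
      rw [hι x] at this
      have := this.append_succ v []
      simp only [List.append_nil] at this
      exact this.mono subset_rfl (by simp only [maxRank]; omega)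
    exact h₅.trans h₇

theorem balanceRight_spec (hι : Function.Involutive ι) (hγ : ∀ x, γ (ι x) = (γ x)⁻¹)
    (p : Rule A) : Stage γ ι p (balanceRight ι p) ∧ ¬ TooLong (balanceRight ι p) := by
  refine iterUntil_spec (P := fun q => Stage γ ι p q) maxRank ?_ (Stage.refl _ _ _)
  intro q hq hd
  obtain ⟨h₁, h₂⟩ := stage_balanceRight hι hγ (not_not.1 hd)
  exact ⟨hq.trans h₁, h₂⟩

theorem balanceLeft_spec (hγ : ∀ x, γ (ι x) = (γ x)⁻¹) (p : Rule A) :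
    Stage γ ι p (balanceLeft ι p) := by
  unfold balanceLeft
  split_ifs with h
  swap
  · exact Stage.refl _ _ _
  obtain ⟨u, v⟩ := p
  obtain ⟨hl, a, b, ha, hb, hab⟩ := h
  rcases u with _ | ⟨a', _ | ⟨b', u⟩⟩
  · simp at ha
  · simp at hb
  simp only [List.getElem?_cons_zero, Option.some.injEq, List.getElem?_cons_succ] at ha hb
  subst ha hb
  simp only [List.length_cons] at hl
  simp only [List.tail_cons, List.head?_cons, Option.map_some, Option.toList_some,
    List.singleton_append]
  have h₁ : rank (b' :: u) < rank (a' :: b' :: u) := rank_lt_of_length_lt (by simp)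
  have h₂ : rank (ι a' :: v) < rank (a' :: b' :: u) :=
    rank_lt_of_length_lt (by simp only [List.length_cons]; omega)
  have h₃ : rank v < rank (a' :: b' :: u) :=
    rank_lt_of_length_lt (by simp only [List.length_cons]; omega)
  have h₄ : rank (a' :: ι a' :: v) < rank (a' :: b' :: u) := by
    have hv : v.length = u.length := by omega
    rw [rank_lt_cons_cons (by simp [hv]), rank_lt_cons_cons hv]
    exact Or.inr ⟨rfl, Or.inl hab⟩
  have hmax : maxRank (b' :: u, ι a' :: v) < maxRank (a' :: b' :: u, v) := by
    simp only [maxRank]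
    omega
  refine ⟨(List.suffix_cons a' _).isInfix, Or.inr hmax, ?_, ?_⟩
  · simp only [val_cons, hγ]
    intro h
    rw [← h]
    simp
  · intro T hT h
    unfold Tight at *
    have h₅ : Conn T (maxRank (a' :: b' :: u, v) + 1) (a' :: b' :: u) (a' :: ι a' :: v) := by
      have := h.append_bound (m := maxRank (a' :: b' :: u, v) + 1) [a'] [] ?_
      · simpa using this
      · intro w hw
        simp only [maxRank] at hw ⊢
        have h₆ : rank w ≤ rank (b' :: u) ∨ rank w ≤ rank (ι a' :: v) := by omega
        rcases h₆ with h₆ | h₆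
        · have := rank_append_le h₆ [a'] []
          simp only [List.append_nil, List.singleton_append] at *
          omega
        · have := rank_append_le h₆ [a'] []
          simp only [List.append_nil, List.singleton_append] at *
          omega
    have h₆ : rank [a', ι a'] ≤ rank (a' :: ι a' :: v) :=
      rank_le_of_infix (List.prefix_append [a', ι a'] v).isInfix
    have h₇ : Conn T (maxRank (a' :: b' :: u, v) + 1) (a' :: ι a' :: v) v := by
      have := (hT a' (by simp only [maxRank]; omega)).append_succ [] v
      simp only [List.nil_append, List.cons_append] at this
      exact this.mono subset_rfl (by simp only [maxRank]; omega)
    exact h₅.trans h₇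

theorem tight_append {T : Set (Rule A)} {p : Rule A} (h : Tight T p) (x y : List A) :
    Tight T (x ++ p.1 ++ y, x ++ p.2 ++ y) := by
  refine Conn.append_bound h x y fun w hw => ?_
  simp only [maxRank] at hw ⊢
  have h₆ : rank w ≤ rank p.1 ∨ rank w ≤ rank p.2 := by omega
  rcases h₆ with h₆ | h₆
  · have := rank_append_le h₆ x y
    omega
  · have := rank_append_le h₆ x y
    omega

theorem cancelLeft_spec (p : Rule A) : Stage γ ι p (cancelLeft p) ∧
    ¬ ((cancelLeft p).2 ≠ [] ∧ (cancelLeft p).1.head? = (cancelLeft p).2.head?) := by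
  refine iterUntil_spec (P := fun q => Stage γ ι p q) maxRank ?_ (Stage.refl _ _ _)
  rintro ⟨u, v⟩ hq hd
  obtain ⟨h₁, h₂⟩ := not_not.1 hd
  rcases v with _ | ⟨y, v⟩
  · simp at h₁
  rcases u with _ | ⟨x, u⟩
  · simp at h₂
  simp only [List.head?_cons, Option.some.injEq] at h₂
  subst h₂
  simp only [List.tail_cons]
  have hmax : maxRank (u, v) < maxRank (x :: u, x :: v) := by
    have h₃ : rank u < rank (x :: u) := rank_lt_of_length_lt (by simp)
    have h₄ : rank v < rank (x :: v) := rank_lt_of_length_lt (by simp)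
    simp only [maxRank]
    omega
  refine ⟨hq.trans ⟨(List.suffix_cons x u).isInfix, Or.inr hmax, ?_, ?_⟩, hmax⟩
  · simp [val_cons]
  · intro T _ h
    simpa using tight_append h [x] []

theorem cancelRight_spec (p : Rule A) : Stage γ ι p (cancelRight p) := by
  refine (iterUntil_spec (P := fun q => Stage γ ι p q) maxRank ?_ (Stage.refl _ _ _)).1
  rintro ⟨u, v⟩ hq hd
  obtain ⟨h₁, h₂⟩ := not_not.1 hd
  simp only at h₁ h₂ ⊢
  rcases List.eq_nil_or_concat v with rfl | ⟨v, y, rfl⟩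
  · simp at h₁
  rcases List.eq_nil_or_concat u with rfl | ⟨u, x, rfl⟩
  · simp at h₂
  simp only [List.concat_eq_append, List.getLast?_append, List.getLast?_singleton, Option.some_or,
    Option.some.injEq] at h₂
  subst h₂
  simp only [List.concat_eq_append, List.dropLast_concat] at hq ⊢
  have hmax : maxRank (u, v) < maxRank (u ++ [x], v ++ [x]) := by
    have h₃ : rank u < rank (u ++ [x]) := rank_lt_of_length_lt (by simp)
    have h₄ : rank v < rank (v ++ [x]) := rank_lt_of_length_lt (by simp)
    simp only [maxRank]
    omega
  refine ⟨hq.trans ⟨(List.prefix_append u [x]).isInfix, Or.inr hmax, ?_, ?_⟩, hmax⟩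
  · simp [val_append]
  · intro T _ h
    simpa using tight_append h [] [x]

/-- The pair in a round of minimization after balancing and cancelling. -/
def balanceCancel (ι : A → A) (p : Rule A) : Rule A :=
  cancelRight (cancelLeft (balanceLeft ι (balanceRight ι p)))

theorem balanceCancel_spec (hι : Function.Involutive ι) (hγ : ∀ x, γ (ι x) = (γ x)⁻¹)
    (p : Rule A) : Stage γ ι p (balanceCancel ι p) :=
  (((balanceRight_spec hι hγ p).1.trans (balanceLeft_spec hγ _)).trans
    (cancelLeft_spec _).1).trans (cancelRight_spec _)

/-- A pair that is not changed by balancing and cancelling. -/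
theorem not_of_balanceCancel_eq (hι : Function.Involutive ι) (hγ : ∀ x, γ (ι x) = (γ x)⁻¹)
    {p : Rule A} (h : balanceCancel ι p = p) :
    ¬ TooLong p ∧ ¬ (p.2 ≠ [] ∧ p.1.head? = p.2.head?) := by
  have h₁ := balanceRight_spec hι hγ p
  have h₂ := balanceLeft_spec hγ (balanceRight ι p)
  have h₃ := cancelLeft_spec (γ := γ) (ι := ι) (balanceLeft ι (balanceRight ι p))
  have h₄ := cancelRight_spec (γ := γ) (ι := ι) (cancelLeft (balanceLeft ι (balanceRight ι p)))
  have h₅ : cancelRight (cancelLeft (balanceLeft ι (balanceRight ι p))) = p := h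
  have hle := h₁.1.maxRank_le
  have hle₂ := h₂.maxRank_le
  have hle₃ := h₃.1.maxRank_le
  have hle₄ := h₄.maxRank_le
  rw [h₅] at hle₄
  have e₁ : balanceRight ι p = p := by
    rcases h₁.1.eq_or_lt with e | e
    · exact e
    · omega
  have e₂ : balanceLeft ι (balanceRight ι p) = p := by
    rcases h₂.eq_or_lt with e | e
    · exact e.trans e₁
    · omega
  have e₃ : cancelLeft (balanceLeft ι (balanceRight ι p)) = p := by
    rcases h₃.1.eq_or_lt with e | e
    · exact e.trans e₂
    · omega
  refine ⟨?_, ?_⟩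
  · have := h₁.2
    rwa [e₁] at this
  · have := h₃.2
    rwa [e₃] at this

/-! ### The minimization of a rule -/

theorem infix_dropLast_or_infix_tail {u w : List A} (h : w <:+: u) (hw : w ≠ u) :
    w <:+: u.dropLast ∨ w <:+: u.tail := by
  obtain ⟨x, y, rfl⟩ := h
  rcases List.eq_nil_or_concat y with rfl | ⟨y, b, rfl⟩
  · rcases x with _ | ⟨a, x⟩
    · simp at hw
    · exact Or.inr ⟨x, [], by simp⟩
  · refine Or.inl ⟨x, y, ?_⟩
    rw [List.concat_eq_append, ← List.append_assoc (x ++ w), List.dropLast_concat]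

theorem minimizeRound_eq (M : RuleAut A) (c : Store A × Rule A) :
    minimizeRound ι M c = ((rReduce M (c.1, (balanceCancel ι c.2).2)).1,
      if SLt (balanceCancel ι c.2).1 (rReduce M (c.1, (balanceCancel ι c.2).2)).2 then
        ((rReduce M (c.1, (balanceCancel ι c.2).2)).2, (balanceCancel ι c.2).1)
      else ((balanceCancel ι c.2).1, (rReduce M (c.1, (balanceCancel ι c.2).2)).2)) := rfl

/-- A measure of pairs that decreases whenever a side is replaced by a smaller string, or both
sides are replaced by strings below the greater side. -/
def size (p : Rule A) : ℕ := maxRank p ^ 2 + (rank p.1 + rank p.2)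

theorem size_lt_of_maxRank_lt {p p' : Rule A} (h : maxRank p' < maxRank p) : size p' < size p := by
  have h₁ : rank p'.1 ≤ maxRank p' := le_max_left _ _
  have h₂ : rank p'.2 ≤ maxRank p' := le_max_right _ _
  unfold size
  nlinarith

/-- The measure that decreases in each round of minimization; a round may also just
interchange the two sides, in case they are in the wrong order. -/
def roundMeasure (p : Rule A) : ℕ := 2 * size p + if rank p.1 < rank p.2 then 1 else 0

theorem minimizeRound_lt (hι : Function.Involutive ι) (hγ : ∀ x, γ (ι x) = (γ x)⁻¹)
    {M : RuleAut A} (hM : GroupLabelled γ M) {c : Store A × Rule A}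
    (hS : ∀ r ∈ c.1.all, Sound γ r) (hc : (minimizeRound ι M c).2 ≠ c.2) :
    roundMeasure (minimizeRound ι M c).2 < roundMeasure c.2 := by
  obtain ⟨S, p⟩ := c
  rw [minimizeRound_eq] at *
  have h₁ := (balanceCancel_spec hι hγ p).eq_or_lt
  simp only at *
  set p₁ := balanceCancel ι p
  obtain ⟨hd, -⟩ := rReduce_spec hM hS p₁.2
  set d := rReduce M (S, p₁.2)
  clear_value d p₁
  have hle := hd.rank_le
  have hq : size (if SLt p₁.1 d.2 then (d.2, p₁.1) else (p₁.1, d.2)) = size (p₁.1, d.2) := by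
    split_ifs
    · unfold size maxRank
      rw [max_comm, add_comm (rank d.2)]
    · rfl
  have hq' : size (p₁.1, d.2) ≤ size p₁ := by
    unfold size maxRank
    simp only
    gcongr
  rcases h₁ with h₁ | h₁
  · subst h₁
    rcases hle.lt_or_eq with hlt | heq
    · have : size (p₁.1, d.2) < size p₁ := by
        have : max (rank p₁.1) (rank d.2) ^ 2 ≤ max (rank p₁.1) (rank p₁.2) ^ 2 := by gcongr
        unfold size maxRank
        simp only
        omega
      unfold roundMeasure
      rw [hq]
      split_ifs <;> omega
    · rw [rank_injective heq] at hc ⊢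
      split_ifs at hc ⊢ with h
      · have h' := rank_lt_iff.2 h
        unfold roundMeasure
        simp only
        rw [if_neg (by omega), if_pos h']
        have : size (p₁.2, p₁.1) = size p₁ := by
          unfold size maxRank
          rw [max_comm, add_comm (rank p₁.2)]
        omega
      · simp at hc
  · have := size_lt_of_maxRank_lt h₁
    unfold roundMeasure
    rw [hq]
    split_ifs <;> omega

theorem minimizeLoop_induction (hι : Function.Involutive ι) (hγ : ∀ x, γ (ι x) = (γ x)⁻¹)
    {M : RuleAut A} (hM : GroupLabelled γ M) {P : Store A × Rule A → Prop}
    (hP : ∀ c, P c → P (minimizeRound ι M c)) (hS : ∀ c, P c → ∀ r ∈ c.1.all, Sound γ r)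
    {c : Store A × Rule A} (hc : P c) :
    P (minimizeLoop ι M c) ∧
      (minimizeRound ι M (minimizeLoop ι M c)).2 = (minimizeLoop ι M c).2 :=
  iterUntil_spec (P := P) (fun c => roundMeasure c.2)
    (fun c h hc => ⟨hP c h, minimizeRound_lt hι hγ hM (hS c h) hc⟩) hc

theorem of_minimizeRound_eq (hι : Function.Involutive ι) (hγ : ∀ x, γ (ι x) = (γ x)⁻¹)
    {M : RuleAut A} (hM : GroupLabelled γ M) {c : Store A × Rule A}
    (hS : ∀ r ∈ c.1.all, Sound γ r) (hc : (minimizeRound ι M c).2 = c.2) :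
    c.2 = ([], []) ∨ Balanced c.2.1 c.2.2 ∧ ¬ Reducible (ruleSet M) c.2.2 := by
  obtain ⟨S, p⟩ := c
  rw [minimizeRound_eq] at *
  have h₁ := (balanceCancel_spec hι hγ p).eq_or_lt
  have h₂ := not_of_balanceCancel_eq hι hγ (p := p)
  simp only at *
  set p₁ := balanceCancel ι p
  obtain ⟨hd, hd'⟩ := rReduce_spec hM hS p₁.2
  set d := rReduce M (S, p₁.2)
  clear_value d p₁
  have hle := hd.rank_le
  rcases h₁ with h₁ | h₁
  · subst h₁
    obtain ⟨h₃, h₄⟩ := h₂ rfl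
    split_ifs at hc with h
    · have h₅ := congrArg Prod.fst hc
      simp only at h₅
      rw [h₅] at h
      exact absurd h (sLt_irrefl _)
    · have h₅ := congrArg Prod.snd hc
      simp only at h₅
      rw [h₅] at h hd'
      rcases sLt_trichotomy p₁.1 p₁.2 with h' | h' | h'
      · exact absurd h' h
      · left
        have h₆ : p₁.2 = [] := by
          by_contra h₆
          exact h₄ ⟨h₆, by rw [h']⟩
        exact Prod.ext (h'.trans h₆) h₆
      · have h₆ := rank_lt_iff.2 h'
        exact Or.inr ⟨⟨h₆, by simp only [TooLong] at h₃; omega, h₄⟩, hd'⟩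
  · exfalso
    have h₃ : maxRank (if SLt p₁.1 d.2 then (d.2, p₁.1) else (p₁.1, d.2)) ≤ maxRank p₁ := by
      split_ifs <;> simp only [maxRank] <;> omega
    rw [hc] at h₃
    omega

/-- The store and the output of the minimization routine. -/
def minimizeOut (ι : A → A) (M : RuleAut A) (S : Store A) (r : Rule A) : Store A × Rule A :=
  minimizeLoop ι M ((minimizeLeft M S r.1).1, ((minimizeLeft M S r.1).2, r.2))

/-- What the minimization routine achieves. The field `derives` says that `r` becomes superfluous
in the presence of the output and the rules used, as soon as those used have smaller left-hand
sides. -/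
structure Minimizes (γ : A → G) (ι : A → A) (M : RuleAut A) (S : Store A) (r : Rule A)
    (S' : Store A) (out : Rule A) : Prop where
  ext : Extends M (rank r.1) S S'
  val_eq : val γ out.1 = val γ out.2
  balanced : out = ([], []) ∨ Balanced out.1 out.2 ∧ ¬ Reducible (ruleSet M) out.2
  proper : ∀ w, w <:+: out.1 → w ≠ out.1 → ¬ Reducible (ruleSet M) w
  precedes : out.1 = r.1 ∧ rank out.2 ≤ rank r.2 ∧ (minimizeLeft M S r.1).2 = r.1 ∨
    rank out.1 < rank r.1
  derives : ∀ T : Set (Rule A), (∀ r' ∈ S'.all, rank r'.1 < rank r.1 → r' ∈ T) →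
    InverseConn ι T (rank r.1) → (out = ([], []) ∨ out ∈ T) → Conn T (rank r.1 + 1) r.1 r.2

theorem minimizeOut_spec (hι : Function.Involutive ι) (hγ : ∀ x, γ (ι x) = (γ x)⁻¹)
    {M : RuleAut A} (hM : GroupLabelled γ M) {S : Store A} (hS : ∀ r ∈ S.all, Sound γ r)
    {r : Rule A} (hr : Sound γ r) :
    Minimizes γ ι M S r (minimizeOut ι M S r).1 (minimizeOut ι M S r).2 := by
  have hne : r.1 ≠ [] := by
    intro h
    have := hr.2
    rw [h, rank_nil] at this
    omega
  obtain ⟨hl₁, hl₂, hl₃, hl₄⟩ := minimizeLeft_spec hM hS hne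
  have hr₂ := hr.2
  set l := minimizeLeft M S r.1 with hl
  have hl₅ : rank l.2 ≤ rank r.1 := by
    rcases hl₄ with h | h
    · rw [h.1]
    · exact h.1.le
  have key := minimizeLoop_induction hι hγ hM
    (c := (l.1, (l.2, r.2)))
    (P := fun c => Extends M (rank r.1) S c.1 ∧ val γ c.2.1 = val γ c.2.2 ∧
      rank c.2.2 < rank r.1 ∧ (∀ w, w <:+: c.2.1 → w ≠ c.2.1 → ¬ Reducible (ruleSet M) w) ∧
      (c.2.1 = r.1 ∧ rank c.2.2 ≤ rank r.2 ∧ l.2 = r.1 ∨ rank c.2.1 < rank r.1) ∧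
      ∀ T : Set (Rule A), (∀ r' ∈ c.1.all, rank r'.1 < rank r.1 → r' ∈ T) →
        InverseConn ι T (rank r.1) → Tight T c.2 → Tight T (l.2, r.2)) ?_ ?_ ?_
  · obtain ⟨⟨h₁, h₂, h₃, h₄, h₅, h₆⟩, h₇⟩ := key
    refine ⟨h₁, h₂, of_minimizeRound_eq hι hγ hM (h₁.sound hM hS) h₇, h₄, h₅, ?_⟩
    intro T hT hinv hout
    have ht : Tight T (minimizeOut ι M S r).2 := by
      rcases hout with hout | hout
      · rw [hout]
        exact Conn.refl _
      · exact Conn.of_rule hout (by simp only [maxRank]; omega) (by simp only [maxRank]; omega)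
    have h₈ := h₆ T hT hinv ht
    have h₉ : Conn T (rank r.1 + 1) r.1 l.2 := by
      refine hl₃ T fun r' hr' => hT r' ?_
      refine (minimizeLoop_induction hι hγ hM (c := (l.1, (l.2, r.2)))
        (P := fun c => (∀ r ∈ c.1.all, Sound γ r) ∧ r' ∈ c.1.all) ?_ (fun c hc => hc.1)
        ⟨hl₁.sound hM hS, hr'⟩).1.2
      rintro c ⟨hc, hc'⟩
      have := (rReduce_spec hM hc (balanceCancel ι c.2).2).1.ext
      exact ⟨this.sound hM hc, this.all_subset hc'⟩
    refine h₉.trans (Conn.mono h₈ subset_rfl ?_)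
    simp only [maxRank]
    omega
  · rintro ⟨S₁, p⟩ ⟨h₁, h₂, h₃, h₄, h₅, h₆⟩
    simp only at *
    have hs := balanceCancel_spec hι hγ (γ := γ) p
    have hS₁ := h₁.sound hM hS
    obtain ⟨hd, hd'⟩ := rReduce_spec hM hS₁ (balanceCancel ι p).2
    rw [minimizeRound_eq]
    simp only
    set p₁ := balanceCancel ι p
    set d := rReduce M (S₁, p₁.2)
    have hdle := hd.rank_le
    have hv := hs.val_eq h₂
    have hpmax : maxRank p ≤ rank r.1 := by
      have : rank p.1 ≤ rank r.1 := by
        rcases h₅ with h | h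
        · rw [h.1]
        · exact h.le
      simp only [maxRank]
      omega
    have h₁₀ : rank p₁.2 < rank r.1 ∧
        (p₁.1 = r.1 ∧ rank p₁.2 ≤ rank r.2 ∧ l.2 = r.1 ∨ rank p₁.1 < rank r.1) := by
      rcases hs.eq_or_lt with h | h
      · rw [h]
        exact ⟨h₃, h₅⟩
      · have : maxRank p₁ < rank r.1 := by omega
        simp only [maxRank] at this
        exact ⟨by omega, Or.inr (by omega)⟩
    have h₁₁ : ∀ w, w <:+: p₁.1 → w ≠ p₁.1 → ¬ Reducible (ruleSet M) w := by
      intro w hw hw'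
      refine h₄ w (hw.trans hs.isInfix) ?_
      rintro rfl
      exact hw' (hw.eq_of_length_le hs.isInfix.length_le)
    have h₁₂ : ∀ T : Set (Rule A), (∀ r' ∈ d.1.all, rank r'.1 < rank r.1 → r' ∈ T) →
        InverseConn ι T (rank r.1) → Tight T (p₁.1, d.2) → Tight T (l.2, r.2) := by
      intro T hT hinv ht
      refine h₆ T (fun r' hr' => hT r' (hd.ext.all_subset hr')) hinv ?_
      refine hs.tight T (hinv.mono hpmax) ?_
      have h₁₃ := hd.conn_of_mem hM hS₁ hT h₁₀.1
      unfold Tight at *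
      refine (ht.mono subset_rfl ?_).trans (h₁₃.symm.mono subset_rfl ?_)
      · simp only [maxRank]
        omega
      · simp only [maxRank]
        omega
    refine ⟨h₁.trans (hd.ext.mono (by omega)), ?_⟩
    split_ifs with h
    · have h' := rank_lt_iff.2 h
      refine ⟨hd.val_eq.trans hv.symm, by simp only; omega, ?_, Or.inr (by simp only; omega), ?_⟩
      · exact fun w hw _ hred => hd' (hred.mono hw)
      · intro T hT hinv ht
        refine h₁₂ T hT hinv ?_
        unfold Tight maxRank at *
        simp only at *
        rw [max_comm]
        exact ht.symm
    · refine ⟨hv.trans hd.val_eq.symm, by simp only; omega, h₁₁, ?_, h₁₂⟩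
      simp only
      rcases h₁₀.2 with h' | h'
      · exact Or.inl ⟨h'.1, by omega, h'.2.2⟩
      · exact Or.inr h'
  · exact fun c hc => hc.1.sound hM hS
  · refine ⟨hl₁, hl₂.trans hr.1, hr.2, ?_, ?_, fun T _ _ h => h⟩
    · intro w hw hw' hred
      simp only at hw hw'
      rcases hl₄ with ⟨h₁, h₂, h₃⟩ | ⟨h₁, h₂⟩
      · rw [h₁] at hw hw'
        rcases infix_dropLast_or_infix_tail hw hw' with h | h
        · exact h₂ (hred.mono h)
        · exact h₃ (hred.mono h)
      · exact h₂ (hred.mono hw)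
    · rcases hl₄ with h | h
      · exact Or.inl ⟨h.1, le_rfl, h.1⟩
      · exact Or.inr h.1

theorem Minimizes.sound_out {M : RuleAut A} {S S' : Store A} {r out : Rule A}
    (h : Minimizes γ ι M S r S' out) (hout : out ≠ ([], [])) : Sound γ out :=
  ⟨h.val_eq, (h.balanced.resolve_left hout).1.1⟩

theorem Minimizes.weight_lt {M : RuleAut A} {S S' : Store A} {r out : Rule A}
    (h : Minimizes γ ι M S r S' out) (hout : out ≠ ([], [])) (hne : out ≠ r) :
    weight out < weight r := by
  rcases h.precedes with h₁ | h₁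
  · refine weight_lt_of_snd_lt h₁.1 (lt_of_le_of_ne h₁.2.1 fun e => hne ?_)
    exact Prod.ext h₁.1 (rank_injective e)
  · exact weight_lt_of_fst_lt (h.sound_out hout).2 h₁

/-- The rule `r` is derivable from what is left of it after its minimization. -/
theorem Minimizes.derivable {M : RuleAut A}
    (hM : GroupLabelled γ M) {S S' : Store A} {r out : Rule A} (h : Minimizes γ ι M S r S' out)
    (hS : ∀ r ∈ S.all, Sound γ r) (hinv : ∀ x, Conn (S.all : Set (Rule A)) (rank [x, ι x] + 1)
      [x, ι x] []) {T : Set (Rule A)} (hT : ∀ r' ∈ S'.all, r' ≠ r → r' ∈ T)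
    (hout : out = ([], []) ∨ out ∈ T) (hne : out ≠ r) : Derivable T r := by
  have hS' := h.ext.sound hM hS
  have key : ∀ r' ∈ S'.all, rank r'.1 < rank r.1 → r' ∈ {r' ∈ T | weight r' < weight r} := by
    intro r' hr' hlt
    refine ⟨hT r' hr' ?_, weight_lt_of_fst_lt (hS' r' hr').2 hlt⟩
    rintro rfl
    omega
  refine h.derives _ key ?_ ?_
  · intro x hx
    exact (hinv x).of_bounded (fun r hr => (hS r hr).2) fun r' hr' hlt =>
      key r' (h.ext.all_subset hr') (by omega)
  · rcases hout with hout | hout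
    · exact Or.inl hout
    · by_cases hn : out = ([], [])
      · exact Or.inl hn
      · exact Or.inr ⟨hout, h.weight_lt hn hne⟩

/-! ### Foldings of rule automata -/

/-- The map `φ` of labels takes the arrows of `E` to arrows of `E'`, or to `(x, x)`-loops at the
initial state, and it does not increase labels (so that the initial state is fixed). -/
structure Folds (φ : List A → List A) (E E' : RuleAut A) : Prop where
  rank_le : ∀ s, rank (φ s) ≤ rank s
  arrow : ∀ a ∈ E, (φ a.1, a.2.1, φ a.2.2) ∈ E' ∨ φ a.1 = [] ∧ φ a.2.2 = [] ∧ IsDiag a.2.1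

theorem Folds.nil {φ : List A → List A} {E E' : RuleAut A} (h : Folds φ E E') : φ [] = [] :=
  eq_nil_of_rank_le (h.rank_le [])

theorem Folds.id (E : RuleAut A) : Folds (fun s => s) E E :=
  ⟨fun _ => le_rfl, fun _ h => Or.inl h⟩

theorem Folds.comp {φ ψ : List A → List A} {E E' E'' : RuleAut A} (h₂ : Folds ψ E' E'')
    (h₁ : Folds φ E E') : Folds (fun s => ψ (φ s)) E E'' := by
  refine ⟨fun s => (h₂.rank_le _).trans (h₁.rank_le s), fun a ha => ?_⟩
  rcases h₁.arrow a ha with h | ⟨h, h', h''⟩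
  · exact h₂.arrow _ h
  · rw [h, h', h₂.nil]
    exact Or.inr ⟨rfl, rfl, h''⟩

theorem Folds.mono {φ : List A → List A} {E E' F F' : RuleAut A} (h : Folds φ E E') (hF : F ⊆ E)
    (hF' : E' ⊆ F') : Folds φ F F' :=
  ⟨h.rank_le, fun a ha => (h.arrow a (hF ha)).imp_left fun h => hF' h⟩

theorem LoopWalk.folds {φ : List A → List A} {E E' : RuleAut A} (h : Folds φ E E')
    {z : List (Letter A)} {σ : ℕ → List A} (hw : LoopWalk E z σ) :
    LoopWalk E' z fun i => φ (σ i) := by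
  intro i a ha
  rcases hw i a ha with h' | ⟨h₁, h₂, h₃⟩
  · exact h.arrow _ h'
  · exact Or.inr ⟨by simp only [h₁, h.nil], by simp only [h₂, h.nil], h₃⟩

theorem LoopWalk.mono {E E' : RuleAut A} (h : E ⊆ E') {z : List (Letter A)} {σ : ℕ → List A}
    (hw : LoopWalk E z σ) : LoopWalk E' z σ :=
  fun i a ha => (hw i a ha).imp_left fun h' => h h'

/-- With additional `(x, x)`-loops at the initial state, `E` reads `z` from `s` to `t`. -/
def LoopReads (E : RuleAut A) (s : List A) (z : List (Letter A)) (t : List A) : Prop :=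
  ∃ σ, σ 0 = s ∧ LoopWalk E z σ ∧ σ z.length = t

theorem LoopReads.nil (E : RuleAut A) (s : List A) : LoopReads E s [] s :=
  ⟨fun _ => s, rfl, by simp [LoopWalk], rfl⟩

theorem LoopReads.cons {E : RuleAut A} {s s' t : List A} {a : Letter A} {z : List (Letter A)}
    (h : (s, a, s') ∈ E) (hz : LoopReads E s' z t) : LoopReads E s (a :: z) t := by
  obtain ⟨σ, rfl, hw, rfl⟩ := hz
  refine ⟨fun i => Nat.casesOn i s σ, rfl, ?_, rfl⟩
  rintro (_ | i) b hb
  · simp only [List.getElem?_cons_zero, Option.some.injEq] at hb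
    exact Or.inl (hb ▸ h)
  · exact hw i b (by simpa using hb)

theorem LoopReads.append {E : RuleAut A} {s t w : List A} {z z' : List (Letter A)}
    (h : LoopReads E s z t) (h' : LoopReads E t z' w) : LoopReads E s (z ++ z') w := by
  obtain ⟨σ, rfl, hw, rfl⟩ := h
  obtain ⟨τ, h₀, hw', rfl⟩ := h'
  refine ⟨fun i => if i ≤ z.length then σ i else τ (i - z.length), by simp, ?_, ?_⟩
  · intro i a ha
    simp only
    by_cases hi : i < z.length
    · rw [List.getElem?_append_left hi] at ha
      rw [if_pos hi.le, if_pos (by omega)]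
      exact hw i a ha
    · rw [List.getElem?_append_right (by omega)] at ha
      have := hw' _ a ha
      have h₁ : (if i ≤ z.length then σ i else τ (i - z.length)) = τ (i - z.length) := by
        split_ifs with h
        · rw [show i = z.length by omega, Nat.sub_self, h₀]
        · rfl
      rw [h₁, if_neg (by omega), show i + 1 - z.length = i - z.length + 1 by omega]
      exact this
  · simp only [List.length_append, Nat.add_sub_cancel_left]
    split_ifs with h
    · have h₁ : z'.length = 0 := by omega
      rw [h₁, h₀, Nat.add_zero]
    · rfl

theorem LoopReads.folds {φ : List A → List A} {E E' : RuleAut A} (h : Folds φ E E')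
    {s t : List A} {z : List (Letter A)} (hz : LoopReads E s z t) :
    LoopReads E' (φ s) z (φ t) := by
  obtain ⟨σ, rfl, hw, rfl⟩ := hz
  exact ⟨_, rfl, hw.folds h, rfl⟩

theorem LoopReads.mono {E E' : RuleAut A} (h : E ⊆ E') {s t : List A} {z : List (Letter A)}
    (hz : LoopReads E s z t) : LoopReads E' s z t := by
  obtain ⟨σ, h₀, hw, h₁⟩ := hz
  exact ⟨σ, h₀, hw.mono h, h₁⟩

theorem LoopReads.val_eq {E : RuleAut A} (hE : GroupLabelled γ E) {s t : List A}
    {z : List (Letter A)} (h : LoopReads E s z t) :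
    val γ t = (val γ (z.filterMap Prod.fst))⁻¹ * val γ s * val γ (z.filterMap Prod.snd) := by
  induction z generalizing s with
  | nil =>
    obtain ⟨σ, rfl, -, rfl⟩ := h
    simp [val_nil]
  | cons a z ih =>
    obtain ⟨σ, rfl, hw, rfl⟩ := h
    have h₁ := @ih (σ 1) ⟨fun i => σ (i + 1), rfl, fun i b hb => hw (i + 1) b (by simpa using hb),
      rfl⟩
    have h₂ : val γ (σ 1) = (val γ a.1.toList)⁻¹ * val γ (σ 0) * val γ a.2.toList := by
      rcases hw 0 a (by simp) with h | ⟨h, h', x, rfl⟩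
      · exact hE _ h
      · rw [zero_add] at h'
        rw [h, h']
        simp [val]
    have h₃ : ∀ (f : Letter A → Option A), val γ ((a :: z).filterMap f) =
        val γ (f a).toList * val γ (z.filterMap f) := by
      intro f
      rw [← val_append]
      rcases h : f a with _ | x <;> simp [h]
    rw [h₃, h₃, h₁, h₂]
    group

/-! ### Welding -/

section Weld

variable {E F : RuleAut A} {j : List A × List A}

theorem weldRel_weldLabel (E : RuleAut A) (j : List A × List A) (s : List A) :
    WeldRel E j s (weldLabel E j s) :=
  slMin_mem (T := {t | WeldRel E j s t}) ⟨s, WeldRel.refl s⟩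

theorem rank_weldLabel_le (E : RuleAut A) (j : List A × List A) (s : List A) :
    rank (weldLabel E j s) ≤ rank s :=
  rank_slMin_le (T := {t | WeldRel E j s t}) (WeldRel.refl s)

theorem weldLabel_eq_of_weldRel {s t : List A} (h : WeldRel E j s t) :
    weldLabel E j s = weldLabel E j t := by
  unfold weldLabel
  congr 1
  ext w
  exact ⟨fun h' => h.symm.trans h', fun h' => h.trans h'⟩

theorem weldRel_of_weldLabel_eq {s t : List A} (h : weldLabel E j s = weldLabel E j t) :
    WeldRel E j s t :=
  (weldRel_weldLabel E j s).trans (h ▸ (weldRel_weldLabel E j t).symm)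

theorem weldLabel_nil (E : RuleAut A) (j : List A × List A) : weldLabel E j [] = [] :=
  eq_nil_of_rank_le (rank_weldLabel_le E j [])

theorem mem_weldImage {a : Arrow A} : a ∈ weldImage E j F ↔
    (∃ b ∈ F, a = (weldLabel E j b.1, b.2.1, weldLabel E j b.2.2)) ∧
      ¬ (a.1 = [] ∧ IsDiag a.2.1) := by
  simp [weldImage, IsDiag, eq_comm]

theorem weldImage_mono {F' : RuleAut A} (h : F ⊆ F') : weldImage E j F ⊆ weldImage E j F' := by
  intro a ha
  rw [mem_weldImage] at *
  exact ⟨ha.1.imp fun b hb => ⟨h hb.1, hb.2⟩, ha.2⟩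

theorem folds_weldImage (hF : F ⊆ E) : Folds (weldLabel E j) F (weldImage E j F) := by
  refine ⟨rank_weldLabel_le E j, fun a ha => ?_⟩
  by_cases h : weldLabel E j a.1 = [] ∧ IsDiag a.2.1
  · obtain ⟨h, x, hx⟩ := h
    obtain ⟨s, b, t⟩ := a
    simp only at h hx
    subst hx
    refine Or.inr ⟨h, ?_, x, rfl⟩
    have h₁ : WeldRel E j s [] := weldRel_of_weldLabel_eq (h.trans (weldLabel_nil E j).symm)
    exact (weldLabel_eq_of_weldRel (WeldRel.diagSource (hF ha) h₁)).trans (weldLabel_nil E j)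
  · exact Or.inl (mem_weldImage.2 ⟨⟨a, ha, rfl⟩, h⟩)

theorem noInitialDiag_weldImage : NoInitialDiag (weldImage E j F) :=
  fun _ ha => (mem_weldImage.1 ha).2

/-- The arrows of `E` are determined by their sources and letters. -/
def Deterministic (E : RuleAut A) : Prop :=
  ∀ s a t t', (s, a, t) ∈ E → (s, a, t') ∈ E → t = t'

theorem Deterministic.mono (h : Deterministic E) (hF : F ⊆ E) : Deterministic F :=
  fun s a t t' h₁ h₂ => h s a t t' (hF h₁) (hF h₂)

theorem deterministic_weldImage : Deterministic (weldImage E j E) := by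
  intro s a t t' h h'
  obtain ⟨⟨⟨s₁, a₁, t₁⟩, h₁, e₁⟩, -⟩ := mem_weldImage.1 h
  obtain ⟨⟨⟨s₂, a₂, t₂⟩, h₂, e₂⟩, -⟩ := mem_weldImage.1 h'
  simp only [Prod.mk.injEq] at e₁ e₂
  obtain ⟨rfl, rfl, rfl⟩ := e₁
  obtain ⟨e₃, rfl, rfl⟩ := e₂
  exact weldLabel_eq_of_weldRel (WeldRel.forward h₁ h₂ (weldRel_of_weldLabel_eq e₃))

theorem WeldRel.val_eq (hE : GroupLabelled γ E) (hj : val γ j.1 = val γ j.2) {s t : List A}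
    (h : WeldRel E j s t) : val γ s = val γ t := by
  induction h with
  | refl => rfl
  | symm _ ih => exact ih.symm
  | trans _ _ ih₁ ih₂ => exact ih₁.trans ih₂
  | join => exact hj
  | forward h₁ h₂ _ ih =>
    have h₃ := hE _ h₁
    have h₄ := hE _ h₂
    simp only at h₃ h₄
    rw [h₃, h₄, ih]
  | backward h₁ h₂ _ ih =>
    have h₃ := hE _ h₁
    have h₄ := hE _ h₂
    simp only at h₃ h₄
    rw [h₃, h₄] at ih
    exact mul_left_cancel (mul_right_cancel ih)
  | diagSource h₁ _ ih =>
    have h₃ := hE _ h₁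
    simp only [ih] at h₃
    rw [h₃]
    simp [val]
  | diagTarget h₁ _ ih =>
    have h₃ := hE _ h₁
    simp only [ih, Option.toList_some] at h₃
    rw [val_nil, eq_comm, mul_assoc, inv_mul_eq_one, eq_comm, mul_eq_right] at h₃
    exact h₃

theorem val_weldLabel (hE : GroupLabelled γ E) (hj : val γ j.1 = val γ j.2) (s : List A) :
    val γ (weldLabel E j s) = val γ s :=
  ((weldRel_weldLabel E j s).val_eq hE hj).symm

theorem groupLabelled_weldImage (hE : GroupLabelled γ E) (hj : val γ j.1 = val γ j.2) :
    GroupLabelled γ (weldImage E j E) := by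
  intro a ha
  obtain ⟨⟨b, hb, rfl⟩, -⟩ := mem_weldImage.1 ha
  simp only [val_weldLabel hE hj]
  exact hE b hb

end Weld

/-! ### Normalization of the labels -/

theorem mem_states {E : RuleAut A} {s : List A} :
    s ∈ states E ↔ s = [] ∨ ∃ a ∈ E, s = a.1 ∨ s = a.2.2 := by
  simp only [states, Finset.mem_union, Finset.mem_singleton, Finset.mem_image]
  constructor
  · rintro ((h | ⟨a, h, rfl⟩) | ⟨a, h, rfl⟩)
    · exact Or.inl h
    · exact Or.inr ⟨a, h, Or.inl rfl⟩
    · exact Or.inr ⟨a, h, Or.inr rfl⟩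
  · rintro (h | ⟨a, h, rfl | rfl⟩)
    · exact Or.inl (Or.inl h)
    · exact Or.inl (Or.inr ⟨a, h, rfl⟩)
    · exact Or.inr ⟨a, h, rfl⟩

theorem GroupLabelled.mono {E F : RuleAut A} (h : GroupLabelled γ E) (hF : F ⊆ E) :
    GroupLabelled γ F :=
  fun a ha => h a (hF ha)

/-- The properties of `WDiff` and of `Rules` that do not depend on the history. -/
structure IsRuleAut (γ : A → G) (E : RuleAut A) : Prop where
  groupLabelled : GroupLabelled γ E
  deterministic : Deterministic E
  noInitialDiag : NoInitialDiag E

theorem IsRuleAut.mono {E F : RuleAut A} (h : IsRuleAut γ E) (hF : F ⊆ E) : IsRuleAut γ F :=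
  ⟨h.1.mono hF, h.2.mono hF, fun a ha => h.3 a (hF ha)⟩

theorem relabel_spec {E : RuleAut A} (hE : GroupLabelled γ E) {S : Store A}
    (hS : ∀ r ∈ S.all, Sound γ r) :
    IsRuleAut γ (relabel S E) ∧ ∃ φ, Folds φ E (relabel S E) ∧
      (∀ s, Reducible (ruleSet E) s → rank (φ s) < rank s) ∧
      ∀ s ∈ states (relabel S E), ∃ t ∈ states E, s = φ t := by
  set red := fun w : List A => (rReduce E (S, w)).2 with hred
  set F : RuleAut A := E.image fun a => (red a.1, a.2.1, red a.2.2) with hF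
  have hrel : relabel S E = weldImage F ([], []) F := by
    unfold relabel
    simp only [hF]
    congr!
  have hmemF : ∀ a ∈ E, (red a.1, a.2.1, red a.2.2) ∈ F := fun a ha =>
    Finset.mem_image.2 ⟨a, ha, rfl⟩
  have hgF : GroupLabelled γ F := by
    intro a ha
    obtain ⟨b, hb, rfl⟩ := Finset.mem_image.1 ha
    simp only [hred, (rReduce_spec hE hS _).1.val_eq]
    exact hE b hb
  have hφ₁ : Folds red E F :=
    ⟨fun s => (rReduce_spec hE hS s).1.rank_le, fun a ha => Or.inl (hmemF a ha)⟩
  have hφ₂ : Folds (weldLabel F ([], [])) F (weldImage F ([], []) F) :=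
    folds_weldImage subset_rfl
  rw [hrel]
  refine ⟨⟨groupLabelled_weldImage hgF rfl, deterministic_weldImage, noInitialDiag_weldImage⟩,
    _, hφ₂.comp hφ₁, ?_, ?_⟩
  · intro s hs
    have h := rReduce_spec hE hS s
    exact (hφ₂.rank_le _).trans_lt (h.1.rank_lt hs h.2)
  · intro s hs
    rcases mem_states.1 hs with rfl | ⟨a, ha, hs⟩
    · exact ⟨[], mem_states.2 (Or.inl rfl), ((hφ₂.comp hφ₁).nil).symm⟩
    · obtain ⟨⟨b, hb, rfl⟩, -⟩ := mem_weldImage.1 ha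
      obtain ⟨c, hc, rfl⟩ := Finset.mem_image.1 hb
      rcases hs with rfl | rfl
      · exact ⟨c.1, mem_states.2 (Or.inr ⟨c, hc, Or.inl rfl⟩), rfl⟩
      · exact ⟨c.2.2, mem_states.2 (Or.inr ⟨c, hc, Or.inr rfl⟩), rfl⟩

theorem sum_rank_states_lt {E E' : RuleAut A} {φ : List A → List A} (hφ : ∀ s, rank (φ s) ≤ rank s)
    (hs : ∀ s ∈ states E', ∃ t ∈ states E, s = φ t) (hlt : ∃ s ∈ states E, rank (φ s) < rank s) :
    ∑ s ∈ states E', rank s < ∑ s ∈ states E, rank s := by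
  choose! g hg hg' using hs
  calc ∑ s ∈ states E', rank s = ∑ s ∈ states E', rank (φ (g s)) :=
        Finset.sum_congr rfl fun s hs => by rw [← hg' s hs]
    _ = ∑ t ∈ (states E').image g, rank (φ t) := by
        rw [Finset.sum_image]
        intro s hs t ht h
        rw [hg' s hs, hg' t ht, h]
    _ ≤ ∑ t ∈ states E, rank (φ t) :=
        Finset.sum_le_sum_of_subset (Finset.image_subset_iff.2 hg)
    _ < ∑ s ∈ states E, rank s := Finset.sum_lt_sum (fun s _ => hφ s) hlt

theorem normalize_spec {E : RuleAut A} (hE : IsRuleAut γ E) {S : Store A}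
    (hS : ∀ r ∈ S.all, Sound γ r) :
    (IsRuleAut γ (normalize S E) ∧ ∃ φ, Folds φ E (normalize S E)) ∧
      ∀ s ∈ states (normalize S E), ¬ Reducible (ruleSet (normalize S E)) s := by
  refine iterUntil_spec (P := fun F => IsRuleAut γ F ∧ ∃ φ, Folds φ E F)
    (fun F => ∑ s ∈ states F, rank s) ?_ ⟨hE, _, Folds.id E⟩
  rintro F ⟨hF, φ, hφ⟩ hd
  push Not at hd
  obtain ⟨s, hs, hred⟩ := hd
  obtain ⟨h₁, ψ, h₂, h₃, h₄⟩ := relabel_spec hF.groupLabelled hS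
  exact ⟨⟨h₁, _, h₂.comp hφ⟩, sum_rank_states_lt h₂.rank_le h₄ ⟨s, hs, h₃ s hred⟩⟩

/-! ### Sewing -/

theorem readForward_cons_of_mem {E : RuleAut A} (hE : Deterministic E) {s t : List A}
    {a : Letter A} (l : List (Letter A)) (h : (s, a, t) ∈ E) :
    readForward E s (a :: l) = ((s, a, t) :: (readForward E t l).1, (readForward E t l).2) := by
  have hex : ∃ t, (s, a, t) ∈ E := ⟨t, h⟩
  have : hex.choose = t := hE _ _ _ _ hex.choose_spec h
  rw [readForward]
  simp only [dif_pos hex, this]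

theorem readForward_spec (E : RuleAut A) (s : List A) (l : List (Letter A)) :
    (∀ a ∈ (readForward E s l).1, a ∈ E) ∧ ∃ z, l = z ++ (readForward E s l).2.2 ∧
      LoopReads (readForward E s l).1.toFinset s z (readForward E s l).2.1 := by
  induction l generalizing s with
  | nil => exact ⟨by simp [readForward], [], rfl, LoopReads.nil _ _⟩
  | cons a l ih =>
    rw [readForward]
    split_ifs with h
    · obtain ⟨h₁, z, h₂, h₃⟩ := ih h.choose
      refine ⟨?_, a :: z, ?_, ?_⟩
      · intro b hb
        rcases List.mem_cons.1 hb with rfl | hb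
        · exact h.choose_spec
        · exact h₁ b hb
      · rw [List.cons_append, ← h₂]
      · refine LoopReads.cons (s' := h.choose) (by simp) (h₃.mono ?_)
        intro b hb
        simp only [List.mem_toFinset, List.mem_cons] at *
        exact Or.inr hb
    · exact ⟨by simp, [], rfl, LoopReads.nil _ _⟩

theorem readBackward_spec (E : RuleAut A) (t : List A) (l : List (Letter A)) :
    (∀ a ∈ (readBackward E t l).1, a ∈ E) ∧ ∃ z, l = z ++ (readBackward E t l).2.2 ∧
      LoopReads (readBackward E t l).1.toFinset (readBackward E t l).2.1 z.reverse t := by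
  induction l generalizing t with
  | nil => exact ⟨by simp [readBackward], [], rfl, LoopReads.nil _ _⟩
  | cons a l ih =>
    rw [readBackward]
    split_ifs with h
    · obtain ⟨h₁, z, h₂, h₃⟩ := ih h.choose
      refine ⟨?_, a :: z, ?_, ?_⟩
      · intro b hb
        rcases List.mem_cons.1 hb with rfl | hb
        · exact h.choose_spec
        · exact h₁ b hb
      · rw [List.cons_append, ← h₂]
      · rw [List.reverse_cons]
        refine (h₃.mono ?_).append (LoopReads.cons (by simp) (LoopReads.nil _ _))
        intro b hb
        simp only [List.mem_toFinset, List.mem_cons] at *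
        exact Or.inr hb
    · exact ⟨by simp, [], rfl, LoopReads.nil _ _⟩

theorem newArrows_spec (hγ : ∀ x, γ (ι x) = (γ x)⁻¹) {red : List A → List A}
    (hred : ∀ w, val γ (red w) = val γ w) (s : List A) (l : List (Letter A)) :
    (∀ a ∈ (newArrows ι red s l).1,
      val γ a.2.2 = (val γ a.2.1.1.toList)⁻¹ * val γ a.1 * val γ a.2.1.2.toList) ∧
      LoopReads (newArrows ι red s l).1.toFinset s l (newArrows ι red s l).2 := by
  induction l generalizing s with
  | nil => exact ⟨by simp [newArrows], LoopReads.nil _ _⟩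
  | cons a l ih =>
    rw [newArrows]
    obtain ⟨h₁, h₂⟩ := ih (red ((a.1.map ι).toList ++ s ++ a.2.toList))
    refine ⟨?_, LoopReads.cons (s' := red ((a.1.map ι).toList ++ s ++ a.2.toList)) (by simp)
      (h₂.mono ?_)⟩
    · intro b hb
      rcases List.mem_cons.1 hb with rfl | hb
      · simp only [hred, val_append]
        rcases a.1 with _ | x <;> simp [val, hγ]
      · exact h₁ b hb
    · intro b hb
      simp only [List.mem_toFinset, List.mem_cons] at *
      exact Or.inr hb

theorem Walk.readForward_eq {E : RuleAut A} (hE : Deterministic E) {z : List (Letter A)}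
    {σ : ℕ → List A} (hw : Walk E z σ) :
    (readForward E (σ 0) z).2 = (σ z.length, []) ∧
      ∀ b, b ∈ (readForward E (σ 0) z).1 ↔
        ∃ i a, z[i]? = some a ∧ b = (σ i, a, σ (i + 1)) := by
  induction z generalizing σ with
  | nil => simp [readForward]
  | cons a z ih =>
    have h₀ := hw 0 a (by simp)
    rw [readForward_cons_of_mem hE z h₀]
    have hw' : Walk E z fun i => σ (i + 1) := fun i b hb => hw (i + 1) b (by simpa using hb)
    obtain ⟨h₁, h₂⟩ := ih hw'
    refine ⟨h₁, fun b => ?_⟩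
    simp only at h₂ ⊢
    rw [List.mem_cons, h₂]
    constructor
    · rintro (rfl | ⟨i, c, hc, rfl⟩)
      · exact ⟨0, a, by simp, rfl⟩
      · exact ⟨i + 1, c, by simpa using hc, rfl⟩
    · rintro ⟨_ | i, c, hc, rfl⟩
      · simp only [List.getElem?_cons_zero, Option.some.injEq] at hc
        exact Or.inl (by rw [hc])
      · exact Or.inr ⟨i, c, by simpa using hc, rfl⟩

/-- The invariants of `WDiff`. -/
structure IsWDiff (γ : A → G) (W : WDiff A) : Prop where
  isRuleAut : IsRuleAut γ W.arrows
  needed_subset : W.needed ⊆ W.arrows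

theorem sew_spec (hγ : ∀ x, γ (ι x) = (γ x)⁻¹) {red : List A → List A}
    (hred : ∀ w, val γ (red w) = val γ w) {W : WDiff A} (hW : IsWDiff γ W) {r : Rule A}
    (hr : val γ r.1 = val γ r.2) :
    IsWDiff γ (sew ι red W r) ∧ LoopReads (sew ι red W r).needed [] (pad r.1 r.2) [] ∧
      ∃ φ, Folds φ W.arrows (sew ι red W r).arrows ∧ Folds φ W.needed (sew ι red W r).needed ∧
        ∀ σ, σ 0 = [] → Walk W.arrows (pad r.1 r.2) σ →
          LoopWalk (sew ι red W r).needed (pad r.1 r.2) fun i => φ (σ i) := by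
  obtain ⟨hf₁, zf, hf₂, hf₃⟩ := readForward_spec W.arrows [] (pad r.1 r.2)
  set f := readForward W.arrows [] (pad r.1 r.2) with hf
  obtain ⟨hb₁, zb, hb₂, hb₃⟩ := readBackward_spec W.arrows [] f.2.2.reverse
  set b := readBackward W.arrows [] f.2.2.reverse with hb
  obtain ⟨hm₁, hm₂⟩ := newArrows_spec hγ hred f.2.1 b.2.2.reverse
  set m := newArrows ι red f.2.1 b.2.2.reverse with hm
  set E := W.arrows ∪ m.1.toFinset with hE
  set N := W.needed ∪ f.1.toFinset ∪ b.1.toFinset ∪ m.1.toFinset with hN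
  have hsew : sew ι red W r = ⟨weldImage E (m.2, b.2.1) E, weldImage E (m.2, b.2.1) N⟩ := rfl
  have hNE : N ⊆ E := by
    intro a ha
    simp only [hN, hE, Finset.mem_union, List.mem_toFinset] at *
    rcases ha with ((ha | ha) | ha) | ha
    · exact Or.inl (hW.needed_subset ha)
    · exact Or.inl (hf₁ a ha)
    · exact Or.inl (hb₁ a ha)
    · exact Or.inr ha
  have hgE : GroupLabelled γ E := by
    intro a ha
    rcases Finset.mem_union.1 ha with ha | ha
    · exact hW.isRuleAut.groupLabelled a ha
    · exact hm₁ a (List.mem_toFinset.1 ha)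
  have hsplit : pad r.1 r.2 = zf ++ (b.2.2.reverse ++ zb.reverse) := by
    rw [hf₂, ← List.reverse_append, ← hb₂, List.reverse_reverse]
  have hNf : f.1.toFinset ⊆ N := fun a ha => by
    simp only [hN, Finset.mem_union]
    exact Or.inl (Or.inl (Or.inr ha))
  have hNb : b.1.toFinset ⊆ N := fun a ha => by
    simp only [hN, Finset.mem_union]
    exact Or.inl (Or.inr ha)
  have hNm : m.1.toFinset ⊆ N := fun a ha => by
    simp only [hN, Finset.mem_union]
    exact Or.inr ha
  have hr₁ : LoopReads N [] zf f.2.1 := hf₃.mono hNf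
  have hr₂ : LoopReads N f.2.1 b.2.2.reverse m.2 := hm₂.mono hNm
  have hr₃ : LoopReads N b.2.1 zb.reverse [] := hb₃.mono hNb
  -- The two states reached represent the same group element, since `r` holds in the group.
  have hj : val γ m.2 = val γ b.2.1 := by
    have h₁ := hr₁.val_eq (hgE.mono hNE)
    have h₂ := hr₂.val_eq (hgE.mono hNE)
    have h₃ := hr₃.val_eq (hgE.mono hNE)
    have h₄ := congrArg (fun z => val γ (z.filterMap Prod.fst)) hsplit
    have h₅ := congrArg (fun z => val γ (z.filterMap Prod.snd)) hsplit
    simp only [filterMap_fst_pad, filterMap_snd_pad, List.filterMap_append, val_append] at h₄ h₅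
    rw [val_nil] at h₃
    have h₆ := inv_mul_eq_iff_eq_mul.1 ((mul_assoc _ _ _).symm.trans h₃.symm)
    rw [mul_one, ← eq_mul_inv_iff_mul_eq] at h₆
    rw [h₆, h₂, h₁, val_nil, eq_mul_inv_iff_mul_eq]
    rw [h₄, h₅] at hr
    rw [mul_one, ← mul_assoc, ← mul_inv_rev]
    simp only [mul_assoc]
    rw [← hr]
    group
  have hφ : Folds (weldLabel E (m.2, b.2.1)) N (weldImage E (m.2, b.2.1) N) := folds_weldImage hNE
  rw [hsew]
  refine ⟨⟨⟨groupLabelled_weldImage hgE hj, deterministic_weldImage, noInitialDiag_weldImage⟩,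
    weldImage_mono hNE⟩, ?_, weldLabel E (m.2, b.2.1), ?_, ?_, ?_⟩
  · have h₁ := hr₁.folds hφ
    have h₂ := hr₂.folds hφ
    have h₃ := hr₃.folds hφ
    have h₄ : weldLabel E (m.2, b.2.1) m.2 = weldLabel E (m.2, b.2.1) b.2.1 :=
      weldLabel_eq_of_weldRel WeldRel.join
    rw [h₄] at h₂
    have := h₁.append (h₂.append h₃)
    rw [weldLabel_nil] at this
    rw [hsplit]
    exact this
  · exact (folds_weldImage (E := E) (j := (m.2, b.2.1)) subset_rfl).mono
      Finset.subset_union_left subset_rfl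
  · exact hφ.mono (fun a ha => by simp only [hN, Finset.mem_union]; tauto) subset_rfl
  · intro σ h₀ hw
    have h₁ := (hw.readForward_eq hW.isRuleAut.deterministic).2
    rw [h₀] at h₁
    refine LoopWalk.folds hφ (Walk.loopWalk fun i a ha => hNf ?_)
    exact List.mem_toFinset.2 ((h₁ _).2 ⟨i, a, ha, rfl⟩)

/-! ### The steps of the procedure -/

/-- The possible steps of the procedure. -/
inductive Steps (ι : A → A) (c : Config A) : Config A → Prop
  | minimize (r : Rule A) (hc : c.comparing = false)
      (hr : r ∈ c.todo ∨ c.todo = ∅ ∧ r ∈ c.store.new) : Steps ι c (minimizeRule ι c r)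
  | startComparing (hc : c.comparing = false) (ht : c.todo = ∅) (hn : c.store.new = ∅) :
      Steps ι c { c with comparing := true }
  | resolve (p : List A × List A) (hc : c.comparing = true) (hp : p ∈ c.pairs) :
      Steps ι c { c with
        store := KnuthBendix.resolve c.rules c.store p
        pairs := c.pairs.erase p }
  | compare (r : Rule A) (hc : c.comparing = true) (hp : c.pairs = ∅) (hr : r ∈ c.store.this) :
      Steps ι c (KnuthBendix.compare c r)
  | nextPass (hc : c.comparing = true) (hp : c.pairs = ∅) (ht : c.store.this = ∅) :
      Steps ι c (KnuthBendix.nextPass c)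

theorem steps_step (c : Config A) (pick : Finset (List A × List A) → List A × List A)
    (hpick : ∀ s : Finset (List A × List A), s.Nonempty → pick s ∈ s) :
    Steps ι c (step ι pick c) := by
  unfold step
  split_ifs with h₁ h₂ h₃ h₄ h₅
  · exact Steps.minimize _ h₁ (Or.inl (hpick _ h₂))
  · exact Steps.minimize _ h₁ (Or.inr ⟨Finset.not_nonempty_iff_eq_empty.1 h₂, hpick _ h₃⟩)
  · exact Steps.startComparing h₁ (Finset.not_nonempty_iff_eq_empty.1 h₂)
      (Finset.not_nonempty_iff_eq_empty.1 h₃)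
  · rw [Bool.not_eq_false] at h₁
    convert Steps.resolve _ h₁ (hpick _ h₄)
  · rw [Bool.not_eq_false] at h₁
    exact Steps.compare _ h₁ (Finset.not_nonempty_iff_eq_empty.1 h₄) (hpick _ h₅)
  · rw [Bool.not_eq_false] at h₁
    exact Steps.nextPass h₁ (Finset.not_nonempty_iff_eq_empty.1 h₄)
      (Finset.not_nonempty_iff_eq_empty.1 h₅)

/-! ### The store after a minimization -/

section MinimizeRule

variable (c : Config A) (r : Rule A)

theorem minimizeRule_wdiff : (minimizeRule ι c r).wdiff =
    if (minimizeOut ι c.rules c.store r).2 = ([], []) then c.wdiff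
    else sew ι (fun w => (rReduce c.rules ((minimizeOut ι c.rules c.store r).1, w)).2) c.wdiff
      (minimizeOut ι c.rules c.store r).2 := rfl

theorem mem_minimizeRule_todo {x : Rule A} :
    x ∈ (minimizeRule ι c r).todo ↔ x ∈ c.todo ∧ x ≠ r := by
  unfold minimizeRule
  simp only [Finset.mem_erase]
  tauto

theorem minimizeRule_store : (minimizeRule ι c r).store =
    if (minimizeOut ι c.rules c.store r).2 = r then
      if r ∈ (minimizeOut ι c.rules c.store r).1.new then
        { (minimizeOut ι c.rules c.store r).1 with
          new := (minimizeOut ι c.rules c.store r).1.new.erase r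
          this := insert r (minimizeOut ι c.rules c.store r).1.this }
      else (minimizeOut ι c.rules c.store r).1
    else
      { considered := (minimizeOut ι c.rules c.store r).1.considered.erase r
        new := (minimizeOut ι c.rules c.store r).1.new.erase r
        this := if (minimizeOut ι c.rules c.store r).2 = ([], []) ∨
            (minimizeOut ι c.rules c.store r).2 ∈ (minimizeOut ι c.rules c.store r).1.all then
              (minimizeOut ι c.rules c.store r).1.this
            else insert (minimizeOut ι c.rules c.store r).2
              (minimizeOut ι c.rules c.store r).1.this
        delete := if (minimizeLeft c.rules c.store r.1).2 = r.1 then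
            insert r (minimizeOut ι c.rules c.store r).1.delete
          else (minimizeOut ι c.rules c.store r).1.delete } := rfl

variable {c r} {S' : Store A} {out : Rule A} (hS' : minimizeOut ι c.rules c.store r = (S', out))
include hS'

theorem mem_minimizeRule_considered {x : Rule A} :
    x ∈ (minimizeRule ι c r).store.considered ↔ x ∈ S'.considered ∧ (x = r → out = r) := by
  rw [minimizeRule_store, hS']
  grind

theorem mem_minimizeRule_new {x : Rule A} :
    x ∈ (minimizeRule ι c r).store.new ↔ x ∈ S'.new ∧ x ≠ r := by
  rw [minimizeRule_store, hS']
  grind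

theorem mem_minimizeRule_this {x : Rule A} :
    x ∈ (minimizeRule ι c r).store.this ↔ x ∈ S'.this ∨ x = r ∧ out = r ∧ r ∈ S'.new ∨
      x = out ∧ out ≠ r ∧ out ≠ ([], []) ∧ out ∉ S'.all := by
  rw [minimizeRule_store, hS']
  grind

theorem mem_minimizeRule_delete {x : Rule A} :
    x ∈ (minimizeRule ι c r).store.delete ↔
      x ∈ S'.delete ∨ x = r ∧ out ≠ r ∧ (minimizeLeft c.rules c.store r.1).2 = r.1 := by
  rw [minimizeRule_store, hS']
  grind

theorem mem_minimizeRule_all_of_ne {x : Rule A} (hx : x ∈ S'.all) (hxr : x ≠ r) :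
    x ∈ (minimizeRule ι c r).store.all := by
  rw [Store.mem_all] at *
  rw [mem_minimizeRule_considered hS', mem_minimizeRule_new hS', mem_minimizeRule_this hS',
    mem_minimizeRule_delete hS']
  tauto

theorem mem_all_of_mem_minimizeRule_all {x : Rule A} (hr : r ∈ c.store.all)
    (hsub : c.store.all ⊆ S'.all) (hx : x ∈ (minimizeRule ι c r).store.all) :
    x ∈ S'.all ∨ x = out ∧ out ≠ r ∧ out ≠ ([], []) ∧ out ∉ S'.all := by
  have hr' := hsub hr
  rw [Store.mem_all, mem_minimizeRule_considered hS', mem_minimizeRule_new hS',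
    mem_minimizeRule_this hS', mem_minimizeRule_delete hS'] at hx
  have := Store.mem_all (S := S') (r := x)
  rcases hx with hx | (hx | hx | hx) | hx | hx | hx
  · tauto
  · tauto
  · exact Or.inl (hx.1 ▸ hr')
  · exact Or.inr hx
  · tauto
  · tauto
  · exact Or.inl (hx.1 ▸ hr')

theorem out_mem_minimizeRule_all (hr : r ∈ S'.considered ∨ r ∈ S'.new) (hout : out ≠ ([], [])) :
    out ∈ (minimizeRule ι c r).store.all := by
  by_cases h : out = r
  · rw [Store.mem_all, mem_minimizeRule_considered hS', mem_minimizeRule_this hS']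
    rw [h]
    tauto
  · by_cases h' : out ∈ S'.all
    · exact mem_minimizeRule_all_of_ne hS' h' h
    · rw [Store.mem_all, mem_minimizeRule_this hS']
      tauto

end MinimizeRule

/-! ### Overlaps and their resolution -/

theorem mem_overlaps {r r' : Rule A} {p : List A × List A} : p ∈ overlaps r r' ↔
    ∃ k, 1 ≤ k ∧ k ≤ r.1.length ∧ k ≤ r'.1.length ∧
      r.1.drop (r.1.length - k) = r'.1.take k ∧
      p = (r.2 ++ r'.1.drop k, r.1.take (r.1.length - k) ++ r'.2) := by
  simp only [overlaps, Finset.mem_image, Finset.mem_filter, Finset.mem_Icc, le_min_iff]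
  constructor
  · rintro ⟨k, ⟨⟨h₁, h₂, h₃⟩, h₄⟩, rfl⟩
    exact ⟨k, h₁, h₂, h₃, h₄, rfl⟩
  · rintro ⟨k, h₁, h₂, h₃, h₄, rfl⟩
    exact ⟨k, ⟨⟨h₁, h₂, h₃⟩, h₄⟩, rfl⟩

theorem val_eq_of_mem_overlaps {r r' : Rule A} (hr : val γ r.1 = val γ r.2)
    (hr' : val γ r'.1 = val γ r'.2) {p : List A × List A} (hp : p ∈ overlaps r r') :
    val γ p.1 = val γ p.2 := by
  obtain ⟨k, -, -, -, h, rfl⟩ := mem_overlaps.1 hp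
  simp only [val_append]
  rw [← hr, ← hr']
  conv_lhs => rw [← List.take_append_drop (r.1.length - k) r.1, h, val_append]
  conv_rhs => rw [← List.take_append_drop k r'.1, val_append]
  rw [mul_assoc]

/-- What the resolution of a critical pair `p` achieves. -/
structure Resolves (γ : A → G) (M : RuleAut A) (S : Store A) (p : List A × List A)
    (S' : Store A) : Prop where
  considered : S'.considered = S.considered
  this : S'.this = S.this
  delete : S'.delete = S.delete
  new_subset : S.new ⊆ S'.new
  new_mem : ∀ x ∈ S'.new, x ∈ S.new ∨ x ∉ S.all ∧ (IsInsertable M x ∨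
    Sound γ x ∧ ¬ Reducible (ruleSet M) x.1 ∧ ¬ Reducible (ruleSet M) x.2)
  conn : Conn (S'.all : Set (Rule A)) (maxRank p + 1) p.1 p.2

theorem Resolves.all_subset {M : RuleAut A} {S S' : Store A} {p : List A × List A}
    (h : Resolves γ M S p S') : S.all ⊆ S'.all := by
  intro r hr
  rw [Store.mem_all] at *
  rw [h.considered, h.this, h.delete]
  have := @h.new_subset r
  tauto

theorem resolve_spec {M : RuleAut A} (hM : GroupLabelled γ M) {S : Store A}
    (hS : ∀ r ∈ S.all, Sound γ r) {p : List A × List A} (hp : val γ p.1 = val γ p.2) :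
    Resolves γ M S p (resolve M S p) := by
  obtain ⟨hc, hc'⟩ := rReduce_spec hM hS p.1
  set c := rReduce M (S, p.1) with hcdef
  have hcS := hc.ext.sound hM hS
  obtain ⟨hd, hd'⟩ := rReduce_spec hM hcS p.2
  set d := rReduce M (c.1, p.2) with hddef
  have hres : resolve M S p = if c.2 = d.2 then d.1
    else if SLt d.2 c.2 then d.1.addNew (c.2, d.2) else d.1.addNew (d.2, c.2) := rfl
  have hdS := hd.ext.sound hM hcS
  have hb₁ : rank p.1 ≤ maxRank p := le_max_left _ _
  have hb₂ : rank p.2 ≤ maxRank p := le_max_right _ _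
  have hext : Extends M (maxRank p + 1) S d.1 :=
    (hc.ext.mono (by omega)).trans (hd.ext.mono (by omega))
  have hle₁ := hc.rank_le
  have hle₂ := hd.rank_le
  have hval : val γ c.2 = val γ d.2 := by rw [hc.val_eq, hd.val_eq, hp]
  -- The reduced strings, joined by `x`, give the path.
  have key : ∀ S' : Store A, d.1.all ⊆ S'.all →
      Conn (S'.all : Set (Rule A)) (maxRank p + 1) c.2 d.2 →
      Conn (S'.all : Set (Rule A)) (maxRank p + 1) p.1 p.2 := by
    intro S' hsub h
    refine Conn.trans (hc.conn.mono (fun r hr => hsub (hd.ext.all_subset hr)) (by omega))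
      (Conn.trans h (Conn.symm (hd.conn.mono (fun r hr => hsub hr) (by omega))))
  have hadd : ∀ x : Rule A, Sound γ x → ¬ Reducible (ruleSet M) x.1 →
      ¬ Reducible (ruleSet M) x.2 →
      Conn ((d.1.addNew x).all : Set (Rule A)) (maxRank p + 1) c.2 d.2 →
      Resolves γ M S p (d.1.addNew x) := by
    intro x hx hx₁ hx₂ hconn
    refine ⟨(Store.addNew_considered _ _).trans hext.considered,
      (Store.addNew_this _ _).trans hext.this, (Store.addNew_delete _ _).trans hext.delete,
      fun r hr => Store.mem_addNew_new.2 (Or.inl (hext.new_subset hr)), ?_,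
      key _ (fun r hr => Store.mem_addNew_all.2 (Or.inl hr)) hconn⟩
    intro y hy
    rcases Store.mem_addNew_new.1 hy with hy | ⟨rfl, hy⟩
    · rcases hext.new_mem y hy with h | h
      · exact Or.inl h
      · exact Or.inr ⟨h.1, Or.inl h.2.1⟩
    · exact Or.inr ⟨fun h => hy (hext.all_subset h), Or.inr ⟨hx, hx₁, hx₂⟩⟩
  rw [hres]
  split_ifs with h₁ h₂
  · refine ⟨hext.considered, hext.this, hext.delete, hext.new_subset, ?_, ?_⟩
    · intro y hy
      rcases hext.new_mem y hy with h | h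
      · exact Or.inl h
      · exact Or.inr ⟨h.1, Or.inl h.2.1⟩
    · refine key _ subset_rfl ?_
      rw [h₁]
      exact Conn.refl _
  · refine hadd _ ⟨hval, rank_lt_of_sLt h₂⟩ hc' hd' ?_
    exact Conn.of_rule (r := (c.2, d.2)) (Store.mem_addNew_all.2 (Or.inr rfl))
      (by simp only; omega) (by simp only; omega)
  · have h₃ : SLt c.2 d.2 := by
      rcases sLt_trichotomy c.2 d.2 with h | h | h
      · exact h
      · exact absurd h h₁
      · exact absurd h h₂
    refine hadd _ ⟨hval.symm, rank_lt_of_sLt h₃⟩ hd' hc' (Conn.symm ?_)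
    exact Conn.of_rule (r := (d.2, c.2)) (Store.mem_addNew_all.2 (Or.inr rfl))
      (by simp only; omega) (by simp only; omega)

/-! ### Invariants of the procedure -/

/-- The invariants of the configurations. -/
structure Inv (γ : A → G) (ι : A → A) (c : Config A) : Prop where
  sound : ∀ r ∈ c.store.all, Sound γ r
  considered_disj : ∀ r ∈ c.store.considered,
    r ∉ c.store.this ∧ r ∉ c.store.new ∧ r ∉ c.store.delete
  this_disj : ∀ r ∈ c.store.this, r ∉ c.store.new ∧ r ∉ c.store.delete
  new_disj : ∀ r ∈ c.store.new, r ∉ c.store.delete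
  todo_subset : c.todo ⊆ c.store.considered
  todo_eq : c.comparing = true → c.todo = ∅
  pairs_eq : c.comparing = false → c.pairs = ∅
  pairs_val : ∀ p ∈ c.pairs, val γ p.1 = val γ p.2
  rules : IsRuleAut γ c.rules
  wdiff : IsWDiff γ c.wdiff
  folds : ∃ φ, Folds φ c.rules c.wdiff.arrows
  inverse : ∀ x, Conn (c.store.all : Set (Rule A)) (rank [x, ι x] + 1) [x, ι x] []
  delete : ∀ r ∈ c.store.delete, Derivable (c.store.all : Set (Rule A)) r
  overlaps : ∀ r ∈ c.store.considered, ∀ r' ∈ c.store.considered, ∀ p ∈ overlaps r r',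
    p ∈ c.pairs ∨ Conn (c.store.all : Set (Rule A)) (maxRank p + 1) p.1 p.2

theorem Inv.decreasing {c : Config A} (h : Inv γ ι c) :
    Decreasing (c.store.all : Set (Rule A)) :=
  fun r hr => (h.sound r hr).2

theorem Inv.minimizes (hι : Function.Involutive ι) (hγ : ∀ x, γ (ι x) = (γ x)⁻¹)
    {c : Config A} (h : Inv γ ι c) {r : Rule A} (hr : r ∈ c.store.all) :
    ∃ S' out, minimizeOut ι c.rules c.store r = (S', out) ∧
      Minimizes γ ι c.rules c.store r S' out :=
  ⟨_, _, rfl, minimizeOut_spec hι hγ h.rules.groupLabelled h.sound (h.sound r hr)⟩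

theorem Inv.minimizeRule_disjoint {c : Config A} (h : Inv γ ι c) {r : Rule A}
    (hr : r ∈ c.store.considered ∨ r ∈ c.store.new) {S' : Store A} {out : Rule A}
    (hS' : minimizeOut ι c.rules c.store r = (S', out))
    (hmin : Minimizes γ ι c.rules c.store r S' out) :
    (∀ x ∈ (minimizeRule ι c r).store.considered, x ∉ (minimizeRule ι c r).store.this ∧
      x ∉ (minimizeRule ι c r).store.new ∧ x ∉ (minimizeRule ι c r).store.delete) ∧
    (∀ x ∈ (minimizeRule ι c r).store.this,
      x ∉ (minimizeRule ι c r).store.new ∧ x ∉ (minimizeRule ι c r).store.delete) ∧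
    ∀ x ∈ (minimizeRule ι c r).store.new, x ∉ (minimizeRule ι c r).store.delete := by
  simp only [mem_minimizeRule_considered hS', mem_minimizeRule_new hS',
    mem_minimizeRule_this hS', mem_minimizeRule_delete hS', Store.mem_all, hmin.ext.considered,
    hmin.ext.this, hmin.ext.delete]
  have h₁ := h.considered_disj
  have h₂ := h.this_disj
  have h₃ := h.new_disj
  have h₄ : ∀ x ∈ S'.new, x ∈ c.store.new ∨ x ∉ c.store.considered ∧ x ∉ c.store.this ∧
      x ∉ c.store.delete := by
    intro x hx
    refine (hmin.ext.new_mem x hx).imp_right fun h => ?_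
    have := h.1
    rw [Store.mem_all] at this
    tauto
  have h₅ : ∀ x ∈ c.store.new, x ∈ S'.new := fun x hx => hmin.ext.new_subset hx
  clear hmin hS'
  refine ⟨?_, ?_, ?_⟩ <;> grind

theorem inv_minimizeRule (hι : Function.Involutive ι) (hγ : ∀ x, γ (ι x) = (γ x)⁻¹)
    {c : Config A} (h : Inv γ ι c) {r : Rule A}
    (hr : r ∈ c.store.considered ∨ r ∈ c.store.new) :
    Inv γ ι (minimizeRule ι c r) ∧ Supersedes ((minimizeRule ι c r).store.all : Set (Rule A))
      (c.store.all : Set (Rule A)) := by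
  have hrS : r ∈ c.store.all := by
    rw [Store.mem_all]
    tauto
  obtain ⟨S', out, hS', hmin⟩ := h.minimizes hι hγ hrS
  have hrS' : r ∈ S'.considered ∨ r ∈ S'.new := by
    rw [hmin.ext.considered]
    exact hr.imp_right fun h => hmin.ext.new_subset h
  have hsup : Supersedes ((minimizeRule ι c r).store.all : Set (Rule A))
      (c.store.all : Set (Rule A)) := by
    intro x hx
    by_cases hxr : x = r ∧ out ≠ r
    · right
      rw [hxr.1]
      refine hmin.derivable h.rules.groupLabelled h.sound h.inverse
        (fun r' hr' hne => mem_minimizeRule_all_of_ne hS' hr' hne) ?_ hxr.2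
      by_cases hout : out = ([], [])
      · exact Or.inl hout
      · exact Or.inr (out_mem_minimizeRule_all hS' hrS' hout)
    · left
      by_cases hxr' : x = r
      · have hout : out = r := by
          by_contra h'
          exact hxr ⟨hxr', h'⟩
        have hne : out ≠ ([], []) := by
          intro h'
          have := (h.sound r hrS).2
          rw [← hout, h'] at this
          exact lt_irrefl _ this
        have := out_mem_minimizeRule_all hS' hrS' hne
        rw [hout] at this
        rwa [hxr']
      · exact mem_minimizeRule_all_of_ne hS' (hmin.ext.all_subset hx) hxr'
  have hsound : ∀ x ∈ (minimizeRule ι c r).store.all, Sound γ x := by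
    intro x hx
    rcases mem_all_of_mem_minimizeRule_all hS' hrS hmin.ext.all_subset hx with hx | hx
    · exact hmin.ext.sound h.rules.groupLabelled h.sound x hx
    · rw [hx.1]
      exact hmin.sound_out hx.2.2.1
  have hwd : IsWDiff γ (minimizeRule ι c r).wdiff ∧
      ∃ φ, Folds φ c.wdiff.arrows (minimizeRule ι c r).wdiff.arrows := by
    rw [minimizeRule_wdiff]
    split_ifs with h'
    · exact ⟨h.wdiff, _, Folds.id _⟩
    · have hval : val γ (minimizeOut ι c.rules c.store r).2.1 =
          val γ (minimizeOut ι c.rules c.store r).2.2 := by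
        rw [hS']
        exact hmin.val_eq
      have hred : ∀ w, val γ
          (rReduce c.rules ((minimizeOut ι c.rules c.store r).1, w)).2 = val γ w := by
        intro w
        rw [hS']
        exact (rReduce_spec h.rules.groupLabelled
          (hmin.ext.sound h.rules.groupLabelled h.sound) w).1.val_eq
      obtain ⟨h₁, -, φ, h₂, -⟩ := sew_spec hγ hred h.wdiff hval
      exact ⟨h₁, φ, h₂⟩
  obtain ⟨hd₁, hd₂, hd₃⟩ := h.minimizeRule_disjoint hr hS' hmin
  have htodo : c.comparing = true → c.todo.erase r = ∅ := fun hc => by simp [h.todo_eq hc]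
  refine ⟨⟨hsound, hd₁, hd₂, hd₃, ?_, htodo, h.pairs_eq, h.pairs_val, h.rules, hwd.1, ?_, ?_, ?_,
    ?_⟩, hsup⟩
  · intro x hx
    rw [mem_minimizeRule_todo] at hx
    rw [mem_minimizeRule_considered hS', hmin.ext.considered]
    exact ⟨h.todo_subset hx.1, fun h' => absurd h' hx.2⟩
  · obtain ⟨φ, hφ⟩ := h.folds
    obtain ⟨ψ, hψ⟩ := hwd.2
    exact ⟨_, hψ.comp hφ⟩
  · exact fun x => (h.inverse x).supersedes h.decreasing hsup
  · intro x hx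
    rw [mem_minimizeRule_delete hS', hmin.ext.delete] at hx
    rcases hx with hx | ⟨rfl, hx, hx'⟩
    · exact (h.delete x hx).supersedes h.decreasing hsup
    · refine hmin.derivable h.rules.groupLabelled h.sound h.inverse
        (fun r' hr' hne => mem_minimizeRule_all_of_ne hS' hr' hne) ?_ hx
      by_cases hout : out = ([], [])
      · exact Or.inl hout
      · exact Or.inr (out_mem_minimizeRule_all hS' hrS' hout)
  · intro x hx y hy p hp
    rw [mem_minimizeRule_considered hS', hmin.ext.considered] at hx hy
    exact (h.overlaps x hx.1 y hy.1 p hp).imp_right fun h' => h'.supersedes h.decreasing hsup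

theorem inv_resolve {c : Config A} (h : Inv γ ι c) {p : List A × List A} (hp : p ∈ c.pairs)
    (hc : c.comparing = true) :
    Inv γ ι { c with store := resolve c.rules c.store p, pairs := c.pairs.erase p } ∧
      Supersedes ((resolve c.rules c.store p).all : Set (Rule A))
        (c.store.all : Set (Rule A)) := by
  have hres := resolve_spec h.rules.groupLabelled h.sound (h.pairs_val p hp)
  have hsup : Supersedes ((resolve c.rules c.store p).all : Set (Rule A))
      (c.store.all : Set (Rule A)) := Supersedes.of_subset fun r hr => hres.all_subset hr
  set S' := resolve c.rules c.store p
  have hnew : ∀ x ∈ S'.new, x ∈ c.store.new ∨ x ∉ c.store.all := fun x hx =>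
    (hres.new_mem x hx).imp_right fun h => h.1
  have hnew' : ∀ x ∈ S'.new, x ∉ c.store.considered ∧ x ∉ c.store.this ∧ x ∉ c.store.delete := by
    intro x hx
    rcases hnew x hx with hx | hx
    · exact ⟨fun h' => (h.considered_disj x h').2.1 hx, fun h' => (h.this_disj x h').1 hx,
        h.new_disj x hx⟩
    · rw [Store.mem_all] at hx
      tauto
  refine ⟨⟨?_, ?_, ?_, ?_, ?_, h.todo_eq, ?_, ?_, h.rules, h.wdiff, h.folds, ?_, ?_, ?_⟩, hsup⟩
  · intro x hx
    rw [Store.mem_all] at hx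
    simp only at hx
    rw [hres.considered, hres.this, hres.delete] at hx
    have hx' := Store.mem_all (S := c.store) (r := x)
    by_cases hxn : x ∈ S'.new
    · rcases hres.new_mem x hxn with h₁ | ⟨-, h₁ | h₁⟩
      · exact h.sound x (hx'.2 (by tauto))
      · exact h.rules.groupLabelled.sound h₁.mem
      · exact h₁.1
    · exact h.sound x (hx'.2 (by tauto))
  · intro x hx
    simp only at hx ⊢
    rw [hres.considered] at hx
    rw [hres.this, hres.delete]
    have h₁ := h.considered_disj x hx
    exact ⟨h₁.1, fun h' => (hnew' x h').1 hx, h₁.2.2⟩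
  · intro x hx
    simp only at hx ⊢
    rw [hres.this] at hx
    rw [hres.delete]
    exact ⟨fun h' => (hnew' x h').2.1 hx, (h.this_disj x hx).2⟩
  · intro x hx
    simp only at hx ⊢
    rw [hres.delete]
    exact (hnew' x hx).2.2
  · simp only
    rw [hres.considered]
    exact h.todo_subset
  · simp only
    rw [hc]
    simp
  · exact fun q hq => h.pairs_val q (Finset.mem_of_mem_erase hq)
  · exact fun x => (h.inverse x).supersedes h.decreasing hsup
  · intro x hx
    simp only at hx ⊢
    rw [hres.delete] at hx
    exact (h.delete x hx).supersedes h.decreasing hsup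
  · intro x hx y hy q hq
    simp only at hx hy ⊢
    rw [hres.considered] at hx hy
    rcases h.overlaps x hx y hy q hq with h' | h'
    · by_cases hqp : q = p
      · rw [hqp]
        exact Or.inr hres.conn
      · exact Or.inl (Finset.mem_erase.2 ⟨hqp, h'⟩)
    · exact Or.inr (h'.supersedes h.decreasing hsup)

theorem mem_compare_all {c : Config A} {r x : Rule A} (hr : r ∈ c.store.this) :
    x ∈ (compare c r).store.all ↔ x ∈ c.store.all := by
  simp only [compare, Store.mem_all, Finset.mem_erase, Finset.mem_insert]
  by_cases h : x = r
  · subst h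
    tauto
  · tauto

theorem inv_compare {c : Config A} (h : Inv γ ι c) {r : Rule A} (hr : r ∈ c.store.this)
    (hc : c.comparing = true) (hp : c.pairs = ∅) : Inv γ ι (compare c r) := by
  have hall : ((compare c r).store.all : Set (Rule A)) = c.store.all :=
    Set.ext fun x => mem_compare_all hr
  have hcons : ∀ x, x ∈ (compare c r).store.considered ↔ x = r ∨ x ∈ c.store.considered := by
    simp [compare]
  have hthis : ∀ x, x ∈ (compare c r).store.this ↔ x ≠ r ∧ x ∈ c.store.this := by
    simp [compare]
  have hrall : r ∈ c.store.all := by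
    rw [Store.mem_all]
    tauto
  have hpairs : ∀ p, p ∈ (compare c r).pairs ↔ ∃ r', (r' = r ∨ r' ∈ c.store.considered) ∧
      (p ∈ overlaps r r' ∨ p ∈ overlaps r' r) := by
    simp [compare]
  have hsound : ∀ x, x = r ∨ x ∈ c.store.considered → val γ x.1 = val γ x.2 := by
    rintro x (rfl | hx)
    · exact (h.sound x hrall).1
    · exact (h.sound x (Store.mem_all.2 (Or.inl hx))).1
  refine ⟨?_, ?_, ?_, h.new_disj, ?_, h.todo_eq, ?_, ?_, h.rules, h.wdiff, h.folds, ?_, ?_, ?_⟩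
  · exact fun x hx => h.sound x ((mem_compare_all hr).1 hx)
  · intro x hx
    rw [hthis]
    rcases (hcons x).1 hx with rfl | hx
    · exact ⟨by tauto, (h.this_disj x hr).1, (h.this_disj x hr).2⟩
    · have := h.considered_disj x hx
      exact ⟨by tauto, this.2.1, this.2.2⟩
  · exact fun x hx => h.this_disj x ((hthis x).1 hx).2
  · exact fun x hx => (hcons x).2 (Or.inr (h.todo_subset hx))
  · intro h'
    exact absurd (hc.symm.trans h') (by simp)
  · intro p hp
    obtain ⟨r', hr', hp | hp⟩ := (hpairs p).1 hp
    · exact val_eq_of_mem_overlaps (hsound r (Or.inl rfl)) (hsound r' hr') hp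
    · exact val_eq_of_mem_overlaps (hsound r' hr') (hsound r (Or.inl rfl)) hp
  · rw [hall]
    exact h.inverse
  · rw [hall]
    exact h.delete
  · rw [hall]
    intro x hx y hy p hp
    rw [hcons] at hx hy
    rw [hpairs]
    rcases hx with rfl | hx
    · exact Or.inl ⟨y, hy, Or.inl hp⟩
    · rcases hy with rfl | hy
      · exact Or.inl ⟨x, Or.inr hx, Or.inr hp⟩
      · rcases h.overlaps x hx y hy p hp with h' | h'
        · simp [‹c.pairs = ∅›] at h'
        · exact Or.inr h'

theorem inv_nextPass {c : Config A} (h : Inv γ ι c) (hp : c.pairs = ∅) :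
    Inv γ ι (nextPass c) ∧ Supersedes ((nextPass c).store.all : Set (Rule A))
      (c.store.all : Set (Rule A)) := by
  have hmem : ∀ x, x ∈ (nextPass c).store.all ↔
      x ∈ c.store.considered ∨ x ∈ c.store.this ∨ x ∈ c.store.new := by
    intro x
    rw [Store.mem_all]
    simp [nextPass]
  have hsub : ∀ x ∈ (nextPass c).store.all, x ∈ c.store.all := by
    intro x hx
    rw [hmem] at hx
    rw [Store.mem_all]
    tauto
  -- Deleted rules derive from preceding rules, which are derivable from those that remain.
  have hsup : Supersedes ((nextPass c).store.all : Set (Rule A)) (c.store.all : Set (Rule A)) := by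
    have key : ∀ n, ∀ r ∈ c.store.all, weight r < n →
        r ∈ ((nextPass c).store.all : Set (Rule A)) ∨
          Derivable ((nextPass c).store.all : Set (Rule A)) r := by
      intro n
      induction n with
      | zero => intro r _ hn; omega
      | succ n ih =>
        intro r hr hn
        by_cases hr' : r ∈ (nextPass c).store.all
        · exact Or.inl hr'
        · right
          have hdel : r ∈ c.store.delete := by
            rw [hmem] at hr'
            rw [Store.mem_all] at hr
            tauto
          refine Conn.bind (h.delete r hdel) ?_
          rintro x ⟨hx, hxw⟩ -
          rcases ih x hx (by omega) with h' | h'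
          · exact Conn.of_rule ⟨h', hxw⟩ (by omega) (by have := h.decreasing x hx; omega)
          · exact Conn.mono h' (fun y hy => ⟨hy.1, by have := hy.2; omega⟩) le_rfl
    exact fun r hr => key _ r hr (Nat.lt_succ_self _)
  have hn := normalize_spec (h.wdiff.isRuleAut.mono h.wdiff.needed_subset) h.sound
  refine ⟨⟨fun x hx => h.sound x (hsub x hx), ?_, ?_, ?_, ?_, ?_, ?_, ?_, hn.1.1, ?_, ?_, ?_, ?_,
    ?_⟩, hsup⟩
  · intro x hx
    have := h.considered_disj x hx
    exact ⟨this.1, this.2.1, by simp [nextPass]⟩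
  · intro x hx
    exact ⟨(h.this_disj x hx).1, by simp [nextPass]⟩
  · intro x _
    simp [nextPass]
  · exact subset_rfl
  · exact fun h' => absurd h' (by simp [nextPass])
  · exact fun _ => rfl
  · simp [nextPass]
  · exact ⟨hn.1.1, by simp [nextPass]⟩
  · exact ⟨_, Folds.id _⟩
  · exact fun x => (h.inverse x).supersedes h.decreasing hsup
  · simp [nextPass]
  · intro x hx y hy p hp'
    right
    rcases h.overlaps x hx y hy p hp' with h' | h'
    · simp [hp] at h'
    · exact h'.supersedes h.decreasing hsup

theorem Steps.inv (hι : Function.Involutive ι) (hγ : ∀ x, γ (ι x) = (γ x)⁻¹) {c c' : Config A}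
    (hs : Steps ι c c') (h : Inv γ ι c) :
    Inv γ ι c' ∧ Supersedes (c'.store.all : Set (Rule A)) (c.store.all : Set (Rule A)) := by
  cases hs with
  | minimize r hc hr =>
    refine inv_minimizeRule hι hγ h ?_
    rcases hr with hr | hr
    · exact Or.inl (h.todo_subset hr)
    · exact Or.inr hr.2
  | startComparing hc ht hn =>
    refine ⟨⟨h.sound, h.considered_disj, h.this_disj, h.new_disj, h.todo_subset, fun _ => ht, ?_,
      h.pairs_val,
      h.rules, h.wdiff, h.folds, h.inverse, h.delete, h.overlaps⟩, Supersedes.refl _⟩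
    simp
  | resolve p hc hp => exact inv_resolve h hp hc
  | compare r hc hp hr =>
    exact ⟨inv_compare h hr hc hp,
      Supersedes.of_subset fun x hx => (mem_compare_all hr).2 hx⟩
  | nextPass hc hp ht => exact inv_nextPass h hp

/-! ### Every pass ends -/

/-- A run of the procedure, beginning with a configuration that satisfies the invariants and has
sufficiently many rules to define the group. -/
structure IsRun (γ : A → G) (ι : A → A) (σ : ℕ → Config A) : Prop where
  involutive : Function.Involutive ι
  map_inv : ∀ x, γ (ι x) = (γ x)⁻¹
  inv_zero : Inv γ ι (σ 0)
  complete : ∀ u v, val γ u = val γ v → ∃ n, Conn ((σ 0).store.all : Set (Rule A)) n u v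
  steps : ∀ t, Steps ι (σ t) (σ (t + 1))

/-- The current pass is finished. -/
def AtPassEnd (c : Config A) : Prop :=
  c.comparing = true ∧ c.pairs = ∅ ∧ c.store.this = ∅

theorem Steps.eq_nextPass {c c' : Config A} (h : Steps ι c c') (hc : AtPassEnd c) :
    c' = KnuthBendix.nextPass c := by
  obtain ⟨h₁, h₂, h₃⟩ := hc
  cases h with
  | minimize r hc hr => simp [hc] at h₁
  | startComparing hc ht hn => simp [hc] at h₁
  | resolve p hc hp => simp [h₂] at hp
  | compare r hc hp hr => simp [h₃] at hr
  | nextPass hc hp ht => rfl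

theorem Steps.pass_eq {c c' : Config A} (h : Steps ι c c') (hc : ¬ AtPassEnd c) :
    c'.pass = c.pass ∧ c'.rules = c.rules := by
  cases h with
  | minimize r hc hr => exact ⟨rfl, rfl⟩
  | startComparing hc ht hn => exact ⟨rfl, rfl⟩
  | resolve p hc hp => exact ⟨rfl, rfl⟩
  | compare r hc hp hr => exact ⟨rfl, rfl⟩
  | nextPass h₁ h₂ h₃ => exact absurd ⟨h₁, h₂, h₃⟩ hc

theorem exists_last {P : ℕ → Prop} {s t : ℕ} (hst : s ≤ t) (hs : P s) (ht : ¬ P t) :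
    ∃ u, s ≤ u ∧ u < t ∧ P u ∧ ¬ P (u + 1) := by
  induction t, hst using Nat.le_induction with
  | base => exact absurd hs ht
  | succ t hst ih =>
    by_cases h : P t
    · exact ⟨t, hst, Nat.lt_succ_self t, h, ht⟩
    · obtain ⟨u, h₁, h₂, h₃⟩ := ih h
      exact ⟨u, h₁, by omega, h₃⟩

/-- The multiset of the values of `f` on `s` decreases when `r` is replaced by elements with
smaller values. -/
theorem isDershowitzMannaLT_map {α : Type*} (f : α → ℕ) {s s' : Finset α} {r : α} (hr : r ∈ s)
    (hs' : ∀ x ∈ s', x ∈ s ∧ x ≠ r ∨ f x < f r) :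
    Multiset.IsDershowitzMannaLT (s'.val.map f) (s.val.map f) := by
  have hr' : r ∉ s' := by
    intro h
    rcases hs' r h with h | h
    · exact h.2 rfl
    · exact lt_irrefl _ h
  have key : ∀ p q : Finset α, p.val = (p ∩ q).val + (p \ q).val := by
    intro p q
    rw [← Finset.disjUnion_val _ _ (Finset.disjoint_sdiff_inter p q).symm,
      Finset.disjUnion_eq_union, Finset.union_comm, Finset.sdiff_union_inter]
  refine ⟨(s ∩ s').val.map f, (s' \ s).val.map f, (s \ s').val.map f, ?_, ?_, ?_, ?_⟩
  · intro h
    have : f r ∈ (s \ s').val.map f := Multiset.mem_map_of_mem f (Finset.mem_sdiff.2 ⟨hr, hr'⟩)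
    rw [h] at this
    simp at this
  · rw [← Multiset.map_add, Finset.inter_comm, ← key]
  · rw [← Multiset.map_add, ← key]
  · intro y hy
    obtain ⟨x, hx, rfl⟩ := Multiset.mem_map.1 hy
    obtain ⟨hx, hx'⟩ := Finset.mem_sdiff.1 hx
    refine ⟨f r, Multiset.mem_map_of_mem f (Finset.mem_sdiff.2 ⟨hr, hr'⟩), ?_⟩
    exact (hs' x hx).resolve_left fun h => hx' h.1

namespace IsRun

variable {σ : ℕ → Config A} (h : IsRun γ ι σ)
include h

theorem inv (t : ℕ) : Inv γ ι (σ t) := by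
  induction t with
  | zero => exact h.inv_zero
  | succ t ih => exact ((h.steps t).inv h.involutive h.map_inv ih).1

theorem supersedes {s t : ℕ} (hst : s ≤ t) :
    Supersedes ((σ t).store.all : Set (Rule A)) ((σ s).store.all : Set (Rule A)) := by
  induction t, hst using Nat.le_induction with
  | base => exact Supersedes.refl _
  | succ t _ ih =>
    exact Supersedes.trans (h.inv t).decreasing ih
      ((h.steps t).inv h.involutive h.map_inv (h.inv t)).2

theorem pass_succ (t : ℕ) : (σ (t + 1)).pass = (σ t).pass ∧ (σ (t + 1)).rules = (σ t).rules ∧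
      ¬ AtPassEnd (σ t) ∨
    (σ (t + 1)).pass = (σ t).pass + 1 ∧ AtPassEnd (σ t) ∧ σ (t + 1) = nextPass (σ t) := by
  by_cases hc : AtPassEnd (σ t)
  · right
    have := (h.steps t).eq_nextPass hc
    rw [this]
    exact ⟨rfl, hc, rfl⟩
  · left
    have := (h.steps t).pass_eq hc
    exact ⟨this.1, this.2, hc⟩

theorem pass_mono {s t : ℕ} (hst : s ≤ t) : (σ s).pass ≤ (σ t).pass := by
  induction t, hst using Nat.le_induction with
  | base => exact le_rfl
  | succ t _ ih =>
    rcases h.pass_succ t with h' | h' <;> omega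

theorem not_atPassEnd {s t u : ℕ} (hst : s ≤ t) (htu : t < u)
    (hsu : (σ u).pass = (σ s).pass) : ¬ AtPassEnd (σ t) := by
  intro hc
  have h₁ := h.pass_mono hst
  have h₂ := h.pass_mono (Nat.succ_le_of_lt htu)
  rcases h.pass_succ t with h' | h'
  · exact h'.2.2 hc
  · simp only [Nat.succ_eq_add_one] at h₂
    omega

theorem rules_eq {s t : ℕ} (hst : (σ s).pass = (σ t).pass) : (σ s).rules = (σ t).rules := by
  wlog hle : s ≤ t generalizing s t
  · exact (this hst.symm (by omega)).symm
  induction t, hle using Nat.le_induction with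
  | base => rfl
  | succ t hle ih =>
    have h₁ := h.pass_mono hle
    rcases h.pass_succ t with h' | h'
    · rw [ih (by omega), h'.2.1]
    · omega

theorem exists_atPassEnd_of_comparing {t : ℕ} (ht : (σ t).comparing = true) :
    ∃ s, t ≤ s ∧ AtPassEnd (σ s) ∧ (σ s).pass = (σ t).pass := by
  have key : ∀ n m t, (σ t).comparing = true → (σ t).store.this.card = n →
      (σ t).pairs.card = m → ∃ s, t ≤ s ∧ AtPassEnd (σ s) ∧ (σ s).pass = (σ t).pass := by
    intro n
    induction n using Nat.strong_induction_on with
    | _ n ihn =>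
    intro m
    induction m using Nat.strong_induction_on with
    | _ m ihm =>
    intro t ht hn hm
    have hs := h.steps t
    generalize hc : σ (t + 1) = c at hs
    cases hs with
    | minimize r hf hr => simp [hf] at ht
    | startComparing hf ht' hn => simp [hf] at ht
    | resolve p _ hp =>
      have hres := resolve_spec (h.inv t).rules.groupLabelled (h.inv t).sound
        ((h.inv t).pairs_val p hp)
      obtain ⟨s, h₁, h₂, h₃⟩ := ihm _
        (by rw [← hm]; exact Finset.card_erase_lt_of_mem hp) (t + 1) (by rw [hc]; exact ht)
        (by rw [hc, ← hn, ← hres.this]) (by rw [hc])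
      exact ⟨s, by omega, h₂, by rw [h₃, hc]⟩
    | compare r _ hp hr =>
      obtain ⟨s, h₁, h₂, h₃⟩ := ihn (compare (σ t) r).store.this.card
        (by rw [← hn]; simp only [compare]; convert Finset.card_erase_lt_of_mem hr) _ (t + 1)
        (by rw [hc]; exact ht)
        (by rw [hc]) rfl
      exact ⟨s, by omega, h₂, by rw [h₃, hc]; rfl⟩
    | nextPass _ hp ht' => exact ⟨t, le_rfl, ⟨ht, hp, ht'⟩, rfl⟩
  exact key _ _ t ht rfl rfl

/-- The rules inserted in `New` by the minimization of a rule have smaller left-hand sides, so that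
the multisets of the ranks of the left-hand sides of `New` decrease in the Dershowitz–Manna
order. -/
theorem exists_comparing_of_todo_eq_empty {t : ℕ} (ht : (σ t).comparing = false)
    (ht' : (σ t).todo = ∅) :
    ∃ s, t ≤ s ∧ (σ s).comparing = true ∧ (σ s).pass = (σ t).pass := by
  have key : ∀ m : Multiset ℕ, ∀ t, (σ t).comparing = false → (σ t).todo = ∅ →
      (σ t).store.new.val.map (fun r => rank r.1) = m →
      ∃ s, t ≤ s ∧ (σ s).comparing = true ∧ (σ s).pass = (σ t).pass := by
    intro m
    refine WellFounded.induction (C := fun m => ∀ t, (σ t).comparing = false → (σ t).todo = ∅ →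
      (σ t).store.new.val.map (fun r => rank r.1) = m →
      ∃ s, t ≤ s ∧ (σ s).comparing = true ∧ (σ s).pass = (σ t).pass)
      (Multiset.wellFounded_isDershowitzMannaLT (α := ℕ)) m ?_
    intro m ih t ht htodo hm
    have hs := h.steps t
    generalize hc : σ (t + 1) = c at hs
    cases hs with
    | minimize r _ hr =>
      have hr : r ∈ (σ t).store.new := by
        rcases hr with hr | hr
        · simp [htodo] at hr
        · exact hr.2
      obtain ⟨S', out, hS', hmin⟩ := (h.inv t).minimizes h.involutive h.map_inv (r := r)
        (Store.mem_all.2 (by tauto))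
      have hlt : Multiset.IsDershowitzMannaLT
          ((minimizeRule ι (σ t) r).store.new.val.map fun r => rank r.1) m := by
        rw [← hm]
        refine isDershowitzMannaLT_map _ hr fun x hx => ?_
        rw [mem_minimizeRule_new hS'] at hx
        by_cases hx' : x ∈ (σ t).store.new
        · exact Or.inl ⟨hx', hx.2⟩
        · exact Or.inr ((hmin.ext.new_mem x hx.1).resolve_left hx').2.2
      obtain ⟨s, h₁, h₂, h₃⟩ := ih _ hlt (t + 1) (by rw [hc]; exact ht)
        (by rw [hc]; simp [minimizeRule, htodo]) (by rw [hc])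
      exact ⟨s, by omega, h₂, by rw [h₃, hc]; rfl⟩
    | startComparing _ _ hn => exact ⟨t + 1, by omega, by rw [hc], by rw [hc]⟩
    | resolve p hc' hp => simp [ht] at hc'
    | compare r hc' hp hr => simp [ht] at hc'
    | nextPass hc' _ _ => simp [ht] at hc'
  exact key _ t ht ht' rfl

theorem exists_comparing {t : ℕ} (ht : (σ t).comparing = false) :
    ∃ s, t ≤ s ∧ (σ s).comparing = true ∧ (σ s).pass = (σ t).pass := by
  have key : ∀ n t, (σ t).comparing = false → (σ t).todo.card = n →
      ∃ s, t ≤ s ∧ (σ s).comparing = true ∧ (σ s).pass = (σ t).pass := by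
    intro n
    induction n with
    | zero =>
      exact fun t ht hn => h.exists_comparing_of_todo_eq_empty ht (Finset.card_eq_zero.1 hn)
    | succ n ih =>
      intro t ht hn
      have hs := h.steps t
      generalize hc : σ (t + 1) = c at hs
      cases hs with
      | minimize r _ hr =>
        have hr : r ∈ (σ t).todo := by
          rcases hr with hr | hr
          · exact hr
          · simp [hr.1] at hn
        obtain ⟨s, h₁, h₂, h₃⟩ := ih (t + 1) (by rw [hc]; exact ht)
          (by
            rw [hc]
            have : ((σ t).todo.erase r).card = n := by
              rw [Finset.card_erase_of_mem hr]
              omega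
            rw [← this]
            rfl)
        exact ⟨s, by omega, h₂, by rw [h₃, hc]; rfl⟩
      | startComparing _ ht' hn' => simp [ht'] at hn
      | resolve p hc' hp => simp [ht] at hc'
      | compare r hc' hp hr => simp [ht] at hc'
      | nextPass hc' _ _ => simp [ht] at hc'
  exact key _ t ht rfl

theorem exists_atPassEnd (t : ℕ) :
    ∃ s, t ≤ s ∧ AtPassEnd (σ s) ∧ (σ s).pass = (σ t).pass := by
  by_cases ht : (σ t).comparing = true
  · exact h.exists_atPassEnd_of_comparing ht
  · obtain ⟨s, h₁, h₂, h₃⟩ := h.exists_comparing (Bool.not_eq_true _ ▸ ht)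
    obtain ⟨u, h₄, h₅, h₆⟩ := h.exists_atPassEnd_of_comparing h₂
    exact ⟨u, h₁.trans h₄, h₅, h₆.trans h₃⟩

theorem exists_pass_eq {n : ℕ} (hn : (σ 0).pass ≤ n) : ∃ t, (σ t).pass = n := by
  induction n, hn using Nat.le_induction with
  | base => exact ⟨0, rfl⟩
  | succ n _ ih =>
    obtain ⟨t, ht⟩ := ih
    obtain ⟨s, -, h₂, h₃⟩ := h.exists_atPassEnd t
    refine ⟨s + 1, ?_⟩
    rcases h.pass_succ s with h' | h'
    · exact absurd h₂ h'.2.2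
    · omega

end IsRun

/-! ### Confluence of rewriting systems with connected critical pairs -/

/-- Repeated rewriting by rules of `T`. -/
def Descends (T : Set (Rule A)) : List A → List A → Prop :=
  Relation.ReflTransGen (Rewrites T)

theorem Descends.rank_le {T : Set (Rule A)} (hT : Decreasing T) {a b : List A}
    (h : Descends T a b) : rank b ≤ rank a := by
  induction h with
  | refl => exact le_rfl
  | tail _ h ih => exact (h.rank_lt hT).le.trans ih

theorem Descends.conn {T : Set (Rule A)} (hT : Decreasing T) {a b : List A}
    (h : Descends T a b) {n : ℕ} (hn : rank a < n) : Conn T n a b := by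
  induction h with
  | refl => exact Conn.refl _
  | tail h' h ih =>
    have h₁ := Descends.rank_le hT h'
    have h₂ := h.rank_lt hT
    exact Relation.ReflTransGen.tail ih ⟨by omega, by omega, Or.inl h⟩

/-- The critical pairs of `T` are connected below the overlap words, as the bound `maxRank p + 1`
is at most the rank of the overlap word, and no left-hand side properly contains another. -/
structure HasConnectedOverlaps (T : Set (Rule A)) : Prop where
  decreasing : Decreasing T
  infix_eq : ∀ r ∈ T, ∀ r' ∈ T, r'.1 <:+: r.1 → r'.1 = r.1
  overlaps : ∀ r ∈ T, ∀ r' ∈ T, ∀ p ∈ overlaps r r', Conn T (maxRank p + 1) p.1 p.2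

/-- The two results of rewriting an overlap `x c y` of the left-hand sides `x c` and `c y`. -/
theorem HasConnectedOverlaps.conn_of_overlap {T : Set (Rule A)} (hT : HasConnectedOverlaps T)
    {r r' : Rule A} (hr : r ∈ T) (hr' : r' ∈ T) {x c y : List A} (h₁ : r.1 = x ++ c)
    (h₂ : r'.1 = c ++ y) (hc : c ≠ []) :
    Conn T (rank (x ++ c ++ y)) (r.2 ++ y) (x ++ r'.2) := by
  have hp : (r.2 ++ y, x ++ r'.2) ∈ KnuthBendix.overlaps r r' := by
    refine mem_overlaps.2 ⟨c.length, List.length_pos_iff.2 hc, ?_, ?_, ?_, ?_⟩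
    · simp [h₁]
    · simp [h₂]
    · simp [h₁, h₂]
    · simp [h₁, h₂]
  have hlt₁ : rank (r.2 ++ y) < rank (x ++ c ++ y) := by
    have := rank_append_lt (hT.decreasing r hr) [] y
    rwa [h₁] at this
  have hlt₂ : rank (x ++ r'.2) < rank (x ++ c ++ y) := by
    have := rank_append_lt (hT.decreasing r' hr') x []
    rw [h₂] at this
    simpa using this
  exact (hT.overlaps r hr r' hr' _ hp).mono subset_rfl (Nat.succ_le_of_lt (max_lt hlt₁ hlt₂))

theorem HasConnectedOverlaps.conn_of_peak_aux {T : Set (Rule A)} (hT : HasConnectedOverlaps T)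
    {r r' : Rule A} (hr : r ∈ T) (hr' : r' ∈ T) {x y m y' : List A}
    (h : r.1 ++ y = m ++ r'.1 ++ y') :
    Conn T (rank (x ++ (r.1 ++ y))) (x ++ (r.2 ++ y)) (x ++ (m ++ r'.2 ++ y')) := by
  have hd := hT.decreasing r hr
  have hd' := hT.decreasing r' hr'
  have hdisj : ∀ c, m = r.1 ++ c → y = c ++ (r'.1 ++ y') →
      Conn T (rank (x ++ (r.1 ++ y))) (x ++ (r.2 ++ y)) (x ++ (m ++ r'.2 ++ y')) := by
    rintro c rfl rfl
    have e₁ : Rewrites T (x ++ (r.2 ++ (c ++ (r'.1 ++ y')))) (x ++ (r.2 ++ (c ++ (r'.2 ++ y')))) :=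
      ⟨x ++ r.2 ++ c, y', r', hr', by simp, by simp⟩
    have e₂ : Rewrites T (x ++ (r.1 ++ c ++ r'.2 ++ y')) (x ++ (r.2 ++ (c ++ (r'.2 ++ y')))) :=
      ⟨x, c ++ r'.2 ++ y', r, hr, by simp, by simp⟩
    have l₁ : rank (x ++ (r.2 ++ (c ++ (r'.1 ++ y')))) <
        rank (x ++ (r.1 ++ (c ++ (r'.1 ++ y')))) := by
      simpa using rank_append_lt hd x (c ++ (r'.1 ++ y'))
    have l₂ : rank (x ++ (r.1 ++ c ++ r'.2 ++ y')) < rank (x ++ (r.1 ++ (c ++ (r'.1 ++ y')))) := by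
      simpa using rank_append_lt hd' (x ++ r.1 ++ c) y'
    have l₃ := e₁.rank_lt hT.decreasing
    refine Relation.ReflTransGen.tail (Relation.ReflTransGen.single
      ⟨l₁, l₃.trans l₁, Or.inl e₁⟩) ⟨l₃.trans l₁, l₂, Or.inr e₂⟩
  rw [List.append_assoc] at h
  rcases List.append_eq_append_iff.1 h with ⟨c, hm, hy⟩ | ⟨c, h₁, h₂⟩
  · exact hdisj c hm hy
  · by_cases hc : c = []
    · subst hc
      simp only [List.append_nil, List.nil_append] at h₁ h₂
      exact hdisj [] (by simp [h₁]) (by simp [h₂])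
    · rcases List.append_eq_append_iff.1 h₂ with ⟨d, h₃, h₄⟩ | ⟨d, h₃, h₄⟩
      · have hlen := congrArg List.length
          (hT.infix_eq r hr r' hr' ⟨m, d, by rw [h₁, h₃, List.append_assoc]⟩)
        rw [h₁, h₃] at hlen
        simp only [List.length_append] at hlen
        obtain rfl : m = [] := List.eq_nil_of_length_eq_zero (by omega)
        obtain rfl : d = [] := List.eq_nil_of_length_eq_zero (by omega)
        simp only [List.append_nil, List.nil_append] at h₁ h₃ h₄
        subst h₄
        have := (hT.conn_of_overlap hr hr' (x := []) (y := []) h₁ (by simp [h₃]) hc).append x y'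
        simpa [h₁] using this
      · have := (hT.conn_of_overlap hr hr' h₁ h₃ hc).append x y'
        simpa [h₁, h₄] using this

/-- A peak is connected below its top. -/
theorem HasConnectedOverlaps.conn_of_peak {T : Set (Rule A)} (hT : HasConnectedOverlaps T)
    {w a b : List A} (ha : Rewrites T w a) (hb : Rewrites T w b) : Conn T (rank w) a b := by
  obtain ⟨x, y, r, hr, rfl, rfl⟩ := ha
  obtain ⟨x', y', r', hr', h, rfl⟩ := hb
  simp only [List.append_assoc] at h ⊢
  rcases List.append_eq_append_iff.1 h with ⟨m, rfl, h₁⟩ | ⟨m, rfl, h₁⟩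
  · have := hT.conn_of_peak_aux hr hr' (x := x) (y := y) (m := m) (y' := y') (by simpa using h₁)
    simpa using this
  · have := hT.conn_of_peak_aux hr' hr (x := x') (y := y') (m := m) (y' := y) (by simpa using h₁)
    rw [h]
    simpa using this.symm

/-- Connected strings have a common descendant. The proof is by induction on the bound of the
ranks along a path: the descendants of two strings obtained from a peak are connected below the
top of the peak. -/
theorem HasConnectedOverlaps.join {T : Set (Rule A)} (hT : HasConnectedOverlaps T) {n : ℕ}
    {a b : List A} (h : Conn T n a b) : ∃ c, Descends T a c ∧ Descends T b c := by
  induction n using Nat.strong_induction_on generalizing a b with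
  | _ n ih =>
  induction h with
  | refl => exact ⟨a, Relation.ReflTransGen.refl, Relation.ReflTransGen.refl⟩
  | @tail b b' _ hb ihb =>
    obtain ⟨hb₁, hb₂, hb | hb⟩ := hb
    · obtain ⟨d, had, hbd⟩ := ihb
      rcases Relation.ReflTransGen.cases_head hbd with rfl | ⟨b₁, hb₁', hbd⟩
      · exact ⟨b', had.tail hb, Relation.ReflTransGen.refl⟩
      · have hc₁ : Conn T (rank b) d b₁ :=
          (Descends.conn hT.decreasing hbd (hb₁'.rank_lt hT.decreasing)).symm
        obtain ⟨e, hde, hbe⟩ := ih _ hb₁ (hc₁.trans (hT.conn_of_peak hb₁' hb))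
        exact ⟨e, Relation.ReflTransGen.trans had hde, hbe⟩
    · obtain ⟨d, had, hbd⟩ := ihb
      exact ⟨d, had, Relation.ReflTransGen.head hb hbd⟩

/-- If a string is connected to a smaller string, then it is reducible. -/
theorem HasConnectedOverlaps.reducible_of_conn {T : Set (Rule A)} (hT : HasConnectedOverlaps T)
    {n : ℕ} {w w' : List A} (h : Conn T n w w') (hlt : rank w' < rank w) : Reducible T w := by
  obtain ⟨c, hc, hc'⟩ := hT.join h
  rcases Relation.ReflTransGen.cases_head hc with rfl | ⟨b, ⟨x, y, r, hr, hw, -⟩, -⟩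
  · have := Descends.rank_le hT.decreasing hc'
    omega
  · exact ⟨r, hr, x, y, hw.symm⟩

/-! ### Least representatives and minimal rules -/

/-- `w` is the shortlex-least representative of a group element. -/
def IsLeast (γ : A → G) (w : List A) : Prop := ∀ w', val γ w' = val γ w → rank w ≤ rank w'

theorem IsLeast.eq {w w' : List A} (h : IsLeast γ w) (h' : IsLeast γ w')
    (hw : val γ w = val γ w') : w = w' :=
  rank_injective (le_antisymm (h w' hw.symm) (h' w hw))

theorem isLeast_nil : IsLeast γ [] := by
  intro w _
  rw [rank_nil]
  exact Nat.zero_le _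

theorem IsLeast.of_infix {u w : List A} (h : IsLeast γ w) (hu : u <:+: w) : IsLeast γ u := by
  obtain ⟨x, y, rfl⟩ := hu
  intro u' hu'
  by_contra! hlt
  have := h (x ++ u' ++ y) (by simp only [val_append, hu'])
  have := rank_append_lt hlt x y
  omega

theorem exists_isLeast (w : List A) : ∃ w', IsLeast γ w' ∧ val γ w' = val γ w := by
  have hne : {w' | val γ w' = val γ w}.Nonempty := ⟨w, rfl⟩
  refine ⟨slMin {w' | val γ w' = val γ w}, fun u hu => ?_, slMin_mem hne⟩
  exact rank_slMin_le (T := {w' | val γ w' = val γ w}) (hu.trans (slMin_mem hne))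

theorem IsLeast.not_reducible {T : Set (Rule A)} (hT : ∀ r ∈ T, Sound γ r) {w : List A}
    (h : IsLeast γ w) : ¬ Reducible T w := by
  rintro ⟨r, hr, hrw⟩
  have h₁ := (h.of_infix hrw) r.2 (hT r hr).1.symm
  have h₂ := (hT r hr).2
  omega

/-- The rules `(λ, ρ)` whose left-hand sides are minimal among the strings that are not least, and
whose right-hand sides are least. -/
structure IsMinimal (γ : A → G) (r : Rule A) : Prop where
  sound : Sound γ r
  proper : ∀ w, w <:+: r.1 → w ≠ r.1 → IsLeast γ w
  least : IsLeast γ r.2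

theorem IsMinimal.not_isLeast {r : Rule A} (h : IsMinimal γ r) : ¬ IsLeast γ r.1 := by
  intro h'
  have h₁ := h' r.2 h.sound.1.symm
  have h₂ := h.sound.2
  omega

theorem exists_isMinimal {w : List A} (hw : ¬ IsLeast γ w) :
    ∃ r, IsMinimal γ r ∧ r.1 <:+: w := by
  have hne : {u | u <:+: w ∧ ¬ IsLeast γ u}.Nonempty := ⟨w, List.infix_rfl, hw⟩
  obtain ⟨hu, hu'⟩ := slMin_mem hne
  set u := slMin {u | u <:+: w ∧ ¬ IsLeast γ u} with hudef
  obtain ⟨v, hv, hvu⟩ := exists_isLeast (γ := γ) u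
  refine ⟨(u, v), ⟨⟨hvu.symm, ?_⟩, ?_, hv⟩, hu⟩
  · unfold IsLeast at hu'
    push Not at hu'
    obtain ⟨u', hu', hlt⟩ := hu'
    have := hv u' (hu'.trans hvu.symm)
    simp only
    omega
  · intro x hx hxu
    by_contra hx'
    have h₁ : rank u ≤ rank x :=
      rank_slMin_le (T := {u | u <:+: w ∧ ¬ IsLeast γ u}) ⟨hx.trans hu, hx'⟩
    have h₂ : rank x < rank u := rank_lt_of_infix hx hxu
    omega

/-! ### Permanent rules -/

/-- The rule `r` is minimized at time `t`. -/
structure IsMinimizedAt (ι : A → A) (σ : ℕ → Config A) (t : ℕ) (r : Rule A) : Prop where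
  comparing : (σ t).comparing = false
  mem : r ∈ (σ t).store.considered ∨ r ∈ (σ t).store.new
  succ : σ (t + 1) = minimizeRule ι (σ t) r

/-- The rules that belong to `S` from some time on. -/
def Permanent (σ : ℕ → Config A) : Set (Rule A) :=
  {r | ∀ᶠ t in atTop, r ∈ (σ t).store.all}

theorem mem_nextPass_all {c : Config A} {r : Rule A} : r ∈ (nextPass c).store.all ↔
    r ∈ c.store.considered ∨ r ∈ c.store.this ∨ r ∈ c.store.new := by
  rw [Store.mem_all]
  simp [nextPass]

namespace IsRun

variable {σ : ℕ → Config A} (h : IsRun γ ι σ)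
include h

theorem pass_strictMono {s t : ℕ} (hs : AtPassEnd (σ s)) (hst : s < t) :
    (σ s).pass < (σ t).pass := by
  have h₁ := h.pass_mono (Nat.succ_le_of_lt hst)
  simp only [Nat.succ_eq_add_one] at h₁
  rcases h.pass_succ s with h' | h'
  · exact absurd hs h'.2.2
  · omega

theorem eventually_lt_pass (n : ℕ) : ∀ᶠ t in atTop, n < (σ t).pass := by
  have : ∃ t, n < (σ t).pass := by
    induction n with
    | zero =>
      obtain ⟨s, -, h₂, -⟩ := h.exists_atPassEnd 0
      exact ⟨s + 1, (Nat.zero_le _).trans_lt (h.pass_strictMono h₂ (Nat.lt_succ_self s))⟩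
    | succ n ih =>
      obtain ⟨t, ht⟩ := ih
      obtain ⟨s, h₁, h₂, h₃⟩ := h.exists_atPassEnd t
      have := h.pass_strictMono (t := s + 1) h₂ (by omega)
      exact ⟨s + 1, by omega⟩
  obtain ⟨t, ht⟩ := this
  filter_upwards [eventually_ge_atTop t] with s hs
  exact ht.trans_le (h.pass_mono hs)

/-- The beginning of a later pass. -/
theorem exists_pass_start {s t : ℕ} (hst : (σ s).pass < (σ t).pass) :
    ∃ u, s ≤ u ∧ u < t ∧ AtPassEnd (σ u) ∧ σ (u + 1) = nextPass (σ u) ∧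
      (σ (u + 1)).pass = (σ t).pass := by
  have hle : s ≤ t := by
    by_contra! h'
    have := h.pass_mono h'.le
    omega
  obtain ⟨u, h₁, h₂, h₃, h₄⟩ := exists_last (P := fun u => (σ u).pass < (σ t).pass) hle hst
    (lt_irrefl _)
  have h₅ := h.pass_mono (Nat.succ_le_of_lt h₂)
  simp only [Nat.succ_eq_add_one] at h₅
  rcases h.pass_succ u with h' | h'
  · omega
  · exact ⟨u, h₁, h₂, h'.2.1, h'.2.2, by omega⟩

theorem delete_subset {t : ℕ} (ht : ¬ AtPassEnd (σ t)) :
    (σ t).store.delete ⊆ (σ (t + 1)).store.delete := by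
  have hs := h.steps t
  generalize hc : σ (t + 1) = c at hs
  cases hs with
  | minimize r hf hr =>
    have hr : r ∈ (σ t).store.all := by
      rw [Store.mem_all]
      rcases hr with hr | hr
      · exact Or.inl ((h.inv t).todo_subset hr)
      · exact Or.inr (Or.inr (Or.inl hr.2))
    obtain ⟨S', out, hS', hmin⟩ := (h.inv t).minimizes h.involutive h.map_inv hr
    intro x hx
    rw [mem_minimizeRule_delete hS', hmin.ext.delete]
    exact Or.inl hx
  | startComparing _ _ _ => exact subset_rfl
  | resolve p _ hp =>
    have hres := resolve_spec (h.inv t).rules.groupLabelled (h.inv t).sound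
      ((h.inv t).pairs_val p hp)
    simp only
    rw [hres.delete]
  | compare r _ _ _ => exact subset_rfl
  | nextPass h₁ h₂ h₃ => exact absurd ⟨h₁, h₂, h₃⟩ ht

/-- During a pass, the rules in `todo` and `New` are minimized. -/
theorem exists_isMinimizedAt {t : ℕ} (ht : (σ t).comparing = false) {r : Rule A}
    (hr : r ∈ (σ t).todo ∨ r ∈ (σ t).store.new) :
    ∃ s, t ≤ s ∧ (σ s).pass = (σ t).pass ∧ IsMinimizedAt ι σ s r := by
  obtain ⟨e, he₁, he₂, he₃⟩ := h.exists_atPassEnd t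
  obtain ⟨s, h₁, h₂, ⟨h₃, h₄⟩, h₅⟩ := exists_last
    (P := fun s => (σ s).comparing = false ∧ (r ∈ (σ s).todo ∨ r ∈ (σ s).store.new)) he₁ ⟨ht, hr⟩
    (fun h' => by simp [he₂.1] at h')
  have hpass : (σ s).pass = (σ t).pass :=
    le_antisymm (he₃ ▸ h.pass_mono h₂.le) (h.pass_mono h₁)
  refine ⟨s, h₁, hpass, ?_⟩
  have hs := h.steps s
  generalize hc : σ (s + 1) = c at hs
  cases hs with
  | minimize r' hf hr' =>
    by_cases hrr : r = r'
    · subst hrr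
      exact ⟨h₃, hr'.imp (fun h' => (h.inv s).todo_subset h') (fun h' => h'.2), hc⟩
    · exfalso
      apply h₅
      have hr'S : r' ∈ (σ s).store.all := by
        rw [Store.mem_all]
        rcases hr' with hr' | hr'
        · exact Or.inl ((h.inv s).todo_subset hr')
        · exact Or.inr (Or.inr (Or.inl hr'.2))
      obtain ⟨S', out, hS', hmin⟩ := (h.inv s).minimizes h.involutive h.map_inv hr'S
      rw [hc, mem_minimizeRule_todo, mem_minimizeRule_new hS']
      exact ⟨h₃, h₄.imp (fun h' => ⟨h', hrr⟩) fun h' => ⟨hmin.ext.new_subset h', hrr⟩⟩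
  | startComparing _ ht hn => simp [ht, hn] at h₄
  | resolve p hf hp => simp [hf] at h₃
  | compare r hf _ _ => simp [hf] at h₃
  | nextPass hf _ _ => simp [hf] at h₃

/-- A rule that stays in `S` is minimized in every later pass. -/
theorem exists_isMinimizedAt_of_permanent {t₀ e : ℕ} {r : Rule A}
    (hr : ∀ t, t₀ ≤ t → r ∈ (σ t).store.all) (he : AtPassEnd (σ e))
    (hpass : (σ t₀).pass < (σ e).pass) :
    ∃ s, t₀ ≤ s ∧ s < e ∧ (σ s).pass = (σ e).pass ∧ IsMinimizedAt ι σ s r := by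
  obtain ⟨u, h₁, h₂, h₃, h₄, h₅⟩ := h.exists_pass_start hpass
  have hru := hr (u + 1) (by omega)
  have hf : (σ (u + 1)).comparing = false := by rw [h₄]; rfl
  have hmem : r ∈ (σ (u + 1)).todo ∨ r ∈ (σ (u + 1)).store.new := by
    rw [h₄] at hru ⊢
    rcases mem_nextPass_all.1 hru with h' | h' | h'
    · exact Or.inl h'
    · simp [h₃.2.2] at h'
    · exact Or.inr h'
  obtain ⟨s, h₆, h₇, h₈⟩ := h.exists_isMinimizedAt hf hmem
  refine ⟨s, by omega, ?_, h₇.trans h₅, h₈⟩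
  by_contra! hle
  rcases hle.eq_or_lt with rfl | hlt
  · have := he.1
    simp [h₈.comparing] at this
  · have := h.pass_strictMono he hlt
    omega

theorem minimizes_of_isMinimizedAt {t : ℕ} {r : Rule A} (ht : IsMinimizedAt ι σ t r) :
    ∃ S' out, minimizeOut ι (σ t).rules (σ t).store r = (S', out) ∧
      Minimizes γ ι (σ t).rules (σ t).store r S' out := by
  refine (h.inv t).minimizes h.involutive h.map_inv (Store.mem_all.2 ?_)
  have := ht.mem
  tauto

/-- A rule that stays in `S` is not changed by its minimization: it would be moved to `Delete`
at best, and deleted when the pass ends. -/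
theorem out_eq_of_permanent {t : ℕ} {r : Rule A} (hr : ∀ u, t ≤ u → r ∈ (σ u).store.all)
    (ht : IsMinimizedAt ι σ t r) {S' : Store A} {out : Rule A}
    (hS' : minimizeOut ι (σ t).rules (σ t).store r = (S', out))
    (hmin : Minimizes γ ι (σ t).rules (σ t).store r S' out) : out = r := by
  by_contra hne
  have hdel : r ∈ (σ (t + 1)).store.delete := by
    have h₁ := hr (t + 1) (by omega)
    rw [ht.succ] at h₁ ⊢
    rw [Store.mem_all, mem_minimizeRule_considered hS', mem_minimizeRule_new hS',
      mem_minimizeRule_this hS', hmin.ext.this] at h₁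
    have hthis : r ∉ (σ t).store.this := by
      rcases ht.mem with h' | h'
      · exact ((h.inv t).considered_disj r h').1
      · exact fun h'' => ((h.inv t).this_disj r h'').1 h'
    rcases h₁ with h₁ | (h₁ | h₁ | h₁) | h₁ | h₁
    · exact absurd (h₁.2 rfl) hne
    · exact absurd h₁ hthis
    · exact absurd h₁.2.1 hne
    · exact absurd h₁.1.symm hne
    · exact absurd rfl h₁.2
    · exact h₁
  obtain ⟨e, he₁, he₂, he₃⟩ := h.exists_atPassEnd (t + 1)
  have hdel' : ∀ u, t + 1 ≤ u → u ≤ e → r ∈ (σ u).store.delete := by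
    intro u hu
    induction u, hu using Nat.le_induction with
    | base => exact fun _ => hdel
    | succ u hu ih =>
      exact fun hue => h.delete_subset (h.not_atPassEnd hu hue he₃) (ih (by omega))
  have h₂ := hdel' e he₁ le_rfl
  have h₃ := hr (e + 1) (by omega)
  rw [(h.steps e).eq_nextPass he₂, mem_nextPass_all] at h₃
  rcases h₃ with h₃ | h₃ | h₃
  · exact ((h.inv e).considered_disj r h₃).2.2 h₂
  · exact ((h.inv e).this_disj r h₃).2 h₂
  · exact (h.inv e).new_disj r h₃ h₂

theorem minimizes_self_of_permanent {t : ℕ} {r : Rule A}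
    (hr : ∀ u, t ≤ u → r ∈ (σ u).store.all) (ht : IsMinimizedAt ι σ t r) :
    ∃ S', minimizeOut ι (σ t).rules (σ t).store r = (S', r) ∧
      Minimizes γ ι (σ t).rules (σ t).store r S' r := by
  obtain ⟨S', out, hS', hmin⟩ := h.minimizes_of_isMinimizedAt ht
  obtain rfl := h.out_eq_of_permanent hr ht hS' hmin
  exact ⟨S', hS', hmin⟩

theorem ne_nil_of_mem {t : ℕ} {r : Rule A} (hr : r ∈ (σ t).store.all) : r ≠ ([], []) := by
  rintro rfl
  exact lt_irrefl _ ((h.inv t).sound _ hr).2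

/-- Once minimized, a rule that stays in `S` stays in `Considered` or `This`. -/
theorem mem_considered_or_this {t : ℕ} {r : Rule A} (hr : ∀ u, t ≤ u → r ∈ (σ u).store.all)
    (ht : IsMinimizedAt ι σ t r) {u : ℕ} (hu : t + 1 ≤ u) :
    r ∈ (σ u).store.considered ∨ r ∈ (σ u).store.this := by
  induction u, hu using Nat.le_induction with
  | base =>
    obtain ⟨S', hS', hmin⟩ := h.minimizes_self_of_permanent hr ht
    rw [ht.succ, mem_minimizeRule_considered hS', mem_minimizeRule_this hS', hmin.ext.considered]
    rcases ht.mem with h' | h'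
    · exact Or.inl ⟨h', fun _ => rfl⟩
    · exact Or.inr (Or.inr (Or.inl ⟨rfl, rfl, hmin.ext.new_subset h'⟩))
  | succ u hu ih =>
    have hs := h.steps u
    generalize hc : σ (u + 1) = c at hs
    cases hs with
    | minimize r' hf hr' =>
      have hmem' : r' ∈ (σ u).store.considered ∨ r' ∈ (σ u).store.new :=
        hr'.imp (fun h' => (h.inv u).todo_subset h') fun h' => h'.2
      have hu' : IsMinimizedAt ι σ u r' := ⟨hf, hmem', hc⟩
      obtain ⟨S', out, hS', hmin⟩ := h.minimizes_of_isMinimizedAt hu'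
      rw [mem_minimizeRule_considered hS', mem_minimizeRule_this hS', hmin.ext.considered,
        hmin.ext.this]
      refine ih.imp (fun h' => ⟨h', ?_⟩) Or.inl
      rintro rfl
      exact h.out_eq_of_permanent (fun v hv => hr v (by omega)) hu' hS' hmin
    | startComparing _ _ _ => exact ih
    | resolve p _ hp =>
      have hres := resolve_spec (h.inv u).rules.groupLabelled (h.inv u).sound
        ((h.inv u).pairs_val p hp)
      simp only
      rw [hres.considered, hres.this]
      exact ih
    | compare r' _ _ _ =>
      simp only [compare, Finset.mem_insert, Finset.mem_erase]
      tauto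
    | nextPass _ _ _ => exact ih

theorem mem_considered_of_permanent {t₀ e : ℕ} {r : Rule A}
    (hr : ∀ t, t₀ ≤ t → r ∈ (σ t).store.all) (he : AtPassEnd (σ e))
    (hpass : (σ t₀).pass < (σ e).pass) : r ∈ (σ e).store.considered := by
  obtain ⟨s, h₁, h₂, -, h₄⟩ := h.exists_isMinimizedAt_of_permanent hr he hpass
  rcases h.mem_considered_or_this (fun u hu => hr u (by omega)) h₄ h₂ with h' | h'
  · exact h'
  · simp [he.2.2] at h'

/-- The rules of `S` derive from permanent rules, by induction on their weights. -/
theorem supersedes_permanent (t : ℕ) :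
    Supersedes (Permanent σ) ((σ t).store.all : Set (Rule A)) := by
  have key : ∀ n t, ∀ r ∈ (σ t).store.all, weight r < n →
      r ∈ Permanent σ ∨ Derivable (Permanent σ) r := by
    intro n
    induction n with
    | zero => intro t r _ hn; omega
    | succ n ih =>
      intro t r hr hn
      by_cases hp : ∀ u, t ≤ u → r ∈ (σ u).store.all
      · left
        filter_upwards [eventually_ge_atTop t] with u hu using hp u hu
      · right
        push Not at hp
        obtain ⟨u, hu, hru⟩ := hp
        refine Conn.bind ((h.supersedes hu r hr).resolve_left hru) ?_
        rintro x ⟨hx, hxw⟩ -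
        rcases ih u x hx (by omega) with h' | h'
        · exact Conn.of_rule ⟨h', hxw⟩ (by omega)
            (by have := (h.inv u).decreasing x hx; omega)
        · exact Conn.mono h' (fun y hy => ⟨hy.1, by have := hy.2; omega⟩) le_rfl
  exact fun r hr => key _ t r hr (Nat.lt_succ_self _)

theorem conn_permanent {t n : ℕ} {a b : List A}
    (hab : Conn ((σ t).store.all : Set (Rule A)) n a b) : Conn (Permanent σ) n a b :=
  hab.supersedes (h.inv t).decreasing (h.supersedes_permanent t)

theorem sound_of_permanent {r : Rule A} (hr : r ∈ Permanent σ) : Sound γ r := by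
  obtain ⟨t, ht⟩ := hr.exists
  exact (h.inv t).sound r ht

/-- The labels along accepting paths persist in `WDiff` to the end of the pass, except that they
may become smaller. -/
theorem exists_folds_needed {s t : ℕ} (hst : s ≤ t) (hpass : (σ t).pass = (σ s).pass) :
    ∃ φ, Folds φ (σ s).wdiff.needed (σ t).wdiff.needed := by
  induction t, hst using Nat.le_induction with
  | base => exact ⟨_, Folds.id _⟩
  | succ t hst ih =>
    have hna := h.not_atPassEnd hst (Nat.lt_succ_self t) hpass
    have hs := h.steps t
    have hp := (hs.pass_eq hna).1
    obtain ⟨φ, hφ⟩ := ih (hp.symm.trans hpass)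
    suffices ∃ ψ, Folds ψ (σ t).wdiff.needed (σ (t + 1)).wdiff.needed by
      obtain ⟨ψ, hψ⟩ := this
      exact ⟨_, hψ.comp hφ⟩
    generalize σ (t + 1) = c at hs
    cases hs with
    | minimize r hf hr =>
      have hr : r ∈ (σ t).store.all := by
        rw [Store.mem_all]
        rcases hr with hr | hr
        · exact Or.inl ((h.inv t).todo_subset hr)
        · exact Or.inr (Or.inr (Or.inl hr.2))
      obtain ⟨S', out, hS', hmin⟩ := (h.inv t).minimizes h.involutive h.map_inv hr
      rw [minimizeRule_wdiff, hS']
      simp only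
      split_ifs with h'
      · exact ⟨_, Folds.id _⟩
      · obtain ⟨-, -, ψ, -, h₂, -⟩ := sew_spec h.map_inv (fun w =>
          (rReduce_spec (h.inv t).rules.groupLabelled
            (hmin.ext.sound (h.inv t).rules.groupLabelled (h.inv t).sound) w).1.val_eq)
          (h.inv t).wdiff hmin.val_eq
        exact ⟨ψ, h₂⟩
    | startComparing _ _ _ => exact ⟨_, Folds.id _⟩
    | resolve p _ hp => exact ⟨_, Folds.id _⟩
    | compare r _ _ _ => exact ⟨_, Folds.id _⟩
    | nextPass h₁ h₂ h₃ => exact absurd ⟨h₁, h₂, h₃⟩ hna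

/-- What sewing a permanent rule achieves in the current pass: any path for the rule yields a path
with smaller labels in the next automaton `Rules`. -/
theorem loopWalk_nextPass {s e : ℕ} (hse : s < e) (he : AtPassEnd (σ e))
    (hpass : (σ e).pass = (σ s).pass) {r : Rule A} (hr : ∀ u, s ≤ u → r ∈ (σ u).store.all)
    (hs : IsMinimizedAt ι σ s r) :
    LoopReads (σ (e + 1)).rules [] (pad r.1 r.2) [] ∧
      ∀ τ, τ 0 = [] → Walk (σ s).wdiff.arrows (pad r.1 r.2) τ →
        ∃ φ : List A → List A, (∀ w, rank (φ w) ≤ rank w) ∧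
          LoopWalk (σ (e + 1)).rules (pad r.1 r.2) fun i => φ (τ i) := by
  obtain ⟨S', hS', hmin⟩ := h.minimizes_self_of_permanent hr hs
  have hne := h.ne_nil_of_mem (hr s le_rfl)
  have hp : (σ (s + 1)).pass = (σ s).pass := by
    rw [hs.succ]
    rfl
  obtain ⟨ψ, hψ⟩ := h.exists_folds_needed hse (hpass.trans hp.symm)
  obtain ⟨-, χ, hχ⟩ := (normalize_spec ((h.inv e).wdiff.isRuleAut.mono
    (h.inv e).wdiff.needed_subset) (h.inv e).sound).1
  have hrules : (σ (e + 1)).rules = normalize (σ e).store (σ e).wdiff.needed := by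
    rw [(h.steps e).eq_nextPass he]
    rfl
  have hwd : (σ (s + 1)).wdiff =
      sew ι (fun w => (rReduce (σ s).rules (S', w)).2) (σ s).wdiff r := by
    rw [hs.succ, minimizeRule_wdiff, hS']
    exact if_neg hne
  obtain ⟨-, h₁, φ, h₂, -, h₃⟩ := sew_spec h.map_inv (fun w =>
    (rReduce_spec (h.inv s).rules.groupLabelled
      (hmin.ext.sound (h.inv s).rules.groupLabelled (h.inv s).sound) w).1.val_eq)
    (h.inv s).wdiff hmin.val_eq
  rw [← hwd] at h₁ h₃
  rw [hrules]
  refine ⟨?_, fun τ hτ hw => ⟨fun w => χ (ψ (φ w)), fun w => ?_, ?_⟩⟩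
  · have := (h₁.folds hψ).folds hχ
    rwa [hψ.nil, hχ.nil] at this
  · exact ((hχ.rank_le _).trans (hψ.rank_le _)).trans (h₂.rank_le w)
  · exact ((h₃ τ hτ hw).folds hψ).folds hχ

end IsRun

/-! ### The permanent rules are the minimal rules -/

namespace IsRun

variable {σ : ℕ → Config A} (h : IsRun γ ι σ)
include h

/-- For large `t`, a permanent rule has been minimized to itself in the current pass. -/
theorem eventually_exists_isMinimizedAt {r : Rule A} (hr : r ∈ Permanent σ) :
    ∀ᶠ t in atTop, (∀ u, t ≤ u → r ∈ (σ u).store.all) ∧ ∀ e, t ≤ e → AtPassEnd (σ e) →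
      ∃ s, s < e ∧ (σ s).pass = (σ e).pass ∧ (∀ u, s ≤ u → r ∈ (σ u).store.all) ∧
        IsMinimizedAt ι σ s r := by
  obtain ⟨t₀, ht₀⟩ := eventually_atTop.1 hr
  filter_upwards [h.eventually_lt_pass (σ t₀).pass, eventually_ge_atTop t₀] with t ht ht'
  refine ⟨fun u hu => ht₀ u (ht'.trans hu), fun e hte he => ?_⟩
  obtain ⟨s, h₁, h₂, h₃, h₄⟩ :=
    h.exists_isMinimizedAt_of_permanent ht₀ he (ht.trans_le (h.pass_mono hte))
  exact ⟨s, h₂, h₃, fun u hu => ht₀ u (h₁.trans hu), h₄⟩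

theorem balanced_of_permanent {r : Rule A} (hr : r ∈ Permanent σ) : Balanced r.1 r.2 := by
  obtain ⟨t, ht, ht'⟩ := (h.eventually_exists_isMinimizedAt hr).exists
  obtain ⟨e, he₁, he₂, -⟩ := h.exists_atPassEnd t
  obtain ⟨s, -, -, h₃, h₄⟩ := ht' e he₁ he₂
  obtain ⟨S', -, hmin⟩ := h.minimizes_self_of_permanent h₃ h₄
  exact (hmin.balanced.resolve_left (h.ne_nil_of_mem (h₃ s le_rfl))).1

theorem eventually_not_reducible_of_permanent {r : Rule A} (hr : r ∈ Permanent σ) :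
    ∀ᶠ t in atTop, ¬ Reducible (ruleSet (σ t).rules) r.2 ∧
      ∀ w, w <:+: r.1 → w ≠ r.1 → ¬ Reducible (ruleSet (σ t).rules) w := by
  filter_upwards [h.eventually_exists_isMinimizedAt hr] with t ht
  obtain ⟨e, he₁, he₂, he₃⟩ := h.exists_atPassEnd t
  obtain ⟨s, -, h₂, h₃, h₄⟩ := ht.2 e he₁ he₂
  obtain ⟨S', -, hmin⟩ := h.minimizes_self_of_permanent h₃ h₄
  rw [h.rules_eq (he₃.symm.trans h₂.symm)]
  exact ⟨(hmin.balanced.resolve_left (h.ne_nil_of_mem (h₃ s le_rfl))).2, hmin.proper⟩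

theorem eventually_reducible_of_permanent {r : Rule A} (hr : r ∈ Permanent σ) :
    ∀ᶠ t in atTop, Reducible (ruleSet (σ t).rules) r.1 := by
  obtain ⟨t₀, ht₀, ht₀'⟩ := (h.eventually_exists_isMinimizedAt hr).exists
  filter_upwards [h.eventually_lt_pass (σ t₀).pass] with t ht
  obtain ⟨e, h₁, h₂, h₃, h₄, h₅⟩ := h.exists_pass_start ht
  obtain ⟨s, h₆, h₇, h₈, h₉⟩ := ht₀' e h₁ h₃
  obtain ⟨τ, hτ₀, hτ, hτ₁⟩ := (h.loopWalk_nextPass h₆ h₃ h₇.symm h₈ h₉).1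
  rw [← h.rules_eq h₅]
  exact hτ.reducible (h.inv (e + 1)).rules.noInitialDiag (h.balanced_of_permanent hr) hτ₀ hτ₁

/-- The permanent rules form a confluent system: they are compared for overlaps, and none of them
properly contains the left-hand side of another one, which is reducible in all late passes. -/
theorem hasConnectedOverlaps : HasConnectedOverlaps (Permanent σ) := by
  refine ⟨fun r hr => (h.sound_of_permanent hr).2, fun r hr r' hr' hrr => ?_, ?_⟩
  · by_contra hne
    obtain ⟨t, h₁, h₂⟩ := ((h.eventually_not_reducible_of_permanent hr).and
      (h.eventually_reducible_of_permanent hr')).exists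
    exact h₁.2 _ hrr hne h₂
  · intro r hr r' hr' p hp
    obtain ⟨t₀, ht₀⟩ := eventually_atTop.1 (Filter.Eventually.and hr hr')
    obtain ⟨t, ht⟩ := (h.eventually_lt_pass (σ t₀).pass).exists
    obtain ⟨e, he₁, he₂, -⟩ := h.exists_atPassEnd t
    have hlt := ht.trans_le (h.pass_mono he₁)
    have h₁ := h.mem_considered_of_permanent (fun u hu => (ht₀ u hu).1) he₂ hlt
    have h₂ := h.mem_considered_of_permanent (fun u hu => (ht₀ u hu).2) he₂ hlt
    rcases (h.inv e).overlaps r h₁ r' h₂ p hp with h' | h'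
    · simp [he₂.2.1] at h'
    · exact h.conn_permanent h'

theorem reducible_permanent {w : List A} (hw : ¬ IsLeast γ w) : Reducible (Permanent σ) w := by
  unfold IsLeast at hw
  push Not at hw
  obtain ⟨w', hw', hlt⟩ := hw
  obtain ⟨n, hn⟩ := h.complete w w' hw'.symm
  exact h.hasConnectedOverlaps.reducible_of_conn (h.conn_permanent hn) hlt

theorem eventually_reducible {w : List A} (hw : ¬ IsLeast γ w) :
    ∀ᶠ t in atTop, Reducible (ruleSet (σ t).rules) w := by
  obtain ⟨r, hr, hrw⟩ := h.reducible_permanent hw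
  filter_upwards [h.eventually_reducible_of_permanent hr] with t ht using ht.mono hrw

theorem isLeast_of_eventually_not_reducible {w : List A}
    (hw : ∀ᶠ t in atTop, ¬ Reducible (ruleSet (σ t).rules) w) : IsLeast γ w := by
  by_contra hw'
  obtain ⟨t, h₁, h₂⟩ := (hw.and (h.eventually_reducible hw')).exists
  exact h₁ h₂

theorem isMinimal_of_permanent {r : Rule A} (hr : r ∈ Permanent σ) : IsMinimal γ r := by
  have hr' := h.eventually_not_reducible_of_permanent hr
  refine ⟨h.sound_of_permanent hr, fun w hw hne => ?_, ?_⟩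
  · exact h.isLeast_of_eventually_not_reducible (hr'.mono fun t ht => ht.2 w hw hne)
  · exact h.isLeast_of_eventually_not_reducible (hr'.mono fun t ht => ht.1)

theorem mem_permanent_iff {r : Rule A} : r ∈ Permanent σ ↔ IsMinimal γ r := by
  refine ⟨h.isMinimal_of_permanent, fun hr => ?_⟩
  obtain ⟨r', hr', hrr⟩ := h.reducible_permanent hr.not_isLeast
  have hmin := h.isMinimal_of_permanent hr'
  have h₁ : r'.1 = r.1 := by
    by_contra hne
    exact hmin.not_isLeast (hr.proper _ hrr hne)
  have h₂ : r'.2 = r.2 := hmin.least.eq hr.least (by rw [← hmin.sound.1, h₁, hr.sound.1])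
  rwa [← Prod.ext h₁ h₂]

theorem balanced_of_isMinimal {r : Rule A} (hr : IsMinimal γ r) : Balanced r.1 r.2 :=
  h.balanced_of_permanent (h.mem_permanent_iff.2 hr)

end IsRun

/-! ### Word differences of minimal rules -/

/-- The word difference of a rule after `i` letters, an element of the group. -/
def wordDiff (γ : A → G) (r : Rule A) (i : ℕ) : G :=
  (val γ (r.1.take i))⁻¹ * val γ (r.2.take i)

theorem length_pad_of_rank_lt {r : Rule A} (hr : rank r.2 < rank r.1) :
    (pad r.1 r.2).length = r.1.length := by
  rw [length_pad]
  exact max_eq_left (length_le_of_rank_le hr.le)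

theorem IsMinimal.wordDiff_ne_one {r : Rule A} (hr : IsMinimal γ r) (hb : Balanced r.1 r.2)
    {i : ℕ} (h₀ : 0 < i) (hi : i < (pad r.1 r.2).length) : wordDiff γ r i ≠ 1 := by
  intro h
  rw [length_pad_of_rank_lt hb.1] at hi
  have h₁ : IsLeast γ (r.1.take i) := by
    refine hr.proper _ (List.take_prefix _ _).isInfix fun he => ?_
    have := congrArg List.length he
    rw [List.length_take] at this
    omega
  have h₂ : IsLeast γ (r.2.take i) := hr.least.of_infix (List.take_prefix _ _).isInfix
  have h₃ := h₁.eq h₂ (inv_mul_eq_one.1 h)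
  have h₄ : r.1.head? = r.2.head? := by
    have h₅ := congrArg List.head? h₃
    rwa [List.head?_take, List.head?_take, if_neg (by omega), if_neg (by omega)] at h₅
  refine hb.2.2 ⟨fun hn => ?_, h₄⟩
  rw [hn, List.head?_nil, List.head?_eq_none_iff] at h₄
  simp [h₄] at hi

theorem IsMinimal.walk_of_loopWalk {r : Rule A} (hr : IsMinimal γ r) (hb : Balanced r.1 r.2)
    {E : RuleAut A} (hE : GroupLabelled γ E) {τ : ℕ → List A} (h₀ : τ 0 = [])
    (hw : LoopWalk E (pad r.1 r.2) τ) : Walk E (pad r.1 r.2) τ := by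
  intro i a ha
  rcases hw i a ha with h | ⟨h₁, -, x, hx⟩
  · exact h
  · exfalso
    have hi : i < (pad r.1 r.2).length := (List.getElem?_eq_some_iff.1 ha).1
    rcases Nat.eq_zero_or_pos i with rfl | hpos
    · have h₂ := ((getElem?_pad _ _ _ _).1 ha).2
      rw [hx, Prod.mk.injEq] at h₂
      refine hb.2.2 ⟨fun hn => ?_, ?_⟩
      · simp [hn] at h₂
      · rw [List.head?_eq_getElem?, List.head?_eq_getElem?, ← h₂.1, ← h₂.2]
    · refine hr.wordDiff_ne_one hb hpos hi ?_
      have := hw.val_eq hE h₀ hi.le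
      rw [h₁, val_nil] at this
      exact this.symm

/-- The least string that represents `g`. -/
def leastRep (γ : A → G) (g : G) : List A := slMin {w | val γ w = g}

theorem isLeast_leastRep (g : G) : IsLeast γ (leastRep γ g) := by
  by_cases hne : {w | val γ w = g}.Nonempty
  · exact fun w hw => rank_slMin_le (T := {w | val γ w = g}) (hw.trans (slMin_mem hne))
  · unfold leastRep slMin
    rw [dif_neg hne]
    exact isLeast_nil

theorem IsLeast.leastRep_eq {w : List A} (h : IsLeast γ w) : leastRep γ (val γ w) = w :=
  (isLeast_leastRep _).eq h (slMin_mem (T := {w' | val γ w' = val γ w}) ⟨w, rfl⟩)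

/-- The arrows of the accepting paths of the minimal rules, the states being labelled by least
strings. These are the arrows of the limiting automaton. -/
def limitArrows (γ : A → G) : Set (Arrow A) :=
  {a | ∃ r, IsMinimal γ r ∧ ∃ i b, (pad r.1 r.2)[i]? = some b ∧
    a = (leastRep γ (wordDiff γ r i), b, leastRep γ (wordDiff γ r (i + 1)))}

theorem leastRep_wordDiff_zero (r : Rule A) : leastRep γ (wordDiff γ r 0) = [] := by
  have : wordDiff γ r 0 = val γ [] := by simp [wordDiff, val_nil]
  rw [this, isLeast_nil.leastRep_eq]

theorem leastRep_wordDiff_length {r : Rule A} (hr : val γ r.1 = val γ r.2) :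
    leastRep γ (wordDiff γ r (pad r.1 r.2).length) = [] := by
  have : wordDiff γ r (pad r.1 r.2).length = val γ [] := by
    rw [wordDiff, length_pad, List.take_of_length_le (le_max_left _ _),
      List.take_of_length_le (le_max_right _ _), hr, inv_mul_cancel, val_nil]
  rw [this, isLeast_nil.leastRep_eq]

/-! ### The labels on the paths of minimal rules become least -/

theorem finite_rank_le (B : ℕ) : {w : List A | rank w ≤ B}.Finite :=
  Set.Finite.of_injOn (f := rank) (t := Set.Iic B) (fun _ hw => hw) rank_injective.injOn
    (Set.finite_Iic B)

namespace IsRun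

variable {σ : ℕ → Config A} (h : IsRun γ ι σ)
include h

/-- The labels along the path of a minimal rule do not increase from one pass to the next one. -/
theorem eventually_bounded_walk {r : Rule A} (hr : IsMinimal γ r) :
    ∃ B, ∀ᶠ t in atTop, ∃ τ : ℕ → List A, τ 0 = [] ∧ Walk (σ t).rules (pad r.1 r.2) τ ∧
      ∀ i, i ≤ (pad r.1 r.2).length → rank (τ i) ≤ B := by
  have hb := h.balanced_of_isMinimal hr
  obtain ⟨t₀, ht₀, ht₀'⟩ :=
    (h.eventually_exists_isMinimizedAt (h.mem_permanent_iff.2 hr)).exists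
  obtain ⟨e, he₁, he₂, -⟩ := h.exists_atPassEnd t₀
  obtain ⟨s, h₁, h₂, h₃, h₄⟩ := ht₀' e he₁ he₂
  obtain ⟨τ, hτ₀, hτ, -⟩ := (h.loopWalk_nextPass h₁ he₂ h₂.symm h₃ h₄).1
  refine ⟨∑ i ∈ Finset.range ((pad r.1 r.2).length + 1), rank (τ i), ?_⟩
  filter_upwards [eventually_ge_atTop (e + 1)] with t ht
  induction t, ht using Nat.le_induction with
  | base =>
    refine ⟨τ, hτ₀, hr.walk_of_loopWalk hb (h.inv _).rules.groupLabelled hτ₀ hτ, fun i hi => ?_⟩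
    exact Finset.single_le_sum (f := fun i => rank (τ i)) (fun _ _ => Nat.zero_le _)
      (Finset.mem_range.2 (Nat.lt_succ_of_le hi))
  | succ t ht ih =>
    obtain ⟨τ', hτ'₀, hτ', hB⟩ := ih
    rcases h.pass_succ t with h' | h'
    · exact ⟨τ', hτ'₀, by rwa [h'.2.1], hB⟩
    · obtain ⟨s, h₁, h₂, h₃, h₄⟩ := ht₀' t (by omega) h'.2.1
      obtain ⟨ψ, hψ⟩ := (h.inv s).folds
      rw [← h.rules_eq h₂] at hτ'
      have hw := hr.walk_of_loopWalk hb (h.inv s).wdiff.isRuleAut.groupLabelled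
        (by simp only [hτ'₀, hψ.nil]) (hτ'.loopWalk.folds hψ)
      obtain ⟨φ, hφ, hw'⟩ := (h.loopWalk_nextPass h₁ h'.2.1 h₂.symm h₃ h₄).2 _
        (by simp only [hτ'₀, hψ.nil]) hw
      have h₀ : φ (ψ (τ' 0)) = [] := by
        rw [hτ'₀, hψ.nil]
        exact eq_nil_of_rank_le (hφ [])
      exact ⟨_, h₀, hr.walk_of_loopWalk hb (h.inv _).rules.groupLabelled h₀ hw', fun i hi =>
        ((hφ _).trans (hψ.rank_le _)).trans (hB i hi)⟩

theorem eventually_not_reducible_label :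
    ∀ᶠ t in atTop, ∀ s ∈ states (σ t).rules, ¬ Reducible (ruleSet (σ t).rules) s := by
  filter_upwards [h.eventually_lt_pass (σ 0).pass] with t ht
  obtain ⟨e, -, -, h₃, h₄, h₅⟩ := h.exists_pass_start ht
  rw [← h.rules_eq h₅, h₄]
  exact (normalize_spec ((h.inv e).wdiff.isRuleAut.mono
    (h.inv e).wdiff.needed_subset) (h.inv e).sound).2

/-- In the long run, the labels on the path of a minimal rule are least: they are bounded, and the
finitely many bounded strings that are not least become reducible. -/
theorem eventually_walk_leastRep {r : Rule A} (hr : IsMinimal γ r) :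
    ∀ᶠ t in atTop, Walk (σ t).rules (pad r.1 r.2) fun i => leastRep γ (wordDiff γ r i) := by
  obtain ⟨B, hB⟩ := h.eventually_bounded_walk hr
  have hfin : ∀ᶠ t in atTop, ∀ w ∈ {w : List A | rank w ≤ B},
      ¬ IsLeast γ w → Reducible (ruleSet (σ t).rules) w := by
    rw [eventually_all_finite (finite_rank_le B)]
    intro w _
    by_cases hw : IsLeast γ w
    · exact Eventually.of_forall fun t hw' => absurd hw hw'
    · exact (h.eventually_reducible hw).mono fun t ht _ => ht
  filter_upwards [hB, hfin, h.eventually_not_reducible_label] with t ⟨τ, hτ₀, hτ, hτB⟩ ht ht'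
  have key : ∀ i, i ≤ (pad r.1 r.2).length → τ i ∈ states (σ t).rules →
      τ i = leastRep γ (wordDiff γ r i) := by
    intro i hi hs
    have hl : IsLeast γ (τ i) := by
      by_contra hl
      exact ht' _ hs (ht _ (hτB i hi) hl)
    rw [← hl.leastRep_eq, hτ.loopWalk.val_eq (h.inv t).rules.groupLabelled hτ₀ hi, wordDiff]
  intro i a ha
  have hi : i < (pad r.1 r.2).length := (List.getElem?_eq_some_iff.1 ha).1
  have harrow := hτ i a ha
  simp only
  rw [← key i hi.le (mem_states.2 (Or.inr ⟨_, harrow, Or.inl rfl⟩)),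
    ← key (i + 1) hi (mem_states.2 (Or.inr ⟨_, harrow, Or.inr rfl⟩))]
  exact harrow

theorem eventually_limitArrows_subset (hK : (limitArrows γ).Finite) :
    ∀ᶠ t in atTop, limitArrows γ ⊆ ((σ t).rules : Set (Arrow A)) := by
  have : ∀ᶠ t in atTop, ∀ a ∈ limitArrows γ, a ∈ (σ t).rules := by
    rw [eventually_all_finite hK]
    rintro a ⟨r, hr, i, b, hb, rfl⟩
    exact (h.eventually_walk_leastRep hr).mono fun t ht => ht i b hb
  exact this

end IsRun

/-! ### Stabilization -/

theorem weldLabel_of_isLeast {E : RuleAut A} (hE : GroupLabelled γ E) {s : List A}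
    (hs : IsLeast γ s) : weldLabel E ([], []) s = s :=
  rank_injective (le_antisymm (rank_weldLabel_le _ _ _) (hs _ (val_weldLabel hE rfl s)))

/-- Welding changes nothing when all labels are least. -/
theorem weldImage_eq_self {E F : RuleAut A} (hE : GroupLabelled γ E)
    (hl : ∀ s ∈ states F, IsLeast γ s) (hd : NoInitialDiag F) :
    weldImage E ([], []) F = F := by
  have key : ∀ b ∈ F, (weldLabel E ([], []) b.1, b.2.1, weldLabel E ([], []) b.2.2) = b := by
    intro b hb
    rw [weldLabel_of_isLeast hE (hl _ (mem_states.2 (Or.inr ⟨b, hb, Or.inl rfl⟩))),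
      weldLabel_of_isLeast hE (hl _ (mem_states.2 (Or.inr ⟨b, hb, Or.inr rfl⟩)))]
  ext a
  rw [mem_weldImage]
  constructor
  · rintro ⟨⟨b, hb, rfl⟩, -⟩
    rwa [key b hb]
  · exact fun ha => ⟨⟨a, ha, (key a ha).symm⟩, hd a ha⟩

/-- Sewing in a rule that is accepted already has no effect other than marking the arrows of
its path, when all labels are least. -/
theorem sew_of_walk {W : WDiff A} (hW : IsWDiff γ W)
    (hl : ∀ s ∈ states W.arrows, IsLeast γ s) (red : List A → List A) {r : Rule A}
    {τ : ℕ → List A} (h₀ : τ 0 = []) (hw : Walk W.arrows (pad r.1 r.2) τ)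
    (h₁ : τ (pad r.1 r.2).length = []) :
    (sew ι red W r).arrows = W.arrows ∧ ∀ b, b ∈ (sew ι red W r).needed ↔ b ∈ W.needed ∨
      ∃ i a, (pad r.1 r.2)[i]? = some a ∧ b = (τ i, a, τ (i + 1)) := by
  obtain ⟨hf₁, hf₂⟩ := hw.readForward_eq hW.isRuleAut.deterministic
  rw [h₀] at hf₁ hf₂
  rw [h₁] at hf₁
  have hsub : (readForward W.arrows [] (pad r.1 r.2)).1.toFinset ⊆ W.arrows := by
    intro b hb
    obtain ⟨i, a, ha, rfl⟩ := (hf₂ b).1 (List.mem_toFinset.1 hb)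
    exact hw i a ha
  have hsub' : W.needed ∪ (readForward W.arrows [] (pad r.1 r.2)).1.toFinset ⊆ W.arrows :=
    Finset.union_subset hW.needed_subset hsub
  have hmono := hW.isRuleAut.mono hsub'
  have hsew : sew ι red W r = WDiff.weld ⟨W.arrows,
      W.needed ∪ (readForward W.arrows [] (pad r.1 r.2)).1.toFinset⟩ ([], []) := by
    unfold sew
    simp only [hf₁, List.reverse_nil, readBackward, newArrows, List.toFinset_nil,
      Finset.union_empty]
  rw [hsew]
  unfold WDiff.weld
  simp only
  rw [weldImage_eq_self hW.isRuleAut.groupLabelled hl hW.isRuleAut.noInitialDiag,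
    weldImage_eq_self hW.isRuleAut.groupLabelled _ hmono.noInitialDiag]
  · refine ⟨rfl, fun b => ?_⟩
    rw [Finset.mem_union, List.mem_toFinset, hf₂]
  · intro s hs
    refine hl s (mem_states.2 ((mem_states.1 hs).imp_right ?_))
    rintro ⟨a, ha, h⟩
    exact ⟨a, hsub' ha, h⟩

theorem IsMinimal.walk_leastRep {r : Rule A} (hr : IsMinimal γ r) {E : RuleAut A}
    (hE : limitArrows γ ⊆ (E : Set (Arrow A))) :
    Walk E (pad r.1 r.2) fun i => leastRep γ (wordDiff γ r i) :=
  fun i b hb => hE ⟨r, hr, i, b, hb, rfl⟩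

namespace IsRun

variable {σ : ℕ → Config A} (h : IsRun γ ι σ)
include h

theorem mem_ruleSet_of_isMinimal {E : RuleAut A} (hE : limitArrows γ ⊆ (E : Set (Arrow A)))
    {r : Rule A} (hr : IsMinimal γ r) : r ∈ ruleSet E :=
  mem_ruleSet.2 ⟨h.balanced_of_isMinimal hr, _, leastRep_wordDiff_zero r, hr.walk_leastRep hE,
    leastRep_wordDiff_length hr.sound.1⟩

theorem reducible_iff {E : RuleAut A} (hE : limitArrows γ ⊆ (E : Set (Arrow A)))
    (hE' : GroupLabelled γ E) {w : List A} : Reducible (ruleSet E) w ↔ ¬ IsLeast γ w := by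
  refine ⟨fun hw hl => hl.not_reducible (fun r hr => hE'.sound hr) hw, fun hw => ?_⟩
  obtain ⟨r, hr, hrw⟩ := exists_isMinimal hw
  exact ⟨r, h.mem_ruleSet_of_isMinimal hE hr, hrw⟩

theorem isMinimal_out {E : RuleAut A} (hE : limitArrows γ ⊆ (E : Set (Arrow A)))
    (hE' : GroupLabelled γ E) {S S' : Store A} {r out : Rule A}
    (hmin : Minimizes γ ι E S r S' out) (hout : out ≠ ([], [])) : IsMinimal γ out := by
  refine ⟨hmin.sound_out hout, fun w hw hne => ?_, ?_⟩
  · by_contra hl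
    exact hmin.proper w hw hne ((h.reducible_iff hE hE').2 hl)
  · by_contra hl
    exact (hmin.balanced.resolve_left hout).2 ((h.reducible_iff hE hE').2 hl)

theorem isMinimal_of_isInsertable {E : RuleAut A} (hE : limitArrows γ ⊆ (E : Set (Arrow A)))
    (hE' : GroupLabelled γ E) {r : Rule A} (hr : IsInsertable E r) : IsMinimal γ r := by
  have hsound := hE'.sound hr.mem
  have hproper : ∀ w, w <:+: r.1 → w ≠ r.1 → IsLeast γ w := by
    intro w hw hne
    by_contra hl
    rcases infix_dropLast_or_infix_tail hw hne with hw' | hw'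
    · exact hr.dropLast (((h.reducible_iff hE hE').2 hl).mono hw')
    · exact hr.tail (((h.reducible_iff hE hE').2 hl).mono hw')
  have hl : ¬ IsLeast γ r.1 := by
    intro h'
    have h₁ := h' r.2 hsound.1.symm
    have h₂ := hsound.2
    omega
  obtain ⟨r', hr', hrr⟩ := exists_isMinimal hl
  have heq : r'.1 = r.1 := by
    by_contra hne
    exact hr'.not_isLeast (hproper _ hrr hne)
  refine ⟨hsound, hproper, fun w hw => ?_⟩
  have h₁ : (r.1, r'.2) ∈ ruleSet E := by
    rw [← heq]
    exact h.mem_ruleSet_of_isMinimal hE hr'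
  refine (hr.least _ h₁).trans (hr'.least w ?_)
  rw [hw, ← hsound.1, ← hr'.sound.1, heq]

/-- Rules that are inserted when all strings that are not least are reducible are minimal. -/
theorem isMinimal_of_inserted {t : ℕ} (hE : limitArrows γ ⊆ ((σ t).rules : Set (Arrow A)))
    {r : Rule A} (hr : r ∈ (σ (t + 1)).store.all) (hr' : r ∉ (σ t).store.all) :
    IsMinimal γ r := by
  have hI := h.inv t
  have hE' := hI.rules.groupLabelled
  have hs := h.steps t
  generalize σ (t + 1) = c at hs hr
  cases hs with
  | minimize x hf hx =>
    have hx : x ∈ (σ t).store.all := by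
      rw [Store.mem_all]
      rcases hx with hx | hx
      · exact Or.inl (hI.todo_subset hx)
      · exact Or.inr (Or.inr (Or.inl hx.2))
    obtain ⟨S', out, hS', hmin⟩ := hI.minimizes h.involutive h.map_inv hx
    rcases mem_all_of_mem_minimizeRule_all hS' hx hmin.ext.all_subset hr with h₁ | h₁
    · exact h.isMinimal_of_isInsertable hE hE' ((hmin.ext.mem_all h₁).resolve_left hr').2.1
    · rw [h₁.1]
      exact h.isMinimal_out hE hE' hmin h₁.2.2.1
  | startComparing _ _ _ => exact absurd hr hr'
  | resolve p _ hp =>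
    have hres := resolve_spec hE' hI.sound (hI.pairs_val p hp)
    have hnew : r ∈ (KnuthBendix.resolve (σ t).rules (σ t).store p).new := by
      rw [Store.mem_all] at hr hr'
      simp only at hr
      rw [hres.considered, hres.this, hres.delete] at hr
      tauto
    rcases hres.new_mem r hnew with h₁ | ⟨-, h₁ | ⟨h₁, h₂, h₃⟩⟩
    · exact absurd (Store.mem_all.2 (Or.inr (Or.inr (Or.inl h₁)))) hr'
    · exact h.isMinimal_of_isInsertable hE hE' h₁
    · rw [h.reducible_iff hE hE', not_not] at h₂ h₃
      have h₄ := h₁.2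
      rw [h₂.eq h₃ h₁.1] at h₄
      exact absurd h₄ (lt_irrefl _)
  | compare x _ _ hx => exact absurd ((mem_compare_all hx).1 hr) hr'
  | nextPass _ _ _ =>
    refine absurd ?_ hr'
    rw [mem_nextPass_all] at hr
    rw [Store.mem_all]
    tauto

theorem limitRules_eq (hK : (limitArrows γ).Finite) : limitRules σ = {r | IsMinimal γ r} := by
  ext r
  rw [Set.mem_ofPred_eq, ← h.mem_permanent_iff]
  constructor
  · intro hr
    by_contra hp
    obtain ⟨T, hT⟩ := eventually_atTop.1 (h.eventually_limitArrows_subset hK)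
    apply hp
    filter_upwards [eventually_ge_atTop T] with t ht
    by_contra hrt
    obtain ⟨s, hs, hrs⟩ := hr t
    obtain ⟨u, h₁, -, h₃, h₄⟩ := exists_last (P := fun u => r ∉ (σ u).store.all) hs hrt
      (fun h' => h' hrs)
    simp only [not_not] at h₃ h₄
    exact hp (h.mem_permanent_iff.2 (h.isMinimal_of_inserted (hT u (ht.trans h₁)) h₄ h₃))
  · intro hr t
    obtain ⟨s, h₁, h₂⟩ := (hr.and (eventually_ge_atTop t)).exists
    exact ⟨s, h₂, h₁⟩

/-- In the long run, `WDiff` does not change during a pass, apart from the marks, and only arrows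
of the limiting automaton are marked. -/
theorem eventually_wdiff (hK : (limitArrows γ).Finite) :
    ∀ᶠ t in atTop, limitArrows γ ⊆ ((σ t).rules : Set (Arrow A)) ∧
      (∀ s ∈ states (σ t).rules, IsLeast γ s) ∧ (σ t).wdiff.arrows = (σ t).rules ∧
      ((σ t).wdiff.needed : Set (Arrow A)) ⊆ limitArrows γ := by
  obtain ⟨T, hT⟩ := eventually_atTop.1
    ((h.eventually_limitArrows_subset hK).and h.eventually_not_reducible_label)
  have hl : ∀ t, T ≤ t → ∀ s ∈ states (σ t).rules, IsLeast γ s := by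
    intro t ht s hs
    by_contra hs'
    exact (hT t ht).2 s hs ((h.reducible_iff (hT t ht).1 (h.inv t).rules.groupLabelled).2 hs')
  obtain ⟨e, he₁, he₂, -⟩ := h.exists_atPassEnd T
  filter_upwards [eventually_ge_atTop (e + 1)] with t ht
  refine ⟨(hT t (by omega)).1, hl t (by omega), ?_⟩
  induction t, ht using Nat.le_induction with
  | base =>
    rw [(h.steps e).eq_nextPass he₂]
    exact ⟨rfl, by simp [nextPass]⟩
  | succ t ht ih =>
    have hI := h.inv t
    have hs := h.steps t
    generalize σ (t + 1) = c at hs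
    cases hs with
    | minimize x hf hx =>
      have hx : x ∈ (σ t).store.all := by
        rw [Store.mem_all]
        rcases hx with hx | hx
        · exact Or.inl (hI.todo_subset hx)
        · exact Or.inr (Or.inr (Or.inl hx.2))
      obtain ⟨S', out, hS', hmin⟩ := hI.minimizes h.involutive h.map_inv hx
      have hrules : (minimizeRule ι (σ t) x).rules = (σ t).rules := rfl
      rw [hrules, minimizeRule_wdiff, hS']
      simp only
      split_ifs with hout
      · exact ih
      · have hE := (hT t (by omega)).1
        have hout' := h.isMinimal_out hE hI.rules.groupLabelled hmin hout
        obtain ⟨h₁, h₂⟩ := sew_of_walk (ι := ι) hI.wdiff (by rw [ih.1]; exact hl t (by omega))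
          (fun w => (rReduce (σ t).rules (S', w)).2) (leastRep_wordDiff_zero out)
          (hout'.walk_leastRep (by rw [ih.1]; exact hE))
          (leastRep_wordDiff_length hout'.sound.1)
        refine ⟨h₁.trans ih.1, fun b hb => ?_⟩
        rcases (h₂ b).1 hb with hb | ⟨i, a, ha, rfl⟩
        · exact ih.2 hb
        · exact ⟨out, hout', i, a, ha, rfl⟩
    | startComparing _ _ _ => exact ih
    | resolve p _ _ => exact ih
    | compare x _ _ _ => exact ih
    | nextPass _ _ _ => exact ⟨rfl, by simp [nextPass]⟩

/-- When the labels are least, minimizing a minimal rule marks the arrows of its path, and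
these stay marked until the pass ends. -/
theorem eventually_needed (hK : (limitArrows γ).Finite) :
    ∀ᶠ e in atTop, AtPassEnd (σ e) →
      ((σ e).wdiff.needed : Set (Arrow A)) = limitArrows γ := by
  obtain ⟨T, hT⟩ := eventually_atTop.1 (h.eventually_wdiff hK)
  have hout : ∀ t, T ≤ t → ∀ x out S', minimizeOut ι (σ t).rules (σ t).store x = (S', out) →
      IsMinimal γ out → ∀ b, b ∈ (minimizeRule ι (σ t) x).wdiff.needed ↔
        b ∈ (σ t).wdiff.needed ∨ ∃ i a, (pad out.1 out.2)[i]? = some a ∧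
          b = (leastRep γ (wordDiff γ out i), a, leastRep γ (wordDiff γ out (i + 1))) := by
    intro t ht x out S' hS' hmin
    obtain ⟨h₁, h₂, h₃, -⟩ := hT t ht
    have hne : out ≠ ([], []) := by
      rintro rfl
      exact lt_irrefl _ hmin.sound.2
    rw [minimizeRule_wdiff, hS']
    simp only
    rw [if_neg hne]
    exact (sew_of_walk (ι := ι) (h.inv t).wdiff (by rw [h₃]; exact h₂) _
      (leastRep_wordDiff_zero out) (hmin.walk_leastRep (by rw [h₃]; exact h₁))
      (leastRep_wordDiff_length hmin.sound.1)).2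
  have hmono : ∀ s t, T ≤ s → s ≤ t → (σ t).pass = (σ s).pass →
      (σ s).wdiff.needed ⊆ (σ t).wdiff.needed := by
    intro s t hs hst hpass
    induction t, hst using Nat.le_induction with
    | base => exact subset_rfl
    | succ t hst ih =>
      have hna := h.not_atPassEnd hst (Nat.lt_succ_self t) hpass
      have hstep := h.steps t
      refine (ih ((hstep.pass_eq hna).1.symm.trans hpass)).trans ?_
      generalize σ (t + 1) = c at hstep
      cases hstep with
      | minimize x hf hx =>
        have hx : x ∈ (σ t).store.all := by
          rw [Store.mem_all]
          rcases hx with hx | hx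
          · exact Or.inl ((h.inv t).todo_subset hx)
          · exact Or.inr (Or.inr (Or.inl hx.2))
        obtain ⟨S', out, hS', hmin⟩ := (h.inv t).minimizes h.involutive h.map_inv hx
        by_cases hne : out = ([], [])
        · rw [minimizeRule_wdiff, hS', if_pos hne]
        · have hout' := h.isMinimal_out (hT t (hs.trans hst)).1
            (h.inv t).rules.groupLabelled hmin hne
          exact fun b hb => (hout t (hs.trans hst) x out S' hS' hout' b).2 (Or.inl hb)
      | startComparing _ _ _ => exact subset_rfl
      | resolve p _ _ => exact subset_rfl
      | compare x _ _ _ => exact subset_rfl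
      | nextPass h₁ h₂ h₃ => exact absurd ⟨h₁, h₂, h₃⟩ hna
  have hsub : ∀ᶠ e in atTop, ∀ a ∈ limitArrows γ, AtPassEnd (σ e) →
      a ∈ (σ e).wdiff.needed := by
    rw [eventually_all_finite hK]
    rintro _ ⟨r, hr, i, b, hb, rfl⟩
    obtain ⟨T', hT'⟩ :=
      (h.eventually_exists_isMinimizedAt (h.mem_permanent_iff.2 hr)).exists
    filter_upwards [eventually_ge_atTop T', h.eventually_lt_pass (σ T).pass] with e he he' hend
    obtain ⟨s, h₁, h₂, h₃, h₄⟩ := hT'.2 e he hend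
    have hTs : T ≤ s := by
      by_contra! hlt
      have := h.pass_mono hlt.le
      omega
    obtain ⟨S', hS', -⟩ := h.minimizes_self_of_permanent h₃ h₄
    have hp : (σ (s + 1)).pass = (σ s).pass := by
      rw [h₄.succ]
      rfl
    refine hmono (s + 1) e (by omega) h₁ (h₂.symm.trans hp.symm) ?_
    rw [h₄.succ]
    exact (hout s hTs r r S' hS' hr _).2 (Or.inr ⟨i, b, hb, rfl⟩)
  filter_upwards [hsub, eventually_ge_atTop T] with e he hTe hend
  exact Set.Subset.antisymm (hT e hTe).2.2.2 fun a ha => he a ha hend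

theorem eventually_rules_eq (hK : (limitArrows γ).Finite) :
    ∀ᶠ t in atTop, ((σ t).rules : Set (Arrow A)) = limitArrows γ := by
  obtain ⟨T, hT⟩ := eventually_atTop.1 ((h.eventually_needed hK).and (h.eventually_wdiff hK))
  filter_upwards [h.eventually_lt_pass (σ T).pass] with t ht
  obtain ⟨e, h₁, -, h₃, h₄, h₅⟩ := h.exists_pass_start ht
  obtain ⟨h₆, -, hl, harr, -⟩ := hT e h₁
  have hsub := (h.inv e).wdiff.needed_subset
  have hnorm : normalize (σ e).store (σ e).wdiff.needed = (σ e).wdiff.needed := by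
    refine iterUntil_of_done fun s hs => ?_
    have hs' : IsLeast γ s := by
      refine hl s (mem_states.2 ((mem_states.1 hs).imp_right ?_))
      rintro ⟨a, ha, h'⟩
      exact ⟨a, harr ▸ hsub ha, h'⟩
    exact hs'.not_reducible fun r hr =>
      ((h.inv e).wdiff.isRuleAut.mono hsub).groupLabelled.sound hr
  rw [← h.rules_eq h₅, h₄, ← h₆ h₃]
  exact congrArg _ hnorm

end IsRun

/-! ### Finiteness of the limiting automaton -/

/-- The word differences are determined by the state reached in an automaton for multiplication
by generators, together with the generator. -/
theorem finite_wordDiff (hauto : IsShortlexAutomatic γ) :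
    {g | ∃ r, IsMinimal γ r ∧ ∃ i, g = wordDiff γ r i}.Finite := by
  obtain ⟨L, ⟨-, -, -, Q, _, M, hM⟩, hL⟩ := hauto
  have hL' : ∀ w, w ∈ L ↔ IsLeast γ w := by
    intro w
    rw [hL]
    refine forall₂_congr fun w' _ => ?_
    rw [← rank_lt_iff, not_lt]
  -- Some completion of the strings leading to the state `q`.
  have hc : ∀ q : Q, ∃ z, (∃ z', M.evalFrom q z' ∈ M.accept) → M.evalFrom q z ∈ M.accept := by
    intro q
    by_cases hq : ∃ z', M.evalFrom q z' ∈ M.accept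
    · exact ⟨hq.choose, fun _ => hq.choose_spec⟩
    · exact ⟨[], fun h => absurd h hq⟩
  choose c hc using hc
  refine Set.Finite.subset ((Set.finite_range fun p : Q × Option A =>
    val γ ((c p.1).filterMap Prod.fst) * val γ p.2.toList *
      (val γ ((c p.1).filterMap Prod.snd))⁻¹).insert 1) ?_
  rintro _ ⟨r, hr, i, rfl⟩
  have hne : r.1 ≠ [] := by
    intro h
    have := hr.sound.2
    rw [h, rank_nil] at this
    omega
  have hlen := length_le_of_rank_le hr.sound.2.le
  have hpos := List.length_pos_iff.2 hne
  by_cases hi : i ≤ r.1.dropLast.length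
  · right
    have htake : r.1.take i = r.1.dropLast.take i := by
      rw [List.dropLast_eq_take, List.take_take, min_eq_left]
      simpa using hi
    have hu : IsLeast γ r.1.dropLast := hr.proper _ (dropLast_infix _) fun h => by
      have := congrArg List.length h
      rw [List.length_dropLast] at this
      omega
    have hmem : pad r.1.dropLast r.2 ∈ M.accepts := by
      rw [hM]
      refine ⟨_, (hL' _).2 hu, _, (hL' _).2 hr.least, Or.inr ⟨r.1.getLast hne, ?_⟩, rfl⟩
      rw [List.dropLast_append_getLast hne, hr.sound.1]
    have hacc : M.evalFrom (M.eval (pad (r.1.dropLast.take i) (r.2.take i)))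
        ((pad r.1.dropLast r.2).drop i) ∈ M.accept := by
      rw [← take_pad]
      unfold DFA.eval
      rw [← DFA.evalFrom_of_append, List.take_append_drop]
      exact hmem
    set q := M.eval (pad (r.1.dropLast.take i) (r.2.take i)) with hq
    have hacc' := hc q ⟨_, hacc⟩
    have hmem' : pad (r.1.dropLast.take i) (r.2.take i) ++ c q ∈ M.accepts := by
      rw [DFA.mem_accepts]
      unfold DFA.eval
      rw [DFA.evalFrom_of_append]
      exact hacc'
    rw [hM] at hmem'
    obtain ⟨u', -, v', -, hval, heq⟩ := hmem'
    have h₁ := congrArg (List.filterMap Prod.fst) heq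
    have h₂ := congrArg (List.filterMap Prod.snd) heq
    rw [filterMap_fst_pad, List.filterMap_append, filterMap_fst_pad] at h₁
    rw [filterMap_snd_pad, List.filterMap_append, filterMap_snd_pad] at h₂
    have hval' : ∃ o : Option A, val γ u' * val γ o.toList = val γ v' := by
      rcases hval with h | ⟨x, h⟩
      · exact ⟨none, by simpa [val_nil] using h⟩
      · exact ⟨some x, by rw [← val_append]; exact h⟩
    obtain ⟨o, ho⟩ := hval'
    refine ⟨(q, o), ?_⟩
    rw [← h₁, ← h₂, val_append, val_append] at ho
    simp only [wordDiff, htake]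
    rw [eq_inv_mul_iff_mul_eq, ← mul_assoc, ← mul_assoc, mul_inv_eq_iff_eq_mul, ho]
  · left
    rw [List.length_dropLast] at hi
    rw [wordDiff, List.take_of_length_le (by omega), List.take_of_length_le (by omega),
      hr.sound.1, inv_mul_cancel]

theorem finite_limitArrows (hauto : IsShortlexAutomatic γ) : (limitArrows γ).Finite := by
  have hD := (finite_wordDiff hauto).image (leastRep γ)
  refine (hD.prod ((Set.finite_univ (α := Letter A)).prod hD)).subset ?_
  rintro _ ⟨r, hr, i, b, -, rfl⟩
  exact ⟨⟨_, ⟨r, hr, i, rfl⟩, rfl⟩, trivial, ⟨_, ⟨r, hr, i + 1, rfl⟩, rfl⟩⟩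

/-! ### The automata constructed from a rule automaton -/

theorem map_fst_pad {u v : List A} (h : v.length ≤ u.length) :
    (pad u v).map Prod.fst = u.map some := by
  induction u generalizing v with
  | nil =>
    obtain rfl : v = [] := List.eq_nil_of_length_eq_zero (by simpa using h)
    simp [pad]
  | cons x u ih =>
    rcases v with _ | ⟨y, v⟩
    · rw [pad_cons_nil, List.map_cons, ih (by simp), List.map_cons]
    · rw [pad_cons_cons, List.map_cons, ih (by simpa using h), List.map_cons]

theorem filterMap_fst_of_map_fst {z : List (Letter A)} {t : List A}
    (h : z.map Prod.fst = t.map some) : z.filterMap Prod.fst = t := by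
  have : z.filterMap Prod.fst = (z.map Prod.fst).filterMap id := by
    rw [List.filterMap_map]
    rfl
  rw [this, h, List.filterMap_map]
  simp

theorem sl2From_append_singleton (q : Option (Fin 5)) (z : List (Letter A)) (a : Letter A) :
    sl2From q (z ++ [a]) = (sl2From q z).bind fun q' => sl2Step q' a := by
  simp [sl2From]

theorem mem_states_target {E : RuleAut A} {s t : List A} {a : Letter A} (h : (s, a, t) ∈ E) :
    t ∈ states E :=
  mem_states.2 (Or.inr ⟨_, h, Or.inr rfl⟩)

theorem mem_states_of_eval {E : RuleAut A} {z : List (Letter A)} {t : List A}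
    (h : t ∈ (toNFA E).eval z) : t ∈ states E := by
  induction z using List.reverseRecOn with
  | nil => exact mem_states.2 (Or.inl (Set.mem_singleton_iff.1 h))
  | append_singleton z a _ =>
    rw [NFA.eval_append_singleton, NFA.mem_stepSet] at h
    obtain ⟨s, -, hs⟩ := h
    exact mem_states_target hs

theorem mem_toNFA_eval_append_singleton {E : RuleAut A} {z : List (Letter A)} {a : Letter A}
    {t : List A} : t ∈ (toNFA E).eval (z ++ [a]) ↔ ∃ s ∈ (toNFA E).eval z, (s, a, t) ∈ E := by
  rw [NFA.eval_append_singleton, NFA.mem_stepSet]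
  rfl

/-- The states of `redNFA M` within a left-hand side, after reading `w`. -/
theorem some_mem_redNFA_eval {M : RuleAut A} {w : List A} {s : {s : List A // s ∈ states M}}
    {q : Fin 5} : some (s, q) ∈ (redNFA M).eval w ↔ ∃ (x t : List A) (z : List (Letter A)),
      w = x ++ t ∧ z.map Prod.fst = t.map some ∧ s.1 ∈ (toNFA M).eval z ∧
        sl2From (some 0) z = some q := by
  induction w using List.reverseRecOn generalizing s q with
  | nil =>
    simp only [NFA.eval_nil]
    constructor
    · rintro ⟨s', hs', h⟩
      simp only [Option.some.injEq, Prod.mk.injEq] at h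
      obtain ⟨rfl, rfl⟩ := h
      exact ⟨[], [], [], rfl, rfl, by rw [hs']; rfl, rfl⟩
    · rintro ⟨x, t, z, hw, hz, hs, hq⟩
      obtain ⟨rfl, rfl⟩ := List.append_eq_nil_iff.1 hw.symm
      obtain rfl : z = [] := by simpa using hz
      have h0 : (0 : Fin 5) = q := by simpa [sl2From] using hq
      exact ⟨s, Set.mem_singleton_iff.1 hs, by rw [h0]⟩
  | append_singleton w a ih =>
    rw [NFA.eval_append_singleton, NFA.mem_stepSet]
    constructor
    · rintro ⟨_ | ⟨s', q'⟩, h₁, h₂⟩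
      · simp [redNFA] at h₂
      · rcases h₂ with ⟨h₂, h₃, h₄⟩ | ⟨y, s'', q'', h₂, h₃, h₄ | h₄⟩
        · simp only [Option.some.injEq, Prod.mk.injEq] at h₄
          obtain ⟨rfl, rfl⟩ := h₄
          exact ⟨w ++ [a], [], [], by simp, rfl, by rw [h₂]; rfl, by rw [h₃]; rfl⟩
        · simp only [Option.some.injEq, Prod.mk.injEq] at h₄
          obtain ⟨rfl, rfl⟩ := h₄
          obtain ⟨x, t, z, rfl, hz, hs, hq⟩ := ih.1 h₁
          refine ⟨x, t ++ [a], z ++ [(some a, y)], by simp, by simp [hz], ?_, ?_⟩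
          · exact mem_toNFA_eval_append_singleton.2 ⟨_, hs, h₂⟩
          · rw [sl2From_append_singleton, hq]
            exact h₃
        · simp at h₄
    · rintro ⟨x, t, z, hw, hz, hs, hq⟩
      rcases List.eq_nil_or_concat' z with rfl | ⟨z, b, rfl⟩
      · have hs' : s.1 = [] := Set.mem_singleton_iff.1 hs
        have h0 : (0 : Fin 5) = q := by simpa [sl2From] using hq
        refine ⟨some (s, q), ih.2 ⟨w, [], [], by simp, rfl, hs, hq⟩, Or.inl ⟨hs', h0.symm, rfl⟩⟩
      · rcases List.eq_nil_or_concat' t with rfl | ⟨t, a', rfl⟩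
        · simp at hz
        · rw [List.map_append, List.map_append] at hz
          obtain ⟨hz', hb⟩ := List.append_inj' hz (by simp)
          obtain ⟨b₁, b₂⟩ := b
          simp only [List.map_cons, List.map_nil, List.cons.injEq, and_true] at hb
          subst hb
          rw [← List.append_assoc] at hw
          obtain ⟨rfl, ha⟩ := List.append_inj' hw (by simp)
          simp only [List.cons.injEq, and_true] at ha
          subst ha
          obtain ⟨s', hs', harr⟩ := mem_toNFA_eval_append_singleton.1 hs
          rw [sl2From_append_singleton, Option.bind_eq_some_iff] at hq
          obtain ⟨q', hq', hstep⟩ := hq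
          exact ⟨some (⟨s', mem_states_of_eval hs'⟩, q'), ih.2 ⟨x, t, z, rfl, hz', hs', hq'⟩,
            Or.inr ⟨b₂, s, q, harr, hstep, Or.inl rfl⟩⟩

theorem reducible_append_singleton {T : Set (Rule A)} {w : List A} {a : A} :
    Reducible T (w ++ [a]) ↔ Reducible T w ∨ ∃ r ∈ T, r.1 <:+ w ++ [a] := by
  constructor
  · rintro ⟨r, hr, hrw⟩
    rcases List.infix_concat_iff.1 hrw with h | h
    · exact Or.inr ⟨r, hr, h⟩
    · exact Or.inl ⟨r, hr, h⟩
  · rintro (h | ⟨r, hr, hrw⟩)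
    · exact h.mono (List.prefix_append _ _).isInfix
    · exact ⟨r, hr, hrw.isInfix⟩

/-- `redNFA M` reads left-hand sides of rules of `Set(M)` as the first components of the padded
pairs. -/
theorem mem_ruleSet_iff_sl2From {M : RuleAut A} {t : List A} : (∃ r ∈ ruleSet M, r.1 = t) ↔
    ∃ z : List (Letter A), z.map Prod.fst = t.map some ∧ [] ∈ (toNFA M).eval z ∧
      ∃ q ∈ sl2Final, sl2From (some 0) z = some q := by
  constructor
  · rintro ⟨r, ⟨h₁, h₂⟩, rfl⟩
    have hb := (pad_mem_SL2_iff _ _).1 h₂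
    refine ⟨pad r.1 r.2, map_fst_pad (length_le_of_rank_le hb.1.le), ?_,
      (mem_accepts_SL2 _).1 h₂⟩
    obtain ⟨s, hs, hs'⟩ := NFA.mem_accepts.1 h₁
    rwa [← Set.mem_singleton_iff.1 hs]
  · rintro ⟨z, hz, hs, hq⟩
    obtain ⟨u, v, rfl, hb⟩ := (sl2Accepts_zero z).1 hq
    have hu := filterMap_fst_of_map_fst hz
    rw [filterMap_fst_pad] at hu
    exact ⟨(u, v), ⟨NFA.mem_accepts.2 ⟨[], rfl, hs⟩, (mem_accepts_SL2 _).2 hq⟩, hu⟩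

theorem none_mem_redNFA_eval {M : RuleAut A} {w : List A} :
    none ∈ (redNFA M).eval w ↔ Reducible (ruleSet M) w := by
  induction w using List.reverseRecOn with
  | nil =>
    simp only [NFA.eval_nil]
    constructor
    · rintro ⟨s, -, h⟩
      simp at h
    · rintro ⟨r, hr, hrw⟩
      have h₁ := (mem_ruleSet.1 hr).1.1
      rw [List.infix_nil.1 hrw, rank_nil] at h₁
      omega
  | append_singleton w a ih =>
    rw [NFA.eval_append_singleton, NFA.mem_stepSet, reducible_append_singleton]
    constructor
    · rintro ⟨_ | ⟨s, q⟩, h₁, h₂⟩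
      · exact Or.inl (ih.1 h₁)
      · right
        rcases h₂ with ⟨-, -, h₂⟩ | ⟨y, s', q', harr, hstep, h₂ | ⟨hs', hq', -⟩⟩
        · simp at h₂
        · simp at h₂
        · obtain ⟨x, t, z, rfl, hz, hs, hq⟩ := some_mem_redNFA_eval.1 h₁
          rw [hs'] at harr
          obtain ⟨r, hr, hrt⟩ := mem_ruleSet_iff_sl2From.2 ⟨z ++ [(some a, y)],
            show _ = (t ++ [a]).map some by simp [hz],
            mem_toNFA_eval_append_singleton.2 ⟨_, hs, harr⟩, q', hq', by
              rw [sl2From_append_singleton, hq]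
              exact hstep⟩
          exact ⟨r, hr, x, by rw [hrt, List.append_assoc]⟩
    · rintro (h | ⟨r, hr, x, hx⟩)
      · exact ⟨none, ih.2 h, rfl⟩
      · obtain ⟨z, hz, hs, q, hq, hzq⟩ := mem_ruleSet_iff_sl2From.1 ⟨r, hr, rfl⟩
        rcases List.eq_nil_or_concat' r.1 with hr₁ | ⟨t, a', hr₁⟩
        · have h₁ := (mem_ruleSet.1 hr).1.1
          rw [hr₁, rank_nil] at h₁
          omega
        · rcases List.eq_nil_or_concat' z with rfl | ⟨z, b, rfl⟩
          · simp [hr₁] at hz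
          · rw [hr₁, List.map_append, List.map_append] at hz
            obtain ⟨hz', hb⟩ := List.append_inj' hz (by simp)
            obtain ⟨b₁, b₂⟩ := b
            simp only [List.map_cons, List.map_nil, List.cons.injEq, and_true] at hb
            subst hb
            rw [hr₁, ← List.append_assoc] at hx
            obtain ⟨rfl, ha⟩ := List.append_inj' hx (by simp)
            simp only [List.cons.injEq, and_true] at ha
            subst ha
            obtain ⟨s', hs', harr⟩ := mem_toNFA_eval_append_singleton.1 hs
            rw [sl2From_append_singleton, Option.bind_eq_some_iff] at hzq
            obtain ⟨q', hq', hstep⟩ := hzq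
            exact ⟨some (⟨s', mem_states_of_eval hs'⟩, q'),
              some_mem_redNFA_eval.2 ⟨x, t, z, rfl, hz', hs', hq'⟩,
              Or.inr ⟨b₂, ⟨[], mem_states.2 (Or.inl rfl)⟩, q, harr, hstep,
                Or.inr ⟨rfl, hq, rfl⟩⟩⟩

theorem redDFA_eval_mem_accept {M : RuleAut A} {w : List A} :
    (redDFA M).eval w ∈ (redDFA M).accept ↔ Reducible (ruleSet M) w := by
  rw [← none_mem_redNFA_eval, ← DFA.mem_accepts, NFA.toDFA_correct, NFA.mem_accepts]
  constructor
  · rintro ⟨s, hs, h⟩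
    rwa [← Set.mem_singleton_iff.1 hs]
  · exact fun h => ⟨none, rfl, h⟩

theorem permanentDFA_eval_snd {M : RuleAut A} (z : List (Letter A)) :
    ((permanentDFA M).eval z).2.1 = sl2From (some 0) z := by
  induction z using List.reverseRecOn with
  | nil => rfl
  | append_singleton z a ih =>
    rw [DFA.eval_append_singleton, sl2From_append_singleton, ← ih]
    obtain ⟨_ | x, y⟩ := a
    · have : ∀ q : Fin 5, sl2Step q ((none, y) : Letter A) = none := by
        intro q
        fin_cases q <;> rfl
      simp only [this, permanentDFA, Option.bind_fun_none]
    · rfl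

theorem permanentDFA_eval {M : RuleAut A} {z : List (Letter A)} {u : List A}
    (hz : z.map Prod.fst = u.map some) : (permanentDFA M).eval z =
      ({t | t.1 ∈ (toNFA M).eval z}, sl2From (some 0) z, (redDFA M).eval (z.filterMap Prod.snd),
        (redDFA M).eval u, (redDFA M).eval u.dropLast,
        if u = [] then none else some ((redDFA M).eval u.tail)) := by
  induction z using List.reverseRecOn generalizing u with
  | nil =>
    obtain rfl : u = [] := by simpa using hz.symm
    rfl
  | append_singleton z b ih =>
    rcases List.eq_nil_or_concat' u with rfl | ⟨u, a, rfl⟩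
    · simp at hz
    · rw [List.map_append, List.map_append] at hz
      obtain ⟨hz', hb⟩ := List.append_inj' hz (by simp)
      obtain ⟨b₁, b₂⟩ := b
      simp only [List.map_cons, List.map_nil, List.cons.injEq, and_true] at hb
      subst hb
      rw [DFA.eval_append_singleton, ih hz', sl2From_append_singleton]
      refine Prod.ext ?_ (Prod.ext rfl (Prod.ext ?_ (Prod.ext ?_ (Prod.ext ?_ ?_))))
      · refine Set.ext fun t => ?_
        simp only [Set.mem_ofPred_eq, mem_toNFA_eval_append_singleton]
        constructor
        · rintro ⟨s, hs, h⟩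
          exact ⟨s, hs, h⟩
        · rintro ⟨s, hs, h⟩
          exact ⟨⟨s, mem_states_of_eval hs⟩, hs, h⟩
      · rcases b₂ with _ | y
        · simp only [List.filterMap_append, List.filterMap_cons, List.filterMap_nil,
            List.append_nil]
          rfl
        · simp only [List.filterMap_append, List.filterMap_cons, List.filterMap_nil,
            DFA.eval_append_singleton]
          rfl
      · simp only [DFA.eval_append_singleton]
        rfl
      · change (redDFA M).eval u = (redDFA M).eval (u ++ [a]).dropLast
        rw [List.dropLast_concat]
      · rcases u with _ | ⟨x, u⟩
        · rw [if_pos rfl, if_neg (by simp)]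
          rfl
        · rw [if_neg (by simp), if_neg (by simp)]
          simp only [List.cons_append, List.tail_cons, DFA.eval_append_singleton]
          rfl

theorem mem_permanentDFA_accepts {M : RuleAut A} {z : List (Letter A)} :
    z ∈ (permanentDFA M).accepts ↔ ∃ r ∈ ruleSet M, z = pad r.1 r.2 ∧
      ¬ Reducible (ruleSet M) r.2 ∧ ¬ Reducible (ruleSet M) r.1.dropLast ∧
      ¬ Reducible (ruleSet M) r.1.tail := by
  have key : ∀ u v, Balanced u v → (pad u v ∈ (permanentDFA M).accepts ↔
      [] ∈ (toNFA M).eval (pad u v) ∧ ¬ Reducible (ruleSet M) v ∧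
      ¬ Reducible (ruleSet M) u.dropLast ∧ ¬ Reducible (ruleSet M) u.tail) := by
    intro u v hb
    have hu : u ≠ [] := by
      rintro rfl
      have := hb.1
      rw [rank_nil] at this
      omega
    have hq : ∃ q ∈ sl2Final, sl2From (some 0) (pad u v) = some q :=
      (sl2Accepts_zero _).2 ⟨u, v, rfl, hb⟩
    rw [DFA.mem_accepts, permanentDFA_eval (map_fst_pad (length_le_of_rank_le hb.1.le)),
      filterMap_snd_pad, if_neg hu]
    simp only [permanentDFA, Set.mem_ofPred_eq, redDFA_eval_mem_accept, Option.some.injEq]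
    constructor
    · rintro ⟨⟨s, hs, hs'⟩, -, h₁, h₂, d, hd, rfl⟩
      rw [hs'] at hs
      exact ⟨hs, h₁, h₂, fun h => hd (redDFA_eval_mem_accept.2 h)⟩
    · rintro ⟨hs, h₁, h₂, h₃⟩
      exact ⟨⟨⟨[], mem_states.2 (Or.inl rfl)⟩, hs, rfl⟩, hq, h₁, h₂, _,
        fun h => h₃ (redDFA_eval_mem_accept.1 h), rfl⟩
  constructor
  · intro hz
    obtain ⟨q, hq, hzq⟩ := ((permanentDFA M).mem_accepts.1 hz).2.1
    rw [permanentDFA_eval_snd] at hzq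
    obtain ⟨u, v, rfl, hb⟩ := (sl2Accepts_zero z).1 ⟨q, hq, hzq⟩
    obtain ⟨h₁, h₂⟩ := (key u v hb).1 hz
    exact ⟨(u, v), ⟨NFA.mem_accepts.2 ⟨[], rfl, h₁⟩, (pad_mem_SL2_iff _ _).2 hb⟩, rfl, h₂⟩
  · rintro ⟨r, hr, rfl, h⟩
    refine (key _ _ (mem_ruleSet.1 hr).1).2 ⟨?_, h⟩
    obtain ⟨s, hs, hs'⟩ := NFA.mem_accepts.1 hr.1
    rwa [← Set.mem_singleton_iff.1 hs]

/-! ### The initial rules present the group -/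

theorem Thue.refl {T : Set (Rule A)} (u : List A) : Thue T u u := Relation.EqvGen.refl u

theorem Thue.symm {T : Set (Rule A)} {u v : List A} (h : Thue T u v) : Thue T v u :=
  Relation.EqvGen.symm _ _ h

theorem Thue.trans {T : Set (Rule A)} {u v w : List A} (h₁ : Thue T u v) (h₂ : Thue T v w) :
    Thue T u w :=
  Relation.EqvGen.trans _ _ _ h₁ h₂

theorem Thue.of_rule {T : Set (Rule A)} {r : Rule A} (h : r ∈ T) : Thue T r.1 r.2 :=
  Relation.EqvGen.rel _ _ ⟨[], [], r, h, by simp, by simp⟩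

theorem Thue.append {T : Set (Rule A)} {u v : List A} (h : Thue T u v) (x y : List A) :
    Thue T (x ++ u ++ y) (x ++ v ++ y) := by
  induction h with
  | rel u v h => exact Relation.EqvGen.rel _ _ (h.append x y)
  | refl u => exact Thue.refl _
  | symm u v _ ih => exact ih.symm
  | trans u v w _ _ ih₁ ih₂ => exact ih₁.trans ih₂

theorem Thue.conn {T : Set (Rule A)} {u v : List A} (h : Thue T u v) : ∃ n, Conn T n u v := by
  induction h with
  | rel u v h =>
    exact ⟨max (rank u) (rank v) + 1, Relation.ReflTransGen.single
      ⟨Nat.lt_succ_of_le (le_max_left _ _), Nat.lt_succ_of_le (le_max_right _ _), Or.inl h⟩⟩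
  | refl u => exact ⟨0, Conn.refl u⟩
  | symm u v _ ih =>
    obtain ⟨n, hn⟩ := ih
    exact ⟨n, hn.symm⟩
  | trans u v w _ _ ih₁ ih₂ =>
    obtain ⟨n, hn⟩ := ih₁
    obtain ⟨m, hm⟩ := ih₂
    exact ⟨max n m, (hn.mono subset_rfl (le_max_left _ _)).trans
      (hm.mono subset_rfl (le_max_right _ _))⟩

theorem of_isRotated {P : List A → Prop} (hP : ∀ p q, P (p ++ q) → P (q ++ p)) {l l' : List A}
    (h : l ~r l') (hl : P l) : P l' := by
  obtain ⟨n, rfl⟩ := h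
  rw [List.rotate_eq_drop_append_take_mod]
  apply hP
  rwa [List.take_append_drop]

theorem inv_append (u v : List A) : inv ι (u ++ v) = inv ι v ++ inv ι u := by
  simp [inv]

theorem inv_inv (hι : Function.Involutive ι) (u : List A) : inv ι (inv ι u) = u := by
  simp [inv, List.map_reverse, hι.comp_self]

theorem val_inv (hγ : ∀ x, γ (ι x) = (γ x)⁻¹) (u : List A) : val γ (inv ι u) = (val γ u)⁻¹ := by
  induction u with
  | nil => simp [inv, val_nil]
  | cons x u ih =>
    rw [show x :: u = [x] ++ u from rfl, inv_append, val_append, val_append, ih, mul_inv_rev]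
    simp [inv, val, hγ]

theorem exists_isCyclicReduction (ι : A → A) (w : List A) : ∃ c, IsCyclicReduction ι w c := by
  induction hn : w.length using Nat.strong_induction_on generalizing w with
  | _ n ih =>
  by_cases hw : ∃ w', CyclicStep ι w w'
  · obtain ⟨w', hw'⟩ := hw
    have hlt : w'.length < n := by
      rcases hw' with ⟨p, q, x, rfl, rfl⟩ | ⟨m, x, rfl, rfl⟩
      · simp only [List.length_append, List.length_cons, List.length_nil] at hn ⊢
        omega
      · simp only [List.length_append, List.length_cons, List.length_nil] at hn
        omega
    obtain ⟨c, hc, hc'⟩ := ih _ hlt w' rfl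
    exact ⟨c, hc.head hw', hc'⟩
  · exact ⟨w, Relation.ReflTransGen.refl, fun c hc => hw ⟨c, hc⟩⟩

theorem val_eq_one_of_cyclicStep (hγ : ∀ x, γ (ι x) = (γ x)⁻¹) {w w' : List A}
    (h : CyclicStep ι w w') (hw : val γ w = 1) : val γ w' = 1 := by
  rcases h with ⟨p, q, x, rfl, rfl⟩ | ⟨m, x, rfl, rfl⟩
  · rw [val_append, val_append] at hw
    rw [val_append, ← hw]
    simp [val, hγ]
  · rw [val_append, val_append] at hw
    have hx : val γ [x] = γ x := by simp [val]
    have hx' : val γ [ι x] = (γ x)⁻¹ := by simp [val, hγ]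
    rwa [hx, hx', conj_eq_one_iff] at hw

theorem val_eq_of_ruleOfRelator (hγ : ∀ x, γ (ι x) = (γ x)⁻¹) {c : List A} (hc : val γ c = 1)
    {r : Rule A} (hr : RuleOfRelator ι c r) : val γ r.1 = val γ r.2 := by
  have hP : ∀ p q : List A, val γ (p ++ q) = 1 → val γ (q ++ p) = 1 := by
    intro p q h
    rw [val_append] at h ⊢
    exact mul_eq_one_comm.1 h
  have h : val γ (r.1 ++ inv ι r.2) = 1 := by
    rcases hr.2 with h | h
    · exact of_isRotated (P := fun w => val γ w = 1) hP h.symm hc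
    · exact of_isRotated (P := fun w => val γ w = 1) hP h.symm (by rw [val_inv hγ, hc, inv_one])
  rw [val_append, val_inv hγ] at h
  exact mul_inv_eq_one.1 h

section Special

variable {T : Set (Rule A)}

theorem thue_append_inv (h : ∀ x : A, ([x, ι x], []) ∈ T) (u : List A) :
    Thue T (u ++ inv ι u) [] := by
  induction u using List.reverseRecOn with
  | nil => exact Thue.refl _
  | append_singleton u x ih =>
    have h₁ := (Thue.of_rule (h x)).append u (inv ι u)
    have h₂ : u ++ [x] ++ inv ι (u ++ [x]) = u ++ [x, ι x] ++ inv ι u := by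
      rw [inv_append]
      simp [inv]
    rw [h₂]
    exact h₁.trans (by simpa using ih)

theorem thue_inv_append (hι : Function.Involutive ι) (h : ∀ x : A, ([ι x, x], []) ∈ T)
    (u : List A) : Thue T (inv ι u ++ u) [] := by
  have := thue_append_inv (ι := ι) (T := T)
    (fun x => by simpa [hι x] using h (ι x)) (inv ι u)
  rwa [inv_inv hι] at this

theorem thue_nil_rotate (h : ∀ x : A, ([x, ι x], []) ∈ T) {p q : List A}
    (hpq : Thue T (p ++ q) []) : Thue T (q ++ p) [] := by
  have h₁ := ((thue_append_inv h q).append (q ++ p) []).symm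
  have h₂ := hpq.append q (inv ι q)
  simp only [List.append_nil, List.append_assoc] at h₁ h₂
  exact (h₁.trans h₂).trans (by simpa using thue_append_inv h q)

theorem thue_nil_inv (h : ∀ x : A, ([x, ι x], []) ∈ T) {u : List A} (hu : Thue T u []) :
    Thue T (inv ι u) [] := by
  have h₁ := (hu.append [] (inv ι u)).symm
  simp only [List.nil_append] at h₁
  exact h₁.trans (thue_append_inv h u)

theorem thue_nil_of_cyclicStep (h : ∀ x : A, ([x, ι x], []) ∈ T) {w w' : List A}
    (hw : CyclicStep ι w w') (hw' : Thue T w' []) : Thue T w [] := by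
  rcases hw with ⟨p, q, x, rfl, rfl⟩ | ⟨m, x, rfl, rfl⟩
  · have h₁ := (Thue.of_rule (h x)).append p q
    exact h₁.trans (by simpa using hw')
  · exact (hw'.append [x] [ι x]).trans (Thue.of_rule (h x))

theorem thue_of_relator (hι : Function.Involutive ι)
    (h : ∀ x : A, ([x, ι x], []) ∈ T ∧ ([ι x, x], []) ∈ T) {R : Set (Rule A)}
    (hR : ∀ e ∈ R, ∀ c : List A, IsCyclicReduction ι (e.1 ++ inv ι e.2) c → c ≠ [] →
      ∃ r ∈ T, RuleOfRelator ι c r) {e : Rule A} (he : e ∈ R) : Thue T e.1 e.2 := by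
  have h' : ∀ x : A, ([x, ι x], []) ∈ T := fun x => (h x).1
  obtain ⟨c, hc⟩ := exists_isCyclicReduction ι (e.1 ++ inv ι e.2)
  have hc' : Thue T c [] := by
    by_cases hn : c = []
    · rw [hn]
      exact Thue.refl _
    · obtain ⟨r, hr, hrel⟩ := hR e he c hc hn
      have h₁ : Thue T (r.1 ++ inv ι r.2) [] := by
        have := (Thue.of_rule hr).append [] (inv ι r.2)
        exact this.trans (thue_append_inv h' r.2)
      rcases hrel.2 with h₂ | h₂
      · exact of_isRotated (P := fun w => Thue T w []) (fun p q => thue_nil_rotate h') h₂ h₁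
      · have := thue_nil_inv h'
          (of_isRotated (P := fun w => Thue T w []) (fun p q => thue_nil_rotate h') h₂ h₁)
        rwa [inv_inv hι] at this
  have hw : Thue T (e.1 ++ inv ι e.2) [] := by
    obtain ⟨hc, -⟩ := hc
    clear hR
    generalize e.1 ++ inv ι e.2 = w at hc
    induction hc using Relation.ReflTransGen.head_induction_on with
    | refl => exact hc'
    | head hs _ ih => exact thue_nil_of_cyclicStep h' hs ih
  have h₁ := (hw.append [] e.2)
  have h₂ := (thue_inv_append hι (fun x => (h x).2) e.2).append e.1 []
  simp only [List.nil_append, List.append_nil, List.append_assoc] at h₁ h₂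
  exact h₂.symm.trans h₁

end Special

/-! ### The initial configuration -/

theorem groupLabelled_initialUnion {I : Finset (Rule A)} {ℓ : Rule A → ℕ → List A}
    (hℓ : IsInitialLabelling γ I ℓ) (hI : ∀ r ∈ I, val γ r.1 = val γ r.2) :
    GroupLabelled γ (initialUnion I ℓ) := by
  have hval : ∀ r ∈ I, ∀ i, i ≤ (pad r.1 r.2).length → val γ (ℓ r i) = wordDiff γ r i := by
    intro r hr i hi
    rcases Nat.eq_zero_or_pos i with rfl | hpos
    · simp [(hℓ.1 r hr).1, wordDiff, val_nil]
    · rcases hi.eq_or_lt with rfl | hlt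
      · rw [(hℓ.1 r hr).2, wordDiff, length_pad, List.take_of_length_le (le_max_left _ _),
          List.take_of_length_le (le_max_right _ _), hI r hr, inv_mul_cancel, val_nil]
      · exact (hℓ.2 r hr i hpos hlt).2.1
  intro a ha
  simp only [initialUnion, Finset.mem_biUnion, List.mem_toFinset, List.mem_map] at ha
  obtain ⟨r, hr, ⟨b, i⟩, hb, rfl⟩ := ha
  rw [List.mk_mem_zipIdx_iff_getElem?] at hb
  have hi : i < (pad r.1 r.2).length := (List.getElem?_eq_some_iff.1 hb).1
  obtain rfl := ((getElem?_pad _ _ _ _).1 hb).2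
  simp only
  rw [hval r hr _ hi, hval r hr _ hi.le, wordDiff, wordDiff, val_take_succ, val_take_succ]
  group

theorem isRun_run (hι : Function.Involutive ι) {R : Finset (Rule A)}
    (hR : ∀ x : A, ([x, ι x], []) ∈ R ∧ ([ι x, x], []) ∈ R)
    (hpres : IsPresentation γ (R : Set (Rule A))) {I : Finset (Rule A)}
    (hI : IsInitialRules ι R I) {ℓ : Rule A → ℕ → List A} (hℓ : IsInitialLabelling γ I ℓ)
    {pick : ℕ → Finset (List A × List A) → List A × List A}
    (hpick : ∀ (t : ℕ) (s : Finset (List A × List A)), s.Nonempty → pick t s ∈ s) :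
    IsRun γ ι (run ι I ℓ pick) := by
  have hγ : ∀ x, γ (ι x) = (γ x)⁻¹ := by
    intro x
    have := (hpres.2 _ _).2 (Thue.of_rule (hR x).1)
    simp only [val, List.map_cons, List.map_nil, List.prod_cons, List.prod_nil, mul_one] at this
    exact eq_inv_of_mul_eq_one_right this
  have hspecial : ∀ x, val γ [x, ι x] = val γ [] ∧ val γ [ι x, x] = val γ [] :=
    fun x => ⟨(hpres.2 _ _).2 (Thue.of_rule (hR x).1), (hpres.2 _ _).2 (Thue.of_rule (hR x).2)⟩
  have hsound : ∀ r ∈ I, Sound γ r := by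
    intro r hr
    rcases hI.2.2 r hr with ⟨x, rfl | rfl⟩ | ⟨e, he, c, hc, -, hrel⟩
    · exact ⟨(hspecial x).1, rank_lt_of_length_lt (by simp)⟩
    · exact ⟨(hspecial x).2, rank_lt_of_length_lt (by simp)⟩
    · refine ⟨val_eq_of_ruleOfRelator hγ ?_ hrel, ((pad_mem_SL2_iff _ _).1 hrel.1).1⟩
      have he' : val γ (e.1 ++ inv ι e.2) = 1 := by
        rw [val_append, val_inv hγ, (hpres.2 _ _).2 (Thue.of_rule he), mul_inv_cancel]
      obtain ⟨hc, -⟩ := hc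
      clear hrel
      induction hc with
      | refl => exact he'
      | tail _ hs ih => exact val_eq_one_of_cyclicStep hγ hs ih
  have hall : ∀ r, r ∈ (run ι I ℓ pick 0).store.all ↔ r ∈ I := by
    intro r
    rw [Store.mem_all]
    simp [run, initialConfig]
  have hall' : ((run ι I ℓ pick 0).store.all : Set (Rule A)) = (I : Set (Rule A)) :=
    Set.ext hall
  have hU := groupLabelled_initialUnion hℓ fun r hr => (hsound r hr).1
  have hM : IsRuleAut γ (weldImage (initialUnion I ℓ) ([], []) (initialUnion I ℓ)) :=
    ⟨groupLabelled_weldImage hU rfl, deterministic_weldImage, noInitialDiag_weldImage⟩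
  refine ⟨hι, hγ, ⟨fun r hr => hsound r ((hall r).1 hr), ?_, ?_, ?_, ?_, ?_, ?_, ?_, hM,
    ⟨hM, subset_rfl⟩, ⟨_, Folds.id _⟩, ?_, ?_, ?_⟩, fun u v huv => ?_,
    fun t => steps_step _ _ (hpick t)⟩
  · simp [run, initialConfig]
  · simp [run, initialConfig]
  · simp [run, initialConfig]
  · simp [run, initialConfig]
  · simp [run, initialConfig]
  · simp [run, initialConfig]
  · simp [run, initialConfig]
  · intro x
    rw [hall']
    exact Conn.of_rule (r := ([x, ι x], [])) (hI.1 x).1 (Nat.lt_succ_self _)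
      (Nat.lt_succ_of_le (by simp only [rank_nil]; exact Nat.zero_le _))
  · simp [run, initialConfig]
  · simp [run, initialConfig]
  · rw [hall']
    apply Thue.conn
    have hthue := (hpres.2 u v).1 huv
    clear huv
    induction hthue with
    | rel u v h =>
      obtain ⟨x, y, e, he, rfl, rfl⟩ := h
      exact (thue_of_relator hι (T := (I : Set (Rule A))) hI.1 hI.2.1 he).append x y
    | refl u => exact Thue.refl u
    | symm u v _ ih => exact ih.symm
    | trans u v w _ _ ih₁ ih₂ => exact ih₁.trans ih₂

end

end KnuthBendix

open KnuthBendix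

theorem mainTheorem1 {A : Type*} [Fintype A] [LinearOrder A] {G : Type*} [Group G]
    (γ : A → G) (ι : A → A) (hι : Function.Involutive ι)
    (R : Finset (KnuthBendix.Rule A))
    (hR : ∀ x : A, ([x, ι x], []) ∈ R ∧ ([ι x, x], []) ∈ R)
    (hpres : KnuthBendix.IsPresentation γ (R : Set (KnuthBendix.Rule A)))
    (hauto : KnuthBendix.IsShortlexAutomatic γ)
    (I : Finset (KnuthBendix.Rule A)) (hI : KnuthBendix.IsInitialRules ι R I)
    (ℓ : KnuthBendix.Rule A → ℕ → List A) (hℓ : KnuthBendix.IsInitialLabelling γ I ℓ)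
    (pick : ℕ → Finset (List A × List A) → List A × List A)
    (hpick : ∀ (t : ℕ) (s : Finset (List A × List A)), s.Nonempty → pick t s ∈ s) :
    ∃ Rules : ℕ → KnuthBendix.RuleAut A,
      (∀ t : ℕ, (KnuthBendix.run ι I ℓ pick t).rules =
        Rules (KnuthBendix.run ι I ℓ pick t).pass) ∧
      (∀ n : ℕ, 1 ≤ n → ∃ t : ℕ, (KnuthBendix.run ι I ℓ pick t).pass = n) ∧
      ∃ n₀ : ℕ, 1 ≤ n₀ ∧ (∀ n : ℕ, n₀ ≤ n → Rules (n + 1) = Rules n) ∧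
        Finite (KnuthBendix.PermState (Rules n₀)) ∧
        ((KnuthBendix.permanentDFA (Rules n₀)).accepts : Set (List (KnuthBendix.Letter A))) =
          {z | ∃ r ∈ KnuthBendix.limitRules (KnuthBendix.run ι I ℓ pick),
            z = KnuthBendix.pad r.1 r.2} := by
  classical
  have h := isRun_run hι hR hpres hI hℓ hpick
  have hK := finite_limitArrows hauto
  set σ := run ι I ℓ pick with hσ
  have hp₀ : (σ 0).pass = 1 := rfl
  have hRules : ∀ t, (σ t).rules =
      (if hn : ∃ s, (σ s).pass = (σ t).pass then (σ hn.choose).rules else ∅ : RuleAut A) := by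
    intro t
    have hn : ∃ s, (σ s).pass = (σ t).pass := ⟨t, rfl⟩
    rw [dif_pos hn]
    exact h.rules_eq hn.choose_spec.symm
  have hpass : ∀ n, 1 ≤ n → ∃ t, (σ t).pass = n := fun n hn => h.exists_pass_eq hn
  obtain ⟨T, hT⟩ := Filter.eventually_atTop.1 (h.eventually_rules_eq hK)
  have hlimit : ∀ t, (σ T).pass ≤ (σ t).pass → ((σ t).rules : Set (Arrow A)) = limitArrows γ := by
    intro t ht
    rcases le_total T t with h' | h'
    · exact hT t h'
    · rw [h.rules_eq (le_antisymm (h.pass_mono h') ht)]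
      exact hT T le_rfl
  refine ⟨fun n => if hn : ∃ s, (σ s).pass = n then (σ hn.choose).rules else ∅, hRules, hpass,
    (σ T).pass, hp₀ ▸ h.pass_mono (Nat.zero_le T), ?_, ?_, ?_⟩
  · intro n hn
    have h₁ := h.pass_mono (Nat.zero_le T)
    obtain ⟨t, rfl⟩ := hpass n (by omega)
    obtain ⟨t', ht'⟩ := hpass ((σ t).pass + 1) (by omega)
    simp only
    rw [← hRules t, ← ht', ← hRules t', ← Finset.coe_inj, hlimit t hn, hlimit t' (by omega)]
  · infer_instance
  · simp only
    rw [← hRules T]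
    have hsub := (hlimit T le_rfl).ge
    have hgl := (h.inv T).rules.groupLabelled
    rw [h.limitRules_eq hK]
    ext z
    rw [mem_permanentDFA_accepts]
    simp only [h.reducible_iff hsub hgl, not_not]
    constructor
    · rintro ⟨r, hr, rfl, h₁, h₂, h₃⟩
      refine ⟨r, ⟨hgl.sound hr, fun w hw hne => ?_, h₁⟩, rfl⟩
      rcases infix_dropLast_or_infix_tail hw hne with hw' | hw'
      · exact h₂.of_infix hw'
      · exact h₃.of_infix hw'
    · rintro ⟨r, hr, rfl⟩
      have hne : r.1 ≠ [] := by
        intro hn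
        have := hr.sound.2
        rw [hn, rank_nil] at this
        omega
      refine ⟨r, h.mem_ruleSet_of_isMinimal hsub hr, rfl, hr.least,
        hr.proper _ (dropLast_infix _) fun he => ?_, hr.proper _ (tail_infix _) fun he => ?_⟩
      · have := rank_dropLast_lt hne
        rw [he] at this
        exact lt_irrefl _ this
      · have := rank_tail_lt hne
        rw [he] at this
        exact lt_irrefl _ this
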